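/- **Proposition 4.1.** Let $N$ be a compact connected complex manifold, let $E_0$ and $E_\infty$ be holomorphic vector bundles on $N$ of ranks $d_0+1$ and $d_\infty+1$ with $d_0,d_\infty\ge 0$, and let $\pi_N\colon N^{ad}=\mathbb P(E_0\oplus E_\infty)\to N$ be the bundle of complex lines in $E_0\oplus E_\infty$. Let $\omega$ be a Kähler form on the complex manifold $N^{ad}$, and let $\pi_M\colon M\to N^{ad}$ be a Boothby–Wang Sasaki bundle over $(N^{ad},\omega)$, that is, a smooth principal circle bundle with a connection form $\eta$ (a smooth $S^1$-invariant real $1$-form on $M$ with $\eta(\xi)=1$, where $\xi_x=\frac{d}{dt}\big|_{t=0}e^{it}\cdot x$ generates the action) such that $d\eta=\pi_M^*\omega$; the Sasakian structure on $M$ is the one with contact form $\eta$, Reeb field $\xi$, and transverse Kähler structure lifted from $N^{ad}$. (This includes all admissible projective bundles $N^{ad}$ with any admissible Kähler form $\omega$ for which $[\omega/2\pi]$ is integral.) Then there is an integer $l\ge 1$ such that $$\pi_N\circ\pi_M\colon M\to N$$ is a smooth locally trivial fibre bundle whose fibre is the lens space $S^{2d_0+2d_\infty+3}/\mathbb Z_l$,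 where $\mathbb Z_l$, the group of complex $l$-th roots of unity, acts on the unit sphere $S^{2d_0+2d_\infty+3}\subset\mathbb C^{d_0+d_\infty+2}$ diagonally, $(z_1,\dots,z_{d_0+d_\infty+2})\mapsto(\lambda z_1,\dots,\lambda z_{d_0+d_\infty+2})$ with $\lambda^l=1$. -/

import Mathlib

open Bundle Set Topology
open scoped Manifold ContDiff LinearAlgebra.Projectivization

noncomputable section

section ProjectiveBundle

/-- The set underlying the projectivization `ℙ(E) → B` of a complex vector bundle `E` with model
fibre `F`: pairs of a point `x` of the base and a complex line in `E x`. -/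
structure ProjBundle (F : Type*) {B : Type*} (E : B → Type*)
    [∀ x, AddCommGroup (E x)] [∀ x, Module ℂ (E x)] where
  /-- The bundle projection `ℙ(E) → B`. -/
  proj : B
  /-- A line in the fibre over `proj`. -/
  line : ℙ ℂ (E proj)

namespace ProjBundle

variable {n : ℕ} {V B F : Type*} {E : B → Type*}
  [∀ x, AddCommGroup (E x)] [∀ x, Module ℂ (E x)]

/-- The map `E ∖ 0 → ℙ(E)` that sends a nonzero vector to the line that it spans. -/
def ofVec (v : {v : TotalSpace F E // v.2 ≠ 0}) : ProjBundle F E :=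
  ⟨v.1.proj, .mk ℂ v.1.2 v.2⟩

theorem ofVec_surjective : Function.Surjective (ofVec : _ → ProjBundle F E) := by
  rintro ⟨x, p⟩
  induction p using Projectivization.ind with
  | h v hv => exact ⟨⟨⟨x, v⟩, hv⟩, rfl⟩

variable [TopologicalSpace (TotalSpace F E)]

/-- `ℙ(E)` carries the quotient topology of `E ∖ 0`. -/
instance : TopologicalSpace (ProjBundle F E) :=
  TopologicalSpace.coinduced (ofVec (F := F) (E := E)) inferInstance

theorem isQuotientMap_ofVec : IsQuotientMap (ofVec : _ → ProjBundle F E) :=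
  ⟨⟨rfl⟩, ofVec_surjective⟩

variable [NormedAddCommGroup V] [TopologicalSpace B] [NormedAddCommGroup F] [NormedSpace ℂ F]
  [∀ x, TopologicalSpace (E x)]

/-- The affine coordinates `[w] ↦ (A w).2 / (A w).1` on the set `(A w).1 ≠ 0` of lines in `F`,
for an isomorphism `A : F ≃ ℂ × ℂⁿ`. -/
def affineCoord (A : F ≃L[ℂ] ℂ × EuclideanSpace ℂ (Fin n)) (p : ℙ ℂ F) :
    EuclideanSpace ℂ (Fin n) :=
  (A p.rep).1⁻¹ • (A p.rep).2

theorem affineCoord_mk (A : F ≃L[ℂ] ℂ × EuclideanSpace ℂ (Fin n)) (w : F) (hw : w ≠ 0) :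
    affineCoord A (.mk ℂ w hw) = (A w).1⁻¹ • (A w).2 := by
  obtain ⟨a, ha⟩ := Projectivization.exists_smul_eq_mk_rep ℂ w hw
  have h : (A (a • w)) = (a : ℂ) • A w := by rw [Units.smul_def, map_smul]
  rw [affineCoord, ← ha, h]
  simp only [Prod.smul_fst, Prod.smul_snd, smul_eq_mul, mul_inv, smul_smul]
  congr 1
  have := a.ne_zero
  field_simp

theorem rep_fst_ne_zero_iff (A : F ≃L[ℂ] ℂ × EuclideanSpace ℂ (Fin n)) (w : F) (hw : w ≠ 0) :
    (A (Projectivization.mk ℂ w hw).rep).1 ≠ 0 ↔ (A w).1 ≠ 0 := by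
  obtain ⟨a, ha⟩ := Projectivization.exists_smul_eq_mk_rep ℂ w hw
  rw [← ha, Units.smul_def, map_smul]
  simp

theorem symm_one_ne_zero (A : F ≃L[ℂ] ℂ × EuclideanSpace ℂ (Fin n))
    (u : EuclideanSpace ℂ (Fin n)) : A.symm (1, u) ≠ 0 := by
  intro h
  have := congrArg A h
  simp at this

variable [FiberBundle F E] [VectorBundle ℂ F E]

/-- The linear isomorphism `E x ≃ F` given by a trivialization `e` of `E` whose domain contains
`x` (and, to have a total function, by the preferred trivialization at all other `x`). -/
def fiberEquiv (e : Trivialization F (π F E)) [MemTrivializationAtlas e] (x : B) :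
    E x ≃ₗ[ℂ] F :=
  open Classical in
  if h : x ∈ e.baseSet then e.linearEquivAt ℂ x h
  else (trivializationAt F E x).linearEquivAt ℂ x (mem_baseSet_trivializationAt F E x)

theorem fiberEquiv_apply (e : Trivialization F (π F E)) [MemTrivializationAtlas e] {x : B}
    (h : x ∈ e.baseSet) (v : E x) : fiberEquiv e x v = (e ⟨x, v⟩).2 := by
  simp [fiberEquiv, h]

theorem fiberEquiv_symm_apply (e : Trivialization F (π F E)) [MemTrivializationAtlas e] {x : B}
    (h : x ∈ e.baseSet) (v : F) : (fiberEquiv e x).symm v = e.symm x v := by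
  simp [fiberEquiv, h]

/-- The forward map of the chart of `ℙ(E)` given by a chart `c` of the base, a local trivialization
`e` of `E`, and `A : F ≃ ℂ × ℂⁿ`. -/
def chartFun (c : OpenPartialHomeomorph B V) (e : Trivialization F (π F E))
    [MemTrivializationAtlas e] (A : F ≃L[ℂ] ℂ × EuclideanSpace ℂ (Fin n))
    (p : ProjBundle F E) : V × EuclideanSpace ℂ (Fin n) :=
  (c p.proj, affineCoord A (p.line.map (fiberEquiv e p.proj).toLinearMap
    (fiberEquiv e p.proj).injective))

/-- The inverse of `chartFun`. -/
def chartInv (c : OpenPartialHomeomorph B V) (e : Trivialization F (π F E))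
    [MemTrivializationAtlas e] (A : F ≃L[ℂ] ℂ × EuclideanSpace ℂ (Fin n))
    (y : V × EuclideanSpace ℂ (Fin n)) : ProjBundle F E :=
  ⟨c.symm y.1, .mk ℂ ((fiberEquiv e (c.symm y.1)).symm (A.symm (1, y.2)))
    (by simp)⟩

/-- The domain of `chartFun`. -/
def chartSource (c : OpenPartialHomeomorph B V) (e : Trivialization F (π F E))
    [MemTrivializationAtlas e] (A : F ≃L[ℂ] ℂ × EuclideanSpace ℂ (Fin n)) :
    Set (ProjBundle F E) :=
  {p | p.proj ∈ c.source ∩ e.baseSet ∧ (A (p.line.map (fiberEquiv e p.proj).toLinearMap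
    (fiberEquiv e p.proj).injective).rep).1 ≠ 0}

theorem chartFun_ofVec (c : OpenPartialHomeomorph B V) (e : Trivialization F (π F E))
    [MemTrivializationAtlas e] (A : F ≃L[ℂ] ℂ × EuclideanSpace ℂ (Fin n))
    (v : {v : TotalSpace F E // v.2 ≠ 0}) (h : v.1.proj ∈ e.baseSet) :
    chartFun c e A (ofVec v) = (c v.1.proj, (A (e v.1).2).1⁻¹ • (A (e v.1).2).2) := by
  simp only [chartFun, ofVec, Projectivization.map_mk, affineCoord_mk]
  simp [fiberEquiv_apply e h]

theorem ofVec_mem_chartSource (c : OpenPartialHomeomorph B V) (e : Trivialization F (π F E))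
    [MemTrivializationAtlas e] (A : F ≃L[ℂ] ℂ × EuclideanSpace ℂ (Fin n))
    (v : {v : TotalSpace F E // v.2 ≠ 0}) :
    ofVec v ∈ chartSource c e A ↔
      (v.1.proj ∈ c.source ∩ e.baseSet ∧ (A (e v.1).2).1 ≠ 0) := by
  simp only [chartSource, ofVec, Projectivization.map_mk, mem_ofPred_eq, rep_fst_ne_zero_iff]
  refine and_congr_right fun h => ?_
  simp [fiberEquiv_apply e h.2]

theorem isOpen_chartSource (c : OpenPartialHomeomorph B V) (e : Trivialization F (π F E))
    [MemTrivializationAtlas e] (A : F ≃L[ℂ] ℂ × EuclideanSpace ℂ (Fin n)) :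
    IsOpen (chartSource c e A) := by
  rw [← isQuotientMap_ofVec.isOpen_preimage]
  have h1 : IsOpen {v : TotalSpace F E | v ∈ e.source ∩ {v | (A (e v).2).1 ≠ 0}} := by
    refine e.continuousOn.isOpen_inter_preimage e.open_source
      (t := {y | (A y.2).1 ≠ 0}) (isOpen_ne.preimage (by fun_prop))
  have h2 := (c.open_source.preimage (FiberBundle.continuous_proj F E)).inter h1
  convert h2.preimage continuous_subtype_val using 1
  ext v
  simp only [mem_preimage, ofVec_mem_chartSource, mem_inter_iff, e.mem_source, mem_ofPred_eq]
  tauto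

/-- The chart of `ℙ(E)` given by a chart `c` of the base, a local trivialization `e` of `E`, and
an isomorphism `A : F ≃ ℂ × ℂⁿ`: it sends the line spanned by `v ∈ E x` to
`(c x, (A (e v)).2 / (A (e v)).1)`. -/
def chart (c : OpenPartialHomeomorph B V) (e : Trivialization F (π F E))
    [MemTrivializationAtlas e] (A : F ≃L[ℂ] ℂ × EuclideanSpace ℂ (Fin n)) :
    OpenPartialHomeomorph (ProjBundle F E) (V × EuclideanSpace ℂ (Fin n)) where
  toFun := chartFun c e A
  invFun := chartInv c e A
  source := chartSource c e A
  target := (c.target ∩ c.symm ⁻¹' e.baseSet) ×ˢ univ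
  map_source' := by
    rintro p ⟨⟨h1, h2⟩, -⟩
    simp [chartFun, h1, h2]
  map_target' := by
    rintro ⟨y, u⟩ ⟨⟨h1, h2⟩, -⟩
    simp only [mem_preimage] at h1 h2
    refine ⟨⟨c.map_target h1, h2⟩, ?_⟩
    simp [chartInv, Projectivization.map_mk, rep_fst_ne_zero_iff]
  left_inv' := by
    intro p hp
    obtain ⟨v, rfl⟩ := ofVec_surjective p
    rw [ofVec_mem_chartSource] at hp
    obtain ⟨⟨h1, h2⟩, h3⟩ := hp
    rw [chartFun_ofVec c e A v h2]
    obtain ⟨⟨x, v⟩, hv⟩ := v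
    have hx : c.symm (c x) = x := c.left_inv h1
    simp only [chartInv, ofVec]
    have key : ∀ y (_ : y = x) (w : F) (hw : (fiberEquiv e y).symm w ≠ 0)
        (hw' : (fiberEquiv e x).symm w ≠ 0),
        (⟨y, .mk ℂ ((fiberEquiv e y).symm w) hw⟩ : ProjBundle F E) =
          ⟨x, .mk ℂ ((fiberEquiv e x).symm w) hw'⟩ := by
      rintro y rfl w hw hw'; rfl
    rw [key _ hx _ _ (by simp)]
    congr 1
    rw [Projectivization.mk_eq_mk_iff']
    refine ⟨(A (e ⟨x, v⟩).2).1⁻¹, ?_⟩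
    apply (fiberEquiv e x).injective
    rw [map_smul, LinearEquiv.apply_symm_apply, fiberEquiv_apply e h2]
    apply A.injective
    rw [map_smul, A.apply_symm_apply]
    ext1
    · simpa using inv_mul_cancel₀ h3
    · rfl
  right_inv' := by
    rintro ⟨y, u⟩ ⟨⟨h1, h2⟩, -⟩
    simp only [chartFun, chartInv, Projectivization.map_mk, affineCoord_mk]
    simp [c.right_inv h1]
  open_source := isOpen_chartSource c e A
  open_target := (c.symm.continuousOn.isOpen_inter_preimage c.open_target e.open_baseSet).prod
    isOpen_univ
  continuousOn_toFun := by
    rw [isQuotientMap_ofVec.continuousOn_isOpen_iff (isOpen_chartSource c e A)]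
    have : ContinuousOn (fun v : {v : TotalSpace F E // v.2 ≠ 0} =>
        (c v.1.proj, (A (e v.1).2).1⁻¹ • (A (e v.1).2).2)) (ofVec ⁻¹' chartSource c e A) := by
      have hsub : ∀ v ∈ ofVec ⁻¹' chartSource c e A, v.1.proj ∈ c.source ∩ e.baseSet ∧
          (A (e v.1).2).1 ≠ 0 := fun v hv => (ofVec_mem_chartSource c e A v).1 hv
      have he : ContinuousOn (fun v : {v : TotalSpace F E // v.2 ≠ 0} => A (e v.1).2)
          (ofVec ⁻¹' chartSource c e A) := by
        refine (A.continuous.comp continuous_snd).comp_continuousOn ?_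
        exact e.continuousOn.comp continuous_subtype_val.continuousOn
          fun v hv => e.mem_source.2 (hsub v hv).1.2
      refine ContinuousOn.prodMk ?_ ?_
      · exact c.continuousOn.comp ((FiberBundle.continuous_proj F E).comp
          continuous_subtype_val).continuousOn fun v hv => (hsub v hv).1.1
      · exact (he.fst.inv₀ fun v hv => (hsub v hv).2).smul he.snd
    refine this.congr fun v hv => ?_
    exact chartFun_ofVec c e A v ((ofVec_mem_chartSource c e A v).1 hv).1.2
  continuousOn_invFun := by
    rw [continuousOn_iff_continuous_domRestrict]
    have hne : ∀ y : (c.target ∩ c.symm ⁻¹' e.baseSet) ×ˢ (univ : Set (EuclideanSpace ℂ (Fin n))),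
        (fiberEquiv e (c.symm y.1.1)).symm (A.symm (1, y.1.2)) ≠ 0 := fun y => by
      simp
    let s : (c.target ∩ c.symm ⁻¹' e.baseSet) ×ˢ (univ : Set (EuclideanSpace ℂ (Fin n))) →
        {v : TotalSpace F E // v.2 ≠ 0} := fun y =>
      ⟨⟨c.symm y.1.1, (fiberEquiv e (c.symm y.1.1)).symm (A.symm (1, y.1.2))⟩, hne y⟩
    have hs : Continuous s := by
      refine Continuous.subtype_mk ?_ _
      have : ContinuousOn (fun y : V × EuclideanSpace ℂ (Fin n) =>
          e.toOpenPartialHomeomorph.symm (c.symm y.1, A.symm (1, y.2)))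
          ((c.target ∩ c.symm ⁻¹' e.baseSet) ×ˢ univ) := by
        refine e.toOpenPartialHomeomorph.symm.continuousOn.comp (ContinuousOn.prodMk ?_ ?_) ?_
        · exact c.symm.continuousOn.comp continuousOn_fst fun y hy => hy.1.1
        · exact (A.symm.continuous.comp (by fun_prop)).continuousOn
        · intro y hy
          exact e.mem_target.2 hy.1.2
      rw [continuousOn_iff_continuous_domRestrict] at this
      convert this using 1
      ext1 y
      simp only [domRestrict_apply]
      rw [fiberEquiv_symm_apply e y.2.1.2]
      exact e.mk_symm y.2.1.2 _
    exact isQuotientMap_ofVec.continuous.comp hs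

theorem exists_affine [hn : Fact (Module.finrank ℂ F = n + 1)] {w : F} (hw : w ≠ 0) :
    ∃ A : F ≃L[ℂ] ℂ × EuclideanSpace ℂ (Fin n), (A w).1 ≠ 0 := by
  have : FiniteDimensional ℂ F := .of_fact_finrank_eq_succ n
  have h : Module.finrank ℂ F = Module.finrank ℂ (ℂ × EuclideanSpace ℂ (Fin n)) := by
    rw [hn.out]; simp [add_comm]
  let A₀ : F ≃L[ℂ] ℂ × EuclideanSpace ℂ (Fin n) := .ofFinrankEq h
  obtain ⟨A₁, hA₁⟩ := SeparatingDual.exists_continuousLinearEquiv_apply_eq (R := ℂ) hw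
    (symm_one_ne_zero A₀ 0)
  exact ⟨A₁.trans A₀, by simp [hA₁]⟩

variable [ChartedSpace V B]

theorem exists_chart [Fact (Module.finrank ℂ F = n + 1)] (p : ProjBundle F E) :
    ∃ A : F ≃L[ℂ] ℂ × EuclideanSpace ℂ (Fin n),
      p ∈ (chart (chartAt V p.proj) (trivializationAt F E p.proj) A).source := by
  obtain ⟨A, hA⟩ := exists_affine (n := n) (p.line.map (fiberEquiv (trivializationAt F E p.proj)
    p.proj).toLinearMap (fiberEquiv (trivializationAt F E p.proj) p.proj).injective).rep_nonzero
  exact ⟨A, ⟨mem_chart_source V p.proj, mem_baseSet_trivializationAt F E p.proj⟩, hA⟩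

/-- The atlas of `ℙ(E)`, where `E` has rank `n + 1`, consists of the charts `chart c e A` with `c`
in the atlas of the base and `e` in the trivialization atlas of `E`. -/
instance [Fact (Module.finrank ℂ F = n + 1)] :
    ChartedSpace (V × EuclideanSpace ℂ (Fin n)) (ProjBundle F E) where
  atlas := {φ | ∃ c ∈ atlas V B, ∃ (e : Trivialization F (π F E)) (_ : MemTrivializationAtlas e)
    (A : F ≃L[ℂ] ℂ × EuclideanSpace ℂ (Fin n)), φ = chart c e A}
  chartAt p := chart (chartAt V p.proj) (trivializationAt F E p.proj) (exists_chart p).choose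
  mem_chart_source p := (exists_chart p).choose_spec
  chart_mem_atlas p := ⟨_, chart_mem_atlas V p.proj, _, inferInstance, _, rfl⟩

variable [NormedSpace ℂ V]

/-- If `E` is a holomorphic vector bundle over a complex manifold then `ℙ(E)` is a complex
manifold. -/
instance [Fact (Module.finrank ℂ F = n + 1)] [IsManifold 𝓘(ℂ, V) ω B]
    [ContMDiffVectorBundle ω F E 𝓘(ℂ, V)] :
    IsManifold 𝓘(ℂ, V × EuclideanSpace ℂ (Fin n)) ω (ProjBundle F E) := by
  refine isManifold_of_contDiffOn _ _ _ ?_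
  rintro _ _ ⟨c, hc, e, he, A, rfl⟩ ⟨c', hc', e', he', A', rfl⟩
  simp only [modelWithCornersSelf_coe, modelWithCornersSelf_coe_symm, Function.comp_id,
    Function.id_comp, range_id, inter_univ, preimage_id_eq, id_eq]
  have hmem : ∀ y ∈ ((chart c e A).symm ≫ₕ chart c' e' A').source,
      y.1 ∈ c.target ∧ c.symm y.1 ∈ c'.source ∧ c.symm y.1 ∈ e.baseSet ∩ e'.baseSet ∧
      (A' (e.coordChangeL ℂ e' (c.symm y.1) (A.symm (1, y.2)))).1 ≠ 0 ∧
      ((chart c e A).symm ≫ₕ chart c' e' A') y = (c' (c.symm y.1),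
        (A' (e.coordChangeL ℂ e' (c.symm y.1) (A.symm (1, y.2)))).1⁻¹ •
        (A' (e.coordChangeL ℂ e' (c.symm y.1) (A.symm (1, y.2)))).2) := by
    rintro y hy
    rw [OpenPartialHomeomorph.trans_source] at hy
    obtain ⟨⟨⟨h1, h2⟩, -⟩, h3⟩ := hy
    change chartInv c e A y ∈ chartSource c' e' A' at h3
    have hinv : chartInv c e A y = ofVec ⟨⟨c.symm y.1, e.symm (c.symm y.1) (A.symm (1, y.2))⟩, by
        rw [← fiberEquiv_symm_apply e h2]; simp⟩ := by
      simp only [chartInv, ofVec, fiberEquiv_symm_apply e h2]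
    rw [hinv, ofVec_mem_chartSource] at h3
    have hT : (e' ⟨c.symm y.1, e.symm (c.symm y.1) (A.symm (1, y.2))⟩).2 =
        e.coordChangeL ℂ e' (c.symm y.1) (A.symm (1, y.2)) := by
      rw [Trivialization.coordChangeL_apply e e' ⟨h2, h3.1.2⟩]
    refine ⟨h1, h3.1.1, ⟨h2, h3.1.2⟩, ?_, ?_⟩
    · rw [← hT]; exact h3.2
    · change chartFun c' e' A' (chartInv c e A y) = _
      rw [hinv, chartFun_ofVec _ _ _ _ h3.1.2, ← hT]
  have hc1 : ContDiffOn ℂ ω (fun y : V × EuclideanSpace ℂ (Fin n) => c' (c.symm y.1))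
      ((chart c e A).symm ≫ₕ chart c' e' A').source := by
    have := (contDiffGroupoid ω 𝓘(ℂ, V)).compatible hc hc'
    rw [contDiffGroupoid, mem_groupoid_of_pregroupoid] at this
    have h := this.1
    simp only [contDiffPregroupoid, modelWithCornersSelf_coe, modelWithCornersSelf_coe_symm,
      Function.comp_id, Function.id_comp, range_id, inter_univ, preimage_id_eq, id_eq] at h
    refine ContDiffOn.comp (g := c.symm ≫ₕ c') h contDiffOn_fst fun y hy => ?_
    obtain ⟨h1, h2, -⟩ := hmem y hy
    simp [h1, h2]
  have hc2 : ContDiffOn ℂ ω (fun y : V × EuclideanSpace ℂ (Fin n) =>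
      A' (e.coordChangeL ℂ e' (c.symm y.1) (A.symm (1, y.2))))
      ((chart c e A).symm ≫ₕ chart c' e' A').source := by
    have hL : ContDiffOn ℂ ω (fun y : V => (e.coordChangeL ℂ e' (c.symm y) : F →L[ℂ] F))
        (c.target ∩ c.symm ⁻¹' (e.baseSet ∩ e'.baseSet)) := by
      rw [← contMDiffOn_iff_contDiffOn]
      exact (contMDiffOn_coordChangeL e e').comp
        ((contMDiffOn_symm_of_mem_maximalAtlas
          (IsManifold.subset_maximalAtlas hc)).mono inter_subset_left) fun y hy => hy.2
    have hL' : ContDiffOn ℂ ω (fun y : V × EuclideanSpace ℂ (Fin n) =>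
        (e.coordChangeL ℂ e' (c.symm y.1) : F →L[ℂ] F))
        ((chart c e A).symm ≫ₕ chart c' e' A').source :=
      ContDiffOn.comp hL contDiffOn_fst fun y hy =>
        ⟨(hmem y hy).1, (hmem y hy).2.2.1⟩
    refine A'.contDiff.comp_contDiffOn (hL'.clm_apply ?_)
    exact (A.symm.contDiff.comp (contDiff_const.prodMk contDiff_snd)).contDiffOn
  refine ContDiffOn.congr ?_ fun y hy => (hmem y hy).2.2.2.2
  exact hc1.prodMk ((hc2.fst.inv fun y hy => (hmem y hy).2.2.2.1).smul hc2.snd)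

end ProjBundle
end ProjectiveBundle

section Forms

variable {V M V' M' : Type*} [NormedAddCommGroup V] [NormedSpace ℝ V] [TopologicalSpace M]
  [ChartedSpace V M] [NormedAddCommGroup V'] [NormedSpace ℝ V'] [TopologicalSpace M']
  [ChartedSpace V' M'] {k : ℕ}

/-- A (not necessarily smooth) real differential `k`-form on a manifold `M` modelled on `V`. -/
abbrev DiffForm (V M : Type*) [NormedAddCommGroup V] [NormedSpace ℝ V] [TopologicalSpace M]
    [ChartedSpace V M] (k : ℕ) :=
  ∀ x : M, TangentSpace 𝓘(ℝ, V) x [⋀^Fin k]→L[ℝ] ℝ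

namespace DiffForm

/-- The pullback `f^* α`. -/
def pullback (f : M → M') (α : DiffForm V' M' k) : DiffForm V M k := fun x =>
  (α (f x)).compContinuousLinearMap (mfderiv 𝓘(ℝ, V) 𝓘(ℝ, V') f x)

/-- The expression of `α` in the preferred chart at `x₀`, that is, the pullback of `α` under the
inverse of this chart, a form on an open subset of `V`. -/
def inChart (α : DiffForm V M k) (x₀ : M) : V → V [⋀^Fin k]→L[ℝ] ℝ := fun y =>
  (α ((chartAt V x₀).symm y)).compContinuousLinearMap
    (mfderiv 𝓘(ℝ, V) 𝓘(ℝ, V) (chartAt V x₀).symm y)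

/-- Smoothness of a differential form: its expression in charts is smooth. -/
def IsSmooth (α : DiffForm V M k) : Prop :=
  ∀ x₀ : M, ContDiffOn ℝ ∞ (α.inChart x₀) (chartAt V x₀).target

/-- The exterior derivative `dα`, computed at each point in the preferred chart there; it is
normalized by `dα(u, v) = u(α(v)) - v(α(u)) - α([u, v])` for 1-forms. -/
def d (α : DiffForm V M k) : DiffForm V M (k + 1) := fun x =>
  (extDeriv (α.inChart x) (chartAt V x x)).compContinuousLinearMap
    (mfderiv 𝓘(ℝ, V) 𝓘(ℝ, V) (chartAt V x) x)

end DiffForm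

/-- A Kähler form on a complex manifold `X`: a smooth closed real 2-form `κ` that is of type
`(1, 1)`, `κ(Ju, Jv) = κ(u, v)`, and positive, `κ(u, Ju) > 0` for `u ≠ 0`. The charts being
holomorphic, `J` is multiplication by `i` on the tangent spaces `T_x X = V`. -/
structure IsKahlerForm {V X : Type*} [NormedAddCommGroup V] [NormedSpace ℂ V]
    [NormedSpace ℝ V] [IsScalarTower ℝ ℂ V] [TopologicalSpace X] [ChartedSpace V X] (κ : DiffForm V X 2) : Prop where
  smooth : κ.IsSmooth
  closed : κ.d = 0
  type_one_one (x : X) (u v : V) : κ x ![Complex.I • u, Complex.I • v] = κ x ![u, v]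
  pos (x : X) (u : V) (hu : u ≠ 0) : 0 < κ x ![u, Complex.I • u]

end Forms

section Bundles

variable {V₁ H₁ X V₂ H₂ B V₃ H₃ F : Type*}
  [NormedAddCommGroup V₁] [NormedSpace ℝ V₁] [TopologicalSpace H₁] [TopologicalSpace X]
  [ChartedSpace H₁ X] [NormedAddCommGroup V₂] [NormedSpace ℝ V₂] [TopologicalSpace H₂]
  [TopologicalSpace B] [ChartedSpace H₂ B] [NormedAddCommGroup V₃] [NormedSpace ℝ V₃]
  [TopologicalSpace H₃] [TopologicalSpace F] [ChartedSpace H₃ F]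

/-- A local trivialization `p ⁻¹ U ≃ U × F` that is a diffeomorphism. -/
def IsSmoothTrivialization (I₁ : ModelWithCorners ℝ V₁ H₁) (I₂ : ModelWithCorners ℝ V₂ H₂)
    (I₃ : ModelWithCorners ℝ V₃ H₃) {p : X → B} (e : Trivialization F p) : Prop :=
  ContMDiffOn I₁ (I₂.prod I₃) ∞ e e.source ∧
    ContMDiffOn (I₂.prod I₃) I₁ ∞ e.toOpenPartialHomeomorph.symm e.target

/-- `p : X → B` is a smooth (locally trivial) fibre bundle with fibre `F`. -/
def IsSmoothFiberBundle (I₁ : ModelWithCorners ℝ V₁ H₁) (I₂ : ModelWithCorners ℝ V₂ H₂)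
    (I₃ : ModelWithCorners ℝ V₃ H₃) (F : Type*) [TopologicalSpace F] [ChartedSpace H₃ F]
    (p : X → B) : Prop :=
  ∀ b : B, ∃ e : Trivialization F p, b ∈ e.baseSet ∧ IsSmoothTrivialization I₁ I₂ I₃ e

/-- `p : X → B` is a smooth principal circle bundle for the given action of the circle on `X`. -/
structure IsPrincipalCircleBundle [MulAction Circle X] (I₁ : ModelWithCorners ℝ V₁ H₁)
    (I₂ : ModelWithCorners ℝ V₂ H₂) (p : X → B) : Prop where
  smooth_action : ContMDiff ((𝓡 1).prod I₁) I₁ ∞ (fun a : Circle × X => a.1 • a.2)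
  invariant (a : Circle) (x : X) : p (a • x) = p x
  locally_trivial (b : B) : ∃ e : Trivialization Circle p, b ∈ e.baseSet ∧
    IsSmoothTrivialization I₁ I₂ (𝓡 1) e ∧
    ∀ (a : Circle), ∀ x ∈ e.source, (e (a • x)).2 = a * (e x).2

/-- The vector field `ξ` generating the circle action, `ξ_x = d/dt (exp(it) • x)` at `t = 0`. -/
def circleVectorField (V : Type*) {X : Type*} [NormedAddCommGroup V] [NormedSpace ℝ V] [TopologicalSpace X]
    [ChartedSpace V X] [MulAction Circle X] (x : X) : TangentSpace 𝓘(ℝ, V) x :=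
  mfderiv 𝓘(ℝ, ℝ) 𝓘(ℝ, V) (fun t : ℝ => Circle.exp t • x) 0 (1 : ℝ)

/-- The Boothby–Wang construction over a Kähler manifold `(B, κ)`: a principal circle bundle
`p : X → B` with a connection form `η` (a smooth invariant 1-form with `η(ξ) = 1`) whose curvature
is `dη = p^* κ`; such an `η` exists iff the real Euler class of `p` is `[κ / 2π]`, up to the sign
convention. The Sasakian structure on `X` is then determined: its contact form is `η`, its Reeb field
is `ξ`, its endomorphism `Φ` is the horizontal lift of `J` and its metric is
`dη ∘ (1 × Φ) + η ⊗ η`. -/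
structure IsBoothbyWang {V X V' B : Type*} [NormedAddCommGroup V] [NormedSpace ℝ V]
    [TopologicalSpace X] [ChartedSpace V X] [MulAction Circle X] [NormedAddCommGroup V']
    [NormedSpace ℝ V'] [TopologicalSpace B] [ChartedSpace V' B]
    (p : X → B) (η : DiffForm V X 1) (κ : DiffForm V' B 2) : Prop where
  principal : IsPrincipalCircleBundle 𝓘(ℝ, V) 𝓘(ℝ, V') p
  smooth : η.IsSmooth
  invariant (a : Circle) : η.pullback (fun x : X => a • x) = η
  reeb (x : X) : η x ![circleVectorField V x] = 1
  curvature : η.d = κ.pullback p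

end Bundles

section LensSpace

/-- The unit sphere `S^{2k+1}` in `ℂ^{k+1}`. -/
abbrev OddSphere (k : ℕ) : Type := Metric.sphere (0 : EuclideanSpace ℂ (Fin (k + 1))) 1

instance (k : ℕ) : Fact (Module.finrank ℝ (EuclideanSpace ℂ (Fin (k + 1))) = 2 * k + 1 + 1) :=
  ⟨by
    rw [← Module.finrank_mul_finrank ℝ ℂ, Complex.finrank_real_complex]
    simp; ring⟩

/-- The group `ℤ_l` of complex `l`-th roots of unity acts diagonally on `S^{2k+1}`, that is,
`λ • (z_0, …, z_k) = (λ z_0, …, λ z_k)`. -/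
instance (k l : ℕ) [NeZero l] : MulAction (rootsOfUnity l ℂ) (OddSphere k) where
  smul a z := ⟨((a : ℂˣ) : ℂ) • (z : EuclideanSpace ℂ (Fin (k + 1))), by
    rw [mem_sphere_zero_iff_norm, norm_smul, Complex.norm_eq_one_of_mem_rootsOfUnity a.2,
      norm_eq_of_mem_sphere, one_mul]⟩
  one_smul z := Subtype.ext (one_smul ℂ _)
  mul_smul a b z := Subtype.ext (mul_smul ((a : ℂˣ) : ℂ) ((b : ℂˣ) : ℂ) _)

instance (k l : ℕ) [NeZero l] : ContinuousConstSMul (rootsOfUnity l ℂ) (OddSphere k) where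
  continuous_const_smul a :=
    Continuous.subtype_mk (continuous_subtype_val.const_smul ((a : ℂˣ) : ℂ)) _

/-- The action is free. -/
instance (k l : ℕ) [NeZero l] : IsCancelSMul (rootsOfUnity l ℂ) (OddSphere k) where
  left_cancel' a _ _ h := MulAction.injective a h
  right_cancel' a b z h := by
    have h1 : ((a : ℂˣ) : ℂ) • (z : EuclideanSpace ℂ (Fin (k + 1))) = ((b : ℂˣ) : ℂ) • (z : _) :=
      congrArg Subtype.val h
    exact Subtype.ext (Units.ext (smul_left_injective ℂ (ne_zero_of_mem_unit_sphere z) h1))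

/-- The lens space `S^{2k+1} / ℤ_l` for the diagonal action of the `l`-th roots of unity. -/
def LensSpace (k l : ℕ) [NeZero l] : Type :=
  MulAction.orbitRel.Quotient (rootsOfUnity l ℂ) (OddSphere k)

/-- The quotient topology. -/
instance (k l : ℕ) [NeZero l] : TopologicalSpace (LensSpace k l) :=
  inferInstanceAs (TopologicalSpace (MulAction.orbitRel.Quotient (rootsOfUnity l ℂ) (OddSphere k)))

/-- The smooth structure of a quotient by a free action of a finite group: the charts are the local
inverses of the quotient map `S^{2k+1} → S^{2k+1} / ℤ_l` followed by charts of the sphere. -/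
instance (k l : ℕ) [NeZero l] :
    ChartedSpace (EuclideanSpace ℝ (Fin (2 * k + 1))) (LensSpace k l) :=
  inferInstanceAs (ChartedSpace (EuclideanSpace ℝ (Fin (2 * k + 1)))
    (MulAction.orbitRel.Quotient (rootsOfUnity l ℂ) (OddSphere k)))

theorem contMDiff_roots_smul (k l : ℕ) [NeZero l] (a : rootsOfUnity l ℂ) :
    ContMDiff (𝓡 (2 * k + 1)) (𝓡 (2 * k + 1)) ω (fun z : OddSphere k => a • z) := by
  apply ContMDiff.codRestrict_sphere
  exact (contDiff_const_smul (𝕜 := ℝ) ((a : ℂˣ) : ℂ)).contMDiff.comp contMDiff_coe_sphere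

theorem isManifold_sphere_quotient (k l : ℕ) [NeZero l] : IsManifold (𝓡 (2 * k + 1)) ω
    (MulAction.orbitRel.Quotient (rootsOfUnity l ℂ) (OddSphere k)) := by
  refine isManifold_of_contDiffOn _ _ _ ?_
  rintro _ _ ⟨q₁, rfl⟩ ⟨q₂, rfl⟩
  generalize_proofs hloc hex
  generalize hex.choose q₁ = z₁
  generalize hex.choose q₂ = z₂
  simp only [modelWithCornersSelf_coe, modelWithCornersSelf_coe_symm, Function.comp_id,
    Function.id_comp, range_id, inter_univ, preimage_id_eq, id_eq]
  intro y hy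
  refine ContDiffAt.contDiffWithinAt ?_
  set s₁ := hloc.localInverseAt z₁
  set s₂ := hloc.localInverseAt z₂
  set φ₁ := chartAt (EuclideanSpace ℝ (Fin (2 * k + 1))) z₁
  set φ₂ := chartAt (EuclideanSpace ℝ (Fin (2 * k + 1))) z₂
  simp only [OpenPartialHomeomorph.trans_source, OpenPartialHomeomorph.symm_source,
    OpenPartialHomeomorph.trans_target, mem_inter_iff, mem_preimage,
    OpenPartialHomeomorph.coe_trans_symm, Function.comp_apply] at hy
  obtain ⟨⟨h1, h2⟩, h3, h4⟩ := hy
  have hs₁ : ∀ z, s₁.symm z =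
      Quotient.mk (MulAction.orbitRel (rootsOfUnity l ℂ) (OddSphere k)) z :=
    fun z => congrFun (hloc.localInverseAt_symm z₁) z
  have hs₂ : ∀ z, s₂.symm z =
      Quotient.mk (MulAction.orbitRel (rootsOfUnity l ℂ) (OddSphere k)) z :=
    fun z => congrFun (hloc.localInverseAt_symm z₂) z
  have hq : s₂.symm (s₂ (s₁.symm (φ₁.symm y))) = s₁.symm (φ₁.symm y) := s₂.left_inv h3
  rw [hs₂, hs₁] at hq
  obtain ⟨a, ha⟩ := MulAction.orbitRel_apply.1 (Quotient.exact hq)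
  simp only at ha
  rw [← hs₁] at ha
  have hc : ContinuousAt φ₁.symm y := φ₁.symm.continuousAt h1
  have hmem : a • φ₁.symm y ∈ s₂.target := by rw [ha]; exact s₂.map_source h3
  have hev : ∀ᶠ w in 𝓝 y, a • φ₁.symm w ∈ s₂.target :=
    ((continuous_const_smul a).continuousAt.comp hc).eventually (s₂.open_target.mem_nhds hmem)
  have heq : (fun w => φ₂ (a • φ₁.symm w)) =ᶠ[𝓝 y] ((s₁ ≫ₕ φ₁).symm ≫ₕ s₂ ≫ₕ φ₂) := by
    filter_upwards [hev] with w hw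
    have : s₁.symm (φ₁.symm w) = s₂.symm (a • φ₁.symm w) := by
      rw [hs₁, hs₂]
      exact Quotient.sound (MulAction.orbitRel_apply.2 ⟨a⁻¹, inv_smul_smul a _⟩)
    simp only [OpenPartialHomeomorph.coe_trans, OpenPartialHomeomorph.coe_trans_symm,
      Function.comp_apply]
    rw [this, s₂.right_inv hw]
  refine ContDiffAt.congr_of_eventuallyEq ?_ heq.symm
  rw [← contMDiffAt_iff_contDiffAt]
  have hφ₂ : ContMDiffAt (𝓡 (2 * k + 1)) (𝓡 (2 * k + 1)) ω φ₂ (a • φ₁.symm y) := by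
    refine contMDiffAt_of_mem_maximalAtlas (IsManifold.chart_mem_maximalAtlas z₂) ?_
    rw [ha]; exact h4
  exact hφ₂.comp y (((contMDiff_roots_smul k l a).contMDiffAt).comp y
    (contMDiffAt_symm_of_mem_maximalAtlas (IsManifold.chart_mem_maximalAtlas z₁) h1))

instance (k l : ℕ) [NeZero l] : IsManifold (𝓡 (2 * k + 1)) ω (LensSpace k l) :=
  isManifold_sphere_quotient k l

end LensSpace

/-- The fibre `ℂ^{a+1} ⊕ ℂ^{b+1}` of a sum of bundles of ranks `a + 1` and `b + 1`. -/
instance (a b : ℕ) : Fact (Module.finrank ℂ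
    (EuclideanSpace ℂ (Fin (a + 1)) × EuclideanSpace ℂ (Fin (b + 1))) = a + b + 1 + 1) :=
  ⟨by simp; ring⟩

end

/-! Put `E = E_0 ⊕ E_inf`, of rank `n + 1` with `n = d_0 + d_inf + 1 ≥ 1`. The splitting plays no
further role: the claim is about a circle bundle over `ℙ(E)` with positive curvature.

Pull the circle bundle back along the tautological projection `E x ∖ 0 → ℙ(E x)`. The source
retracts onto a sphere of dimension `2n + 1 ≥ 3`, which has no second cohomology, so the pulled back
bundle is trivial. In other words, the projection lifts to a map into `M`, and this works over a
small ball of base points at once. Cohomology appears only through lifts and logarithms: two lifts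
differ by a circle-valued function, and if that function has a logarithm on the overlap, the lifts
can be glued (`HasLog.union`, `HasLift.union`). Applied to boxes and then to two stereographic caps,
this gives `IsPrincipalCircleBundle.exists_hasLift`.

Averaging over the circle then turns a lift into an equivariant one, `Φ (u, a • w) = a ^ k • Φ (u,
w)`, for an integer weight `k` (`IsPrincipalCircleBundle.exists_equivariant_lift`).

The weight is not zero. Otherwise `Φ` would be constant on circle orbits, and two affine discs of a
projective line would lift to discs in `M` with a common boundary. By Stokes the integral of `η`
over each boundary equals the integral of the Kähler form over the disc and is positive, whereas the
two boundaries have opposite orientations (`IsBoothbyWang.not_glued_discs`,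
`ProjBundle.weight_ne_zero`).

Restricted to unit vectors, `Φ` maps onto the part of `M` over the ball of base points: a defect in
the circle direction is removed by a `k`-th root. Two unit vectors over the same base point have the
same image exactly when they differ by a root of unity of order dividing `|k|`. Hence the fibre is
the lens space with `l = |k|` (`ProjBundle.exists_isSmoothTrivialization_lensSpace`). Finally, the
weight at a point of the base is unique, hence locally constant, and one `l` serves for the whole
connected base (`ProjBundle.IsWeight.unique`). -/

section Logarithm

/-! ### Logarithms of circle-valued functions: uniqueness and gluing. -/

variable {T Y : Type*} [TopologicalSpace T] [TopologicalSpace Y]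

/-- Every continuous circle-valued function on `S` has a continuous logarithm. -/
def HasLog (S : Set T) : Prop :=
  ∀ g : T → Circle, ContinuousOn g S →
    ∃ f : T → ℝ, ContinuousOn f S ∧ ∀ x ∈ S, Circle.exp (f x) = g x

/-- The difference of two logarithms is continuous with values in the discrete set `2πℤ`, hence
constant on a connected set. -/
theorem IsPreconnected.circle_log_unique {S : Set T} (hS : IsPreconnected S) {f₁ f₂ : T → ℝ}
    (h₁ : ContinuousOn f₁ S) (h₂ : ContinuousOn f₂ S)
    (h : ∀ x ∈ S, Circle.exp (f₁ x) = Circle.exp (f₂ x)) :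
    ∃ n : ℤ, ∀ x ∈ S, f₁ x = f₂ x + n * (2 * Real.pi) := by
  rcases S.eq_empty_or_nonempty with rfl | ⟨x₀, hx₀⟩
  · simp
  have hn : ∀ x ∈ S, ∃ n : ℤ, f₁ x - f₂ x = n * (2 * Real.pi) := fun x hx => by
    rw [← Circle.exp_eq_one, Circle.exp_sub, h x hx, div_self']
  have hpi : (2 * Real.pi) ≠ 0 := by positivity
  have hdisc : IsDiscrete (range ((↑) : ℤ → ℝ)) :=
    ⟨Int.isClosedEmbedding_coe_real.isEmbedding.toHomeomorph.discreteTopology⟩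
  obtain ⟨n, hn₀⟩ := hn x₀ hx₀
  refine ⟨n, fun x hx => ?_⟩
  have key := hS.constant_of_mapsTo hdisc
    (f := fun x => (f₁ x - f₂ x) / (2 * Real.pi))
    ((h₁.sub h₂).div_const _) (fun y hy => by
      obtain ⟨m, hm⟩ := hn y hy
      exact ⟨m, by simp only [hm]; field_simp⟩) hx hx₀
  simp only [hn₀] at key
  field_simp at key
  linarith

/-- A logarithm of `g ∘ ψ` pulls back along `φ` to one of `g`. Only `ψ ∘ φ = id` is needed, so it is
enough that `S` is a retract of `S'`. -/
theorem HasLog.congr_homeomorph {S : Set T} {S' : Set Y} (h : HasLog S') (φ : T → Y)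
    (ψ : Y → T) (hφ : ContinuousOn φ S) (hψ : ContinuousOn ψ S') (hφS : MapsTo φ S S')
    (hψS : MapsTo ψ S' S) (hψφ : ∀ x ∈ S, ψ (φ x) = x) : HasLog S := by
  intro g hg
  obtain ⟨f, hf, hfg⟩ := h (g ∘ ψ) (hg.comp hψ hψS)
  refine ⟨f ∘ φ, hf.comp hφ hφS, fun x hx => ?_⟩
  simp [hfg _ (hφS hx), hψφ x hx]

/-- This is the Mayer–Vietoris argument for first cohomology: on the connected overlap the two
logarithms differ by a constant multiple of `2π`, and shifting one of them by this constant makes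
them agree. -/
theorem HasLog.union {S₁ S₂ : Set T} (h₁ : HasLog S₁) (h₂ : HasLog S₂) (ho₁ : IsOpen S₁)
    (ho₂ : IsOpen S₂) (hc : IsPreconnected (S₁ ∩ S₂)) : HasLog (S₁ ∪ S₂) := by
  classical
  intro g hg
  obtain ⟨f₁, hf₁, hg₁⟩ := h₁ g (hg.mono subset_union_left)
  obtain ⟨f₂, hf₂, hg₂⟩ := h₂ g (hg.mono subset_union_right)
  obtain ⟨n, hn⟩ := hc.circle_log_unique (hf₁.mono inter_subset_left)
    (hf₂.mono inter_subset_right) fun x hx => by rw [hg₁ x hx.1, hg₂ x hx.2]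
  have e₁ : EqOn (fun x => if x ∈ S₁ then f₁ x else f₂ x + n * (2 * Real.pi)) f₁ S₁ :=
    fun x hx => by simp [hx]
  have e₂ : EqOn (fun x => if x ∈ S₁ then f₁ x else f₂ x + n * (2 * Real.pi))
      (fun x => f₂ x + n * (2 * Real.pi)) S₂ := fun x hx => by
    by_cases hx1 : x ∈ S₁
    · simp [hx1, hn x ⟨hx1, hx⟩]
    · simp [hx1]
  refine ⟨_, ContinuousOn.union_of_isOpen (hf₁.congr e₁)
    ((hf₂.add continuousOn_const).congr e₂) ho₁ ho₂, ?_⟩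
  rintro x (hx | hx)
  · rw [← hg₁ x hx]; exact congrArg _ (e₁ hx)
  · rw [← hg₂ x hx]
    refine (congrArg _ (e₂ hx)).trans ?_
    rw [Circle.exp_add, (Circle.exp_eq_one (r := n * (2 * Real.pi))).2 ⟨n, rfl⟩, mul_one]

end Logarithm

/-! ### Logarithms on star-shaped sets and on punctured vector spaces; smoothness. -/

section LogNormed

variable {T : Type*} [NormedAddCommGroup T] [NormedSpace ℝ T]

/-- A star-shaped open set is contractible and locally path connected, so maps to the circle lift
through the covering `Circle.exp`. -/
theorem StarConvex.hasLog {S : Set T} {x : T} (hS : StarConvex ℝ x S) (ho : IsOpen S) :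
    HasLog S := by
  classical
  intro g hg
  rcases S.eq_empty_or_nonempty with rfl | hne
  · exact ⟨fun _ => 0, continuousOn_empty _, by simp⟩
  have : ContractibleSpace S := hS.contractibleSpace hne
  have : LocallyPathConnectedSpace S := ho.locallyPathConnectedSpace
  obtain ⟨a⟩ := hne.to_subtype
  obtain ⟨r, hr⟩ := Circle.exp_surjective (g a)
  obtain ⟨f, ⟨-, hf⟩, -⟩ := Circle.isCoveringMap_exp.existsUnique_continuousMap_lifts
    ⟨S.domRestrict g, continuousOn_iff_continuous_domRestrict.1 hg⟩ a r hr
  refine ⟨fun x => if h : x ∈ S then f ⟨x, h⟩ else 0, ?_, fun x hx => ?_⟩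
  · rw [continuousOn_iff_continuous_domRestrict]
    convert! f.continuous using 1
    ext x
    simp
  · simpa [hx] using congrFun hf ⟨x, hx⟩

theorem Convex.hasLog {S : Set T} (hS : Convex ℝ S) (ho : IsOpen S) : HasLog S := by
  rcases S.eq_empty_or_nonempty with rfl | ⟨x, hx⟩
  · exact fun _ _ => ⟨fun _ => 0, continuousOn_empty _, by simp⟩
  · exact (hS.starConvex hx).hasLog ho

/-- Removing from `ℝ × W` one or the other closed half-line of the first axis leaves two sets,
star-shaped about `(1, 0)` and `(-1, 0)`. They cover the complement of the origin and meet in `ℝ ×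
(W ∖ 0)`, which is connected because `W` has dimension at least two. -/
theorem hasLog_prod_compl_zero_of_rank {W : Type*} [NormedAddCommGroup W] [NormedSpace ℝ W]
    (hW : 1 < Module.rank ℝ W) {K : Set T} (hK : Convex ℝ K) (ho : IsOpen K) :
    HasLog (K ×ˢ ({0}ᶜ : Set (ℝ × W))) := by
  rcases K.eq_empty_or_nonempty with rfl | ⟨k, hk⟩
  · rw [empty_prod]
    exact (convex_empty (𝕜 := ℝ)).hasLog isOpen_empty
  have hopen : ∀ ε : ℝ, IsOpen (K ×ˢ {w : ℝ × W | w.2 ≠ 0 ∨ 0 < ε * w.1}) := fun ε =>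
    ho.prod ((isOpen_ne_fun continuous_snd continuous_const).union
      (isOpen_lt continuous_const (continuous_const.mul continuous_fst)))
  have hstar : ∀ ε : ℝ, ε * ε = 1 → HasLog (K ×ˢ {w : ℝ × W | w.2 ≠ 0 ∨ 0 < ε * w.1}) := by
    intro ε hε
    refine StarConvex.hasLog (x := (k, (ε, 0))) ?_ (hopen ε)
    rintro ⟨u, a, v⟩ ⟨hu, hw⟩ s t hs ht hst
    refine ⟨hK hk hu hs ht hst, ?_⟩
    simp only [mem_ofPred_eq, Prod.snd_add, Prod.smul_snd, smul_zero, zero_add, Prod.fst_add,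
      Prod.smul_fst, smul_eq_mul] at hw ⊢
    rcases ht.eq_or_lt with rfl | ht
    · right
      obtain rfl : s = 1 := by linarith
      nlinarith
    · rcases hw with hw | hw
      · exact .inl (smul_ne_zero ht.ne' hw)
      · right
        have := mul_pos ht hw
        nlinarith
  have hunion : K ×ˢ ({0}ᶜ : Set (ℝ × W)) =
      (K ×ˢ {w : ℝ × W | w.2 ≠ 0 ∨ 0 < (1 : ℝ) * w.1}) ∪
        (K ×ˢ {w : ℝ × W | w.2 ≠ 0 ∨ 0 < (-1 : ℝ) * w.1}) := by
    ext ⟨u, a, v⟩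
    simp only [mem_prod, mem_compl_iff, mem_singleton_iff, Prod.mk_eq_zero, mem_union,
      mem_ofPred_eq, one_mul, neg_mul, Left.neg_pos_iff, not_and_or]
    rw [← ne_eq a, ne_iff_lt_or_gt]
    tauto
  rw [hunion]
  refine (hstar 1 (by norm_num)).union (hstar (-1) (by norm_num)) (hopen _) (hopen _) ?_
  have hinter : (K ×ˢ {w : ℝ × W | w.2 ≠ 0 ∨ 0 < (1 : ℝ) * w.1}) ∩
      (K ×ˢ {w : ℝ × W | w.2 ≠ 0 ∨ 0 < (-1 : ℝ) * w.1}) =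
        K ×ˢ ((univ : Set ℝ) ×ˢ ({0}ᶜ : Set W)) := by
    ext ⟨u, a, v⟩
    simp only [mem_prod, mem_inter_iff, mem_ofPred_eq, one_mul, neg_mul, Left.neg_pos_iff,
      mem_univ, true_and, mem_compl_iff, mem_singleton_iff]
    constructor
    · rintro ⟨⟨h1, h2⟩, -, h3⟩
      refine ⟨h1, fun h => ?_⟩
      simp only [h, ne_eq, not_true_eq_false, false_or] at h2 h3
      linarith
    · exact fun h => ⟨⟨h.1, .inl h.2⟩, h.1, .inl h.2⟩
  rw [hinter]
  exact hK.isPreconnected.prod (isPreconnected_univ.prod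
    (isConnected_compl_singleton_of_one_lt_rank hW 0).isPreconnected)

/-- The complement of the origin in a real vector space of dimension at least three has no first
cohomology, also after multiplication with a convex set. -/
theorem hasLog_prod_compl_zero {Z : Type*} [NormedAddCommGroup Z] [NormedSpace ℝ Z]
    [FiniteDimensional ℝ Z] (hZ : 3 ≤ Module.finrank ℝ Z) {K : Set T} (hK : Convex ℝ K)
    (ho : IsOpen K) : HasLog (K ×ˢ ({0}ᶜ : Set Z)) := by
  obtain ⟨d, hd⟩ := Nat.exists_eq_add_of_le hZ
  let A : Z ≃L[ℝ] ℝ × EuclideanSpace ℝ (Fin (d + 2)) :=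
    .ofFinrankEq (by simp [hd]; ring)
  have hW : 1 < Module.rank ℝ (EuclideanSpace ℝ (Fin (d + 2))) := by
    rw [← Module.finrank_eq_rank]
    simp only [finrank_euclideanSpace, Fintype.card_fin]
    exact_mod_cast (by lia : 1 < d + 2)
  refine (hasLog_prod_compl_zero_of_rank hW hK ho).congr_homeomorph (Prod.map id A)
    (Prod.map id A.symm) (by fun_prop) (by fun_prop) ?_ ?_ ?_
  · rintro ⟨u, z⟩ ⟨hu, hz⟩
    exact ⟨hu, by simpa using hz⟩
  · rintro ⟨u, z⟩ ⟨hu, hz⟩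
    exact ⟨hu, by simpa using hz⟩
  · rintro ⟨u, z⟩ -
    simp

section

attribute [local instance] finrank_real_complex_fact'

theorem Circle.contMDiff_coe : ContMDiff (𝓡 1) 𝓘(ℝ, ℂ) ∞ (fun z : Circle => (z : ℂ)) :=
  contMDiff_coe_sphere

end

/-- A continuous logarithm of a smooth function is smooth. -/
theorem contDiffOn_of_circle_exp {S : Set T} (ho : IsOpen S) {f : T → ℝ} {g : T → Circle}
    (hf : ContinuousOn f S) (hg : ContMDiffOn 𝓘(ℝ, T) (𝓡 1) ∞ g S)
    (h : ∀ x ∈ S, Circle.exp (f x) = g x) : ContDiffOn ℝ ∞ f S := by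
  intro x hx
  refine ContDiffAt.contDiffWithinAt ?_
  have hg' : ContDiffAt ℝ ∞ (fun y => (g y : ℂ)) x := by
    rw [← contMDiffAt_iff_contDiffAt]
    exact Circle.contMDiff_coe.contMDiffAt.comp x
      (hg.contMDiffAt (ho.mem_nhds hx))
  -- Close to `x` the difference `f y - f x` lies in `(-π, π)`, so the principal branch of the
  -- logarithm recovers it from `g y / g x`.
  have hev : f =ᶠ[𝓝 x] fun y => f x + (Complex.log ((g y : ℂ) / (g x : ℂ))).im := by
    have hfx : ContinuousAt f x := hf.continuousAt (ho.mem_nhds hx)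
    filter_upwards [ho.mem_nhds hx, hfx.eventually (Metric.ball_mem_nhds (f x) Real.pi_pos)]
      with y hy hfy
    rw [Real.dist_eq, abs_lt] at hfy
    have : (g y : ℂ) / (g x : ℂ) = Complex.exp (((f y - f x : ℝ) : ℂ) * Complex.I) := by
      rw [← h x hx, ← h y hy, ← Circle.coe_div, ← Circle.exp_sub, Circle.coe_exp]
    rw [this, Complex.log_exp (by simp; linarith) (by simp; linarith)]
    simp
  refine ContDiffAt.congr_of_eventuallyEq ?_ hev
  refine contDiffAt_const.add
    (Complex.imCLM.contDiff.contDiffAt.comp (f := fun y => Complex.log ((g y : ℂ) / g x)) x ?_)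
  have hlog : ContDiffAt ℝ ∞ Complex.log ((g x : ℂ) / (g x : ℂ)) := by
    rw [div_self (Circle.coe_ne_zero _)]
    exact (Complex.contDiffAt_log Complex.one_mem_slitPlane).restrict_scalars ℝ
  exact hlog.comp x (hg'.div_const _)

theorem HasLog.exists_contDiffOn {S : Set T} (hS : HasLog S) (ho : IsOpen S) {g : T → Circle}
    (hg : ContMDiffOn 𝓘(ℝ, T) (𝓡 1) ∞ g S) :
    ∃ f : T → ℝ, ContDiffOn ℝ ∞ f S ∧ ∀ x ∈ S, Circle.exp (f x) = g x := by
  obtain ⟨f, hf, hfg⟩ := hS g hg.continuousOn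
  exact ⟨f, contDiffOn_of_circle_exp ho hf hg hfg, hfg⟩

end LogNormed

/-! ### Principal circle bundles and comparison of lifts. -/

section PrincipalBundle

variable {X V' B M : Type*} [NormedAddCommGroup X] [NormedSpace ℝ X] [TopologicalSpace M]
  [ChartedSpace X M] [NormedAddCommGroup V'] [NormedSpace ℝ V'] [TopologicalSpace B]
  [ChartedSpace V' B] [MulAction Circle M] {p : M → B}

namespace IsPrincipalCircleBundle

theorem smul_left_cancel_of_eq (hp : IsPrincipalCircleBundle 𝓘(ℝ, X) 𝓘(ℝ, V') p) {a b : Circle}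
    {m : M} (h : a • m = b • m) : a = b := by
  obtain ⟨e, he, -, hmul⟩ := hp.locally_trivial (p m)
  have hm : m ∈ e.source := e.mem_source.2 he
  have := congrArg (fun x => (e x).2) h
  simp only [hmul a m hm, hmul b m hm] at this
  exact mul_right_cancel this

theorem exists_smul_eq (hp : IsPrincipalCircleBundle 𝓘(ℝ, X) 𝓘(ℝ, V') p) {m m' : M}
    (h : p m = p m') : ∃ a : Circle, m' = a • m := by
  obtain ⟨e, he, -, hmul⟩ := hp.locally_trivial (p m)
  have hm : m ∈ e.source := e.mem_source.2 he
  have hm' : m' ∈ e.source := e.mem_source.2 (h ▸ he)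
  refine ⟨(e m').2 / (e m).2, e.injOn hm' (e.mem_source.2 (by rwa [hp.invariant])) ?_⟩
  change e m' = e _
  refine Prod.ext ?_ ?_
  · rw [e.coe_fst hm', e.coe_fst (e.mem_source.2 (by rwa [hp.invariant])), hp.invariant, h]
  · rw [hmul _ m hm, div_mul_cancel]

theorem surjective (hp : IsPrincipalCircleBundle 𝓘(ℝ, X) 𝓘(ℝ, V') p) :
    Function.Surjective p := fun b => by
  obtain ⟨e, he, -⟩ := hp.locally_trivial b
  exact ⟨e.toOpenPartialHomeomorph.symm (b, 1), e.proj_symm_apply' he⟩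

variable {H E Y : Type*} [NormedAddCommGroup E] [NormedSpace ℝ E] [TopologicalSpace H]
  [TopologicalSpace Y] [ChartedSpace H Y] {J : ModelWithCorners ℝ E H}

/-- Two smooth maps to the total space over the same map to the base differ by a smooth
circle-valued function. -/
theorem exists_contMDiffOn_smul_eq (hp : IsPrincipalCircleBundle 𝓘(ℝ, X) 𝓘(ℝ, V') p)
    {f₁ f₂ : Y → M} {S : Set Y} (h₁ : ContMDiffOn J 𝓘(ℝ, X) ∞ f₁ S)
    (h₂ : ContMDiffOn J 𝓘(ℝ, X) ∞ f₂ S) (h : ∀ y ∈ S, p (f₁ y) = p (f₂ y)) :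
    ∃ g : Y → Circle, ContMDiffOn J (𝓡 1) ∞ g S ∧ ∀ y ∈ S, f₂ y = g y • f₁ y := by
  classical
  choose! g hg using fun y hy => hp.exists_smul_eq (h y hy)
  refine ⟨g, fun y hy => ?_, hg⟩
  obtain ⟨e, he, ⟨hsm, -⟩, hmul⟩ := hp.locally_trivial (p (f₁ y))
  have hs₁ : f₁ y ∈ e.source := e.mem_source.2 he
  have hs₂ : f₂ y ∈ e.source := e.mem_source.2 (h y hy ▸ he)
  have key : ∀ f : Y → M, ContMDiffOn J 𝓘(ℝ, X) ∞ f S → f y ∈ e.source →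
      ContMDiffWithinAt J (𝓡 1) ∞ (fun z => (e (f z)).2) S y := fun f hf hfy =>
    contMDiff_snd.contMDiffAt.comp_contMDiffWithinAt y
      ((hsm.contMDiffAt (e.open_source.mem_nhds hfy)).comp_contMDiffWithinAt y (hf y hy))
  -- The function `g` was chosen point by point, but in a local trivialization it must be the
  -- quotient of the fibre coordinates, which is smooth.
  refine ((key f₂ h₂ hs₂).div (key f₁ h₁ hs₁)).congr_of_eventuallyEq ?_ ?_
  · filter_upwards [self_mem_nhdsWithin,
      (h₁.continuousOn y hy).eventually (e.open_source.mem_nhds hs₁)] with z hz hz₁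
    rw [hg z hz, hmul _ _ hz₁, mul_div_cancel_right]
  · rw [hg y hy, hmul _ _ hs₁, mul_div_cancel_right]

theorem contMDiffOn_smul (hp : IsPrincipalCircleBundle 𝓘(ℝ, X) 𝓘(ℝ, V') p)
    {f : Y → M} {g : Y → Circle} {S : Set Y} (hg : ContMDiffOn J (𝓡 1) ∞ g S)
    (hf : ContMDiffOn J 𝓘(ℝ, X) ∞ f S) : ContMDiffOn J 𝓘(ℝ, X) ∞ (fun y => g y • f y) S :=
  hp.smooth_action.comp_contMDiffOn (hg.prodMk hf)

theorem contMDiff_proj (hp : IsPrincipalCircleBundle 𝓘(ℝ, X) 𝓘(ℝ, V') p) :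
    ContMDiff 𝓘(ℝ, X) 𝓘(ℝ, V') ∞ p := fun m => by
  obtain ⟨e, he, ⟨hsm, -⟩, -⟩ := hp.locally_trivial (p m)
  have hm : m ∈ e.source := e.mem_source.2 he
  have := contMDiff_fst.contMDiffAt.comp m (hsm.contMDiffAt (e.open_source.mem_nhds hm))
  refine this.congr_of_eventuallyEq ?_
  filter_upwards [e.open_source.mem_nhds hm] with x hx
  exact (e.coe_fst hx).symm

end IsPrincipalCircleBundle

/-! ### Gluing two lifts. -/

section Lift

variable {T : Type*} [NormedAddCommGroup T] [NormedSpace ℝ T]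

/-- The map `q` to the base of a bundle `p` has a smooth lift to the total space over `S`. -/
def HasLift (X : Type*) {M : Type*} [NormedAddCommGroup X] [NormedSpace ℝ X] [TopologicalSpace M]
    [ChartedSpace X M] (p : M → B) (q : T → B) (S : Set T) : Prop :=
  ∃ s : T → M, ContMDiffOn 𝓘(ℝ, T) 𝓘(ℝ, X) ∞ s S ∧ ∀ x ∈ S, p (s x) = q x

theorem HasLift.mono {B M : Type*} [TopologicalSpace M] [ChartedSpace X M] {p : M → B} {q : T → B}
    {S S' : Set T} (h : HasLift X p q S) (hS : S' ⊆ S) :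
    HasLift X p q S' := by
  obtain ⟨s, hs, hq⟩ := h
  exact ⟨s, hs.mono hS, fun x hx => hq x (hS hx)⟩

/-- With smooth nonnegative functions `f₁`, `f₂` supported exactly on `S₁`, `S₂`, the quotient `f₂ /
(f₁ + f₂)` is `0` on `S₁ ∖ S₂` and `1` on `S₂ ∖ S₁`. A smooth step makes it locally constant near
these sets, so that functions defined only on `S₁ ∩ S₂` can be multiplied by it and extended by
zero. -/
theorem exists_smooth_cutoff [FiniteDimensional ℝ T] {S₁ S₂ : Set T} (h₁ : IsOpen S₁)
    (h₂ : IsOpen S₂) : ∃ ρ : T → ℝ, ContDiffOn ℝ ∞ ρ (S₁ ∪ S₂) ∧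
      (∀ x ∈ S₁ \ S₂, ∀ᶠ y in 𝓝 x, ρ y = 0) ∧ ∀ x ∈ S₂ \ S₁, ∀ᶠ y in 𝓝 x, ρ y = 1 := by
  obtain ⟨f₁, hf₁, hc₁, hr₁⟩ := h₁.exists_contDiff_support_eq (n := (⊤ : ℕ∞))
  obtain ⟨f₂, hf₂, hc₂, hr₂⟩ := h₂.exists_contDiff_support_eq (n := (⊤ : ℕ∞))
  have hn₁ : ∀ x, 0 ≤ f₁ x := fun x => (hr₁ (mem_range_self x)).1
  have hn₂ : ∀ x, 0 ≤ f₂ x := fun x => (hr₂ (mem_range_self x)).1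
  have hp₁ : ∀ x, x ∈ S₁ ↔ 0 < f₁ x := fun x => by
    rw [← hf₁, Function.mem_support, (hn₁ x).lt_iff_ne']
  have hp₂ : ∀ x, x ∈ S₂ ↔ 0 < f₂ x := fun x => by
    rw [← hf₂, Function.mem_support, (hn₂ x).lt_iff_ne']
  have hpos : ∀ x ∈ S₁ ∪ S₂, 0 < f₁ x + f₂ x := by
    rintro x (hx | hx)
    · exact add_pos_of_pos_of_nonneg ((hp₁ x).1 hx) (hn₂ x)
    · exact add_pos_of_nonneg_of_pos (hn₁ x) ((hp₂ x).1 hx)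
  have hr : ContDiffOn ℝ ∞ (fun x => f₂ x / (f₁ x + f₂ x)) (S₁ ∪ S₂) :=
    hc₂.contDiffOn.div (hc₁.add hc₂).contDiffOn fun x hx => (hpos x hx).ne'
  have hcont : ∀ x ∈ S₁ ∪ S₂, ContinuousAt (fun x => f₂ x / (f₁ x + f₂ x)) x := fun x hx =>
    hr.continuousOn.continuousAt ((h₁.union h₂).mem_nhds hx)
  -- The step is `0` where the quotient is at most `1/3` and `1` where it is at least `2/3`.
  refine ⟨fun x => Real.smoothTransition (3 * (f₂ x / (f₁ x + f₂ x)) - 1),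
    Real.smoothTransition.contDiff.comp_contDiffOn ((contDiffOn_const.mul hr).sub
      contDiffOn_const), ?_, ?_⟩
  · rintro x ⟨hx₁, hx₂⟩
    have hz : f₂ x = 0 := by
      have := (hp₂ x).not.1 hx₂
      linarith [hn₂ x]
    have := (hcont x (.inl hx₁)).eventually_lt (continuousAt_const (y := (1 / 3 : ℝ)))
      (by simp [hz])
    filter_upwards [this] with y hy
    exact Real.smoothTransition.zero_of_nonpos (by linarith)
  · rintro x ⟨hx₂, hx₁⟩
    have hz : f₁ x = 0 := by
      have := (hp₁ x).not.1 hx₁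
      linarith [hn₁ x]
    have := (continuousAt_const (y := (2 / 3 : ℝ))).eventually_lt (hcont x (.inr hx₂))
      (by simp only [hz, zero_add]; rw [div_self ((hp₂ x).1 hx₂).ne']; norm_num)
    filter_upwards [this] with y hy
    exact Real.smoothTransition.one_of_one_le (by linarith)

variable {q : T → B}

/-- On the overlap `s₂ = exp(f) • s₁`. The smooth cutoff `ρ` splits `f` into a part that extends to
`S₁` and one that extends to `S₂`: `exp(ρ f) • s₁ = exp((ρ - 1) f) • s₂`, and the two sides define a
single lift over the union. -/
theorem HasLift.union [FiniteDimensional ℝ T]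
    (hp : IsPrincipalCircleBundle 𝓘(ℝ, X) 𝓘(ℝ, V') p) {S₁ S₂ : Set T}
    (h₁ : HasLift X p q S₁) (h₂ : HasLift X p q S₂) (ho₁ : IsOpen S₁) (ho₂ : IsOpen S₂)
    (hlog : HasLog (S₁ ∩ S₂)) : HasLift X p q (S₁ ∪ S₂) := by
  classical
  obtain ⟨s₁, hs₁, hq₁⟩ := h₁
  obtain ⟨s₂, hs₂, hq₂⟩ := h₂
  obtain ⟨g, hg, hgs⟩ := hp.exists_contMDiffOn_smul_eq (hs₁.mono inter_subset_left)
    (hs₂.mono inter_subset_right) fun x hx => by rw [hq₁ x hx.1, hq₂ x hx.2]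
  obtain ⟨f, hf, hfg⟩ := hlog.exists_contDiffOn (ho₁.inter ho₂) hg
  obtain ⟨ρ, hρ, hρ₁, hρ₂⟩ := exists_smooth_cutoff ho₁ ho₂
  have hF₁ : ContDiffOn ℝ ∞ (fun x => if x ∈ S₂ then ρ x * f x else 0) S₁ := by
    intro x hx
    refine ContDiffAt.contDiffWithinAt ?_
    by_cases hx₂ : x ∈ S₂
    · have : ContDiffAt ℝ ∞ (fun x => ρ x * f x) x :=
        (hρ.contDiffAt ((ho₁.union ho₂).mem_nhds (.inl hx))).mul
          (hf.contDiffAt ((ho₁.inter ho₂).mem_nhds ⟨hx, hx₂⟩))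
      refine this.congr_of_eventuallyEq ?_
      filter_upwards [ho₂.mem_nhds hx₂] with y hy
      simp [hy]
    · refine (contDiffAt_const (c := (0 : ℝ))).congr_of_eventuallyEq ?_
      filter_upwards [hρ₁ x ⟨hx, hx₂⟩] with y hy
      simp [hy]
  have hF₂ : ContDiffOn ℝ ∞ (fun x => if x ∈ S₁ then (ρ x - 1) * f x else 0) S₂ := by
    intro x hx
    refine ContDiffAt.contDiffWithinAt ?_
    by_cases hx₁ : x ∈ S₁
    · have : ContDiffAt ℝ ∞ (fun x => (ρ x - 1) * f x) x :=
        ((hρ.contDiffAt ((ho₁.union ho₂).mem_nhds (.inl hx₁))).sub contDiffAt_const).mul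
          (hf.contDiffAt ((ho₁.inter ho₂).mem_nhds ⟨hx₁, hx⟩))
      refine this.congr_of_eventuallyEq ?_
      filter_upwards [ho₁.mem_nhds hx₁] with y hy
      simp [hy]
    · refine (contDiffAt_const (c := (0 : ℝ))).congr_of_eventuallyEq ?_
      filter_upwards [hρ₂ x ⟨hx, hx₁⟩] with y hy
      simp [hy]
  set F₁ : T → ℝ := fun x => if x ∈ S₂ then ρ x * f x else 0 with hF₁def
  set F₂ : T → ℝ := fun x => if x ∈ S₁ then (ρ x - 1) * f x else 0 with hF₂def
  have e₁ : EqOn (fun x => if x ∈ S₁ then Circle.exp (F₁ x) • s₁ x else Circle.exp (F₂ x) • s₂ x)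
      (fun x => Circle.exp (F₁ x) • s₁ x) S₁ := fun x hx => by simp [hx]
  have e₂ : EqOn (fun x => if x ∈ S₁ then Circle.exp (F₁ x) • s₁ x else Circle.exp (F₂ x) • s₂ x)
      (fun x => Circle.exp (F₂ x) • s₂ x) S₂ := fun x hx => by
    by_cases hx₁ : x ∈ S₁
    · simp only [hx₁, if_true]
      rw [hgs x ⟨hx₁, hx⟩, ← hfg x ⟨hx₁, hx⟩, smul_smul, ← Circle.exp_add]
      simp only [hF₁def, hF₂def, hx, hx₁, if_true]
      ring_nf
    · simp [hx₁]
  have hsm : ∀ (F : T → ℝ) (s : T → M) (S : Set T), ContDiffOn ℝ ∞ F S →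
      ContMDiffOn 𝓘(ℝ, T) 𝓘(ℝ, X) ∞ s S →
      ContMDiffOn 𝓘(ℝ, T) 𝓘(ℝ, X) ∞ (fun x => Circle.exp (F x) • s x) S := fun F s S hF hs =>
    hp.contMDiffOn_smul (contMDiff_circleExp.comp_contMDiffOn hF.contMDiffOn) hs
  refine ⟨_, ContMDiffOn.union_of_isOpen ((hsm F₁ s₁ S₁ hF₁ hs₁).congr e₁)
    ((hsm F₂ s₂ S₂ hF₂ hs₂).congr e₂) ho₁ ho₂, ?_⟩
  rintro x (hx | hx)
  · rw [← hq₁ x hx, ← hp.invariant (Circle.exp (F₁ x)) (s₁ x)]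
    exact congrArg p (e₁ hx)
  · rw [← hq₂ x hx, ← hp.invariant (Circle.exp (F₂ x)) (s₂ x)]
    exact congrArg p (e₂ hx)

theorem IsPrincipalCircleBundle.exists_hasLift_nhds
    (hp : IsPrincipalCircleBundle 𝓘(ℝ, X) 𝓘(ℝ, V') p) {D : Set T} (hD : IsOpen D)
    (hq : ContMDiffOn 𝓘(ℝ, T) 𝓘(ℝ, V') ∞ q D) {x : T} (hx : x ∈ D) :
    ∃ U, IsOpen U ∧ x ∈ U ∧ HasLift X p q U := by
  obtain ⟨e, he, ⟨-, hsm⟩, -⟩ := hp.locally_trivial (q x)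
  refine ⟨D ∩ q ⁻¹' e.baseSet, hq.continuousOn.isOpen_inter_preimage hD e.open_baseSet,
    ⟨hx, he⟩, fun y => e.toOpenPartialHomeomorph.symm (q y, 1), ?_, fun y hy => ?_⟩
  · refine hsm.comp ((hq.mono inter_subset_left).prodMk contMDiffOn_const) fun y hy => ?_
    exact e.mem_target.2 hy.2
  · exact e.proj_symm_apply' hy.2

end Lift

end PrincipalBundle

/-! ### Lifts over boxes. -/

section LiftNear

open scoped Pointwise

variable {X V' B M T : Type*} [NormedAddCommGroup X] [NormedSpace ℝ X] [TopologicalSpace M]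
  [ChartedSpace X M] [NormedAddCommGroup V'] [NormedSpace ℝ V'] [TopologicalSpace B]
  [ChartedSpace V' B] [MulAction Circle M] {p : M → B}
  [NormedAddCommGroup T] [NormedSpace ℝ T] [FiniteDimensional ℝ T] {q : T → B}

/-- The map `q` has a smooth lift over a neighbourhood of `C`. -/
def LiftNear (X : Type*) {B M T : Type*} [NormedAddCommGroup X] [NormedSpace ℝ X]
    [TopologicalSpace M] [ChartedSpace X M] [NormedAddCommGroup T] [NormedSpace ℝ T]
    (p : M → B) (q : T → B) (C : Set T) : Prop :=
  ∃ U, IsOpen U ∧ C ⊆ U ∧ HasLift X p q U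

/-- Thickenings of convex sets are convex, and so is their intersection, on which logarithms
therefore exist. Compactness provides thickenings inside the given neighbourhoods. -/
theorem LiftNear.union (hp : IsPrincipalCircleBundle 𝓘(ℝ, X) 𝓘(ℝ, V') p) {C₁ C₂ : Set T}
    (h₁ : LiftNear X p q C₁) (h₂ : LiftNear X p q C₂) (hK₁ : IsCompact C₁) (hK₂ : IsCompact C₂)
    (hC₁ : Convex ℝ C₁) (hC₂ : Convex ℝ C₂) : LiftNear X p q (C₁ ∪ C₂) := by
  obtain ⟨U₁, ho₁, hU₁, hl₁⟩ := h₁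
  obtain ⟨U₂, ho₂, hU₂, hl₂⟩ := h₂
  obtain ⟨δ₁, hδ₁, ht₁⟩ := hK₁.exists_thickening_subset_open ho₁ hU₁
  obtain ⟨δ₂, hδ₂, ht₂⟩ := hK₂.exists_thickening_subset_open ho₂ hU₂
  refine ⟨_, Metric.isOpen_thickening.union Metric.isOpen_thickening,
    union_subset_union (Metric.self_subset_thickening hδ₁ _)
      (Metric.self_subset_thickening hδ₂ _),
    (hl₁.mono ht₁).union hp (hl₂.mono ht₂) Metric.isOpen_thickening Metric.isOpen_thickening
      (((hC₁.thickening _).inter (hC₂.thickening _)).hasLog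
        (Metric.isOpen_thickening.inter Metric.isOpen_thickening))⟩

/-- As in the proof of homotopy lifting, a lift near each slice `t • v + C` also covers the slabs
for nearby parameters. A fine subdivision of `[0, 1]` gives finitely many compact convex slabs,
whose lifts are glued one after the other. -/
theorem LiftNear.segment_add (hp : IsPrincipalCircleBundle 𝓘(ℝ, X) 𝓘(ℝ, V') p) {C : Set T}
    (hK : IsCompact C) (hC : Convex ℝ C) (v : T)
    (h : ∀ t ∈ Icc (0 : ℝ) 1, LiftNear X p q ({t • v} + C)) :
    LiftNear X p q (segment ℝ 0 v + C) := by
  have hseg : ∀ a b : ℝ, IsCompact ((fun t : ℝ => t • v) '' Icc a b + C) ∧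
      Convex ℝ ((fun t : ℝ => t • v) '' Icc a b + C) := fun a b =>
    ⟨(isCompact_Icc.image (by fun_prop)).add hK,
      ((convex_Icc a b).is_linear_image ⟨fun x y => add_smul x y v, fun c x => by
        simp [mul_smul]⟩).add hC⟩
  choose U hUo hCU hU using h
  have hδ : ∀ i : Icc (0 : ℝ) 1, ∃ δ > 0, Metric.thickening δ ({i.1 • v} + C) ⊆ U i i.2 :=
    fun i => ((isCompact_singleton.add hK).exists_thickening_subset_open (hUo i i.2) (hCU i i.2))
  choose δ hδ₀ hδ using hδ
  -- Each subinterval of the subdivision lies in one of the open sets of parameters whose slices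
  -- stay within a thickening on which a lift exists.
  obtain ⟨t, ht₀, htm, ⟨m, hm⟩, ht⟩ := exists_monotone_Icc_subset_open_cover_Icc
    (zero_le_one' ℝ) (c := fun i : Icc (0 : ℝ) 1 => {s | dist (s.1 • v) (i.1 • v) < δ i})
    (fun i => isOpen_lt (by fun_prop) continuous_const)
    (fun s _ => mem_iUnion.2 ⟨s, by simpa using hδ₀ s⟩)
  have hloc : ∀ n, LiftNear X p q ((fun t : ℝ => t • v) '' Icc (t n).1 (t (n + 1)).1 + C) := by
    intro n
    obtain ⟨i, hi⟩ := ht n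
    refine ⟨U i i.2, hUo i i.2, ?_, hU i i.2⟩
    rintro _ ⟨_, ⟨s, hs, rfl⟩, x, hx, rfl⟩
    refine hδ i (Metric.mem_thickening_iff.2 ⟨i.1 • v + x, add_mem_add rfl hx, ?_⟩)
    simp only [dist_add_right]
    exact hi (show (⟨s, (t n).2.1.trans hs.1, hs.2.trans (t (n + 1)).2.2⟩ : Icc (0 : ℝ) 1) ∈ _
      from ⟨hs.1, hs.2⟩)
  have hall : ∀ n, LiftNear X p q ((fun t : ℝ => t • v) '' Icc 0 (t n).1 + C) := by
    intro n
    induction n with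
    | zero =>
      rw [ht₀]
      refine ⟨U 0 (by simp), hUo 0 _, ?_, hU 0 _⟩
      simpa using hCU 0 (by simp)
    | succ n ih =>
      have := LiftNear.union hp ih (hloc n) (hseg _ _).1 (hseg _ _).1 (hseg _ _).2 (hseg _ _).2
      rwa [← union_add, ← image_union, Icc_union_Icc_eq_Icc (t n).2.1 (htm n.le_succ)] at this
  have := hall m
  rw [hm m le_rfl] at this
  rwa [segment_eq_image, show (fun θ : ℝ => (1 - θ) • (0 : T) + θ • v) = fun t => t • v by
    ext; simp]

/-- Induction on the number of edges of the parallelepiped: its slices along one edge are translates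
of a parallelepiped with one edge fewer. This is why the corner `x` has to vary in the induction. -/
theorem LiftNear.sum_segment (hp : IsPrincipalCircleBundle 𝓘(ℝ, X) 𝓘(ℝ, V') p) {D : Set T}
    (hD : IsOpen D) (hq : ContMDiffOn 𝓘(ℝ, T) 𝓘(ℝ, V') ∞ q D) {ι : Type*} (I : Finset ι)
    (v : ι → T) : ∀ x : T, {x} + ∑ i ∈ I, segment ℝ 0 (v i) ⊆ D →
      LiftNear X p q ({x} + ∑ i ∈ I, segment ℝ 0 (v i)) := by
  classical
  have hcc : ∀ J : Finset ι, IsCompact (∑ i ∈ J, segment ℝ 0 (v i)) ∧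
      Convex ℝ (∑ i ∈ J, segment ℝ 0 (v i)) := by
    intro J
    induction J using Finset.induction_on with
    | empty =>
      rw [Finset.sum_empty]
      exact ⟨isCompact_singleton (x := (0 : T)), convex_singleton (𝕜 := ℝ) (0 : T)⟩
    | insert j J hj ih =>
      rw [Finset.sum_insert hj]
      refine ⟨IsCompact.add ?_ ih.1, (convex_segment _ _).add ih.2⟩
      rw [segment_eq_image]
      exact isCompact_Icc.image (by fun_prop)
  induction I using Finset.induction_on with
  | empty =>
    intro x hx
    simp only [Finset.sum_empty, add_zero, singleton_subset_iff] at hx ⊢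
    obtain ⟨U, hU, hxU, hl⟩ := hp.exists_hasLift_nhds (X := X) hD hq hx
    exact ⟨U, hU, singleton_subset_iff.2 hxU, hl⟩
  | insert j J hj ih =>
    intro x hx
    rw [Finset.sum_insert hj, add_left_comm] at hx ⊢
    refine LiftNear.segment_add hp (isCompact_singleton.add (hcc J).1)
      ((convex_singleton _).add (hcc J).2) _ fun t ht => ?_
    have hmem : t • v j ∈ segment ℝ 0 (v j) := by
      rw [segment_eq_image]
      exact ⟨t, ht, by simp⟩
    rw [← add_assoc, singleton_add_singleton]
    refine ih _ (Subset.trans ?_ hx)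
    rw [← singleton_add_singleton, add_assoc]
    exact add_subset_add_right (singleton_subset_iff.2 hmem)

/-- A map from a product with a Euclidean space has a smooth lift over the product of a small
ball and any given ball in the Euclidean space. -/
theorem IsPrincipalCircleBundle.exists_hasLift_ball_prod_ball
    (hp : IsPrincipalCircleBundle 𝓘(ℝ, X) 𝓘(ℝ, V') p) {ι : Type*} [Fintype ι] {q : T ×
    EuclideanSpace ℝ ι → B} {D : Set T} (hD : IsOpen D)
    (hq : ContMDiffOn 𝓘(ℝ, T × EuclideanSpace ℝ ι) 𝓘(ℝ, V') ∞ q (D ×ˢ univ))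
    {x : T} (hx : x ∈ D) (R : ℝ) :
    ∃ ε > 0, HasLift X p q (Metric.ball x ε ×ˢ Metric.ball 0 R) := by
  classical
  rcases le_or_gt R 0 with hR | hR
  · refine ⟨1, one_pos, ?_⟩
    -- The set is empty, but a point of `M` is still needed as the value of a total function.
    rw [Metric.ball_eq_empty.2 hR, prod_empty]
    obtain ⟨m, -⟩ := hp.surjective (q (x, 0))
    exact ⟨fun _ => m, contMDiffOn_const, by simp⟩
  -- The segments of length `2R` starting at the corner `(-R, …, -R)` span the cube `[-R, R]^ι`,
  -- which contains the closed ball of radius `R`.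
  let v : ι → T × EuclideanSpace ℝ ι := fun i => (0, EuclideanSpace.single i (2 * R))
  let x₀ : T × EuclideanSpace ℝ ι := (x, WithLp.toLp 2 fun _ => -R)
  have hsum : ∀ I : Finset ι, ∀ y ∈ ∑ i ∈ I, segment ℝ 0 (v i), y.1 = 0 := by
    intro I
    induction I using Finset.induction_on with
    | empty => simp
    | insert j J hj ih =>
      rw [Finset.sum_insert hj]
      rintro _ ⟨a, ha, b, hb, rfl⟩
      rw [segment_eq_image] at ha
      obtain ⟨t, -, rfl⟩ := ha
      simp [v, ih b hb]
  have hsub : {x₀} + ∑ i, segment ℝ 0 (v i) ⊆ D ×ˢ univ := by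
    rintro _ ⟨_, rfl, y, hy, rfl⟩
    simpa [x₀, hsum _ y hy] using hx
  obtain ⟨U, hU, hCU, hl⟩ := LiftNear.sum_segment hp (hD.prod isOpen_univ) hq
    Finset.univ v x₀ hsub
  have hball : {x} ×ˢ Metric.closedBall (0 : EuclideanSpace ℝ ι) R ⊆ U := by
    refine Subset.trans ?_ hCU
    rintro ⟨_, y⟩ ⟨rfl, hy⟩
    have hy' : ∀ i, |y i| ≤ R := fun i =>
      (PiLp.norm_apply_le y i).trans (by simpa using hy)
    refine ⟨x₀, rfl, ∑ i, ((y i + R) / (2 * R)) • v i,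
      Set.finsetSum_mem_finsetSum _ _ _ fun i _ => ?_, ?_⟩
    · rw [segment_eq_image]
      have := abs_le.1 (hy' i)
      refine ⟨(y i + R) / (2 * R), ⟨div_nonneg (by linarith) (by linarith), ?_⟩, by simp⟩
      rw [div_le_one (by linarith)]
      linarith
    · refine Prod.ext ?_ ?_
      · simp [x₀, v, Prod.fst_sum]
      · ext j
        simp only [x₀, v, Prod.snd_add, Prod.snd_sum, Prod.smul_snd, PiLp.add_apply,
          WithLp.ofLp_sum, Finset.sum_apply, PiLp.smul_apply, smul_eq_mul,
          PiLp.single_apply, mul_ite, mul_zero, Finset.sum_ite_eq, Finset.mem_univ, if_true]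
        field_simp
        ring
  obtain ⟨δ, hδ, hthick⟩ := (isCompact_singleton.prod
    (isCompact_closedBall (0 : EuclideanSpace ℝ ι) R)).exists_thickening_subset_open hU hball
  refine ⟨δ, hδ, hl.mono (Subset.trans ?_ hthick)⟩
  rintro ⟨u, y⟩ ⟨hu, hy⟩
  refine Metric.mem_thickening_iff.2 ⟨(x, y), ⟨rfl, Metric.ball_subset_closedBall hy⟩, ?_⟩
  simpa [Prod.dist_eq, hδ] using hu

end LiftNear

/-! ### Lifts over a punctured vector space, from two stereographic caps. -/

section Caps

variable {X V' B M T : Type*} [NormedAddCommGroup X] [NormedSpace ℝ X] [TopologicalSpace M]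
  [ChartedSpace X M] [NormedAddCommGroup V'] [NormedSpace ℝ V'] [TopologicalSpace B]
  [ChartedSpace V' B] [MulAction Circle M] {p : M → B}
  [NormedAddCommGroup T] [NormedSpace ℝ T] [FiniteDimensional ℝ T]

/-- The Euclidean length of a vector in `ℝ × W`. -/
noncomputable def euclLength {W : Type*} [NormedAddCommGroup W] (w : ℝ × W) : ℝ :=
  √(w.1 ^ 2 + ‖w.2‖ ^ 2)

/-- The part of the complement of the origin in `ℝ × W` that lies away from a half-line; its
stereographic image is a ball. -/
def stereoCap (W : Type*) [NormedAddCommGroup W] (ε : ℝ) : Set (ℝ × W) :=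
  {w | ‖w.2‖ < 2 * (euclLength w + ε * w.1)}

section Length

variable {W : Type*} [NormedAddCommGroup W]

theorem euclLength_sq (w : ℝ × W) : euclLength w ^ 2 = w.1 ^ 2 + ‖w.2‖ ^ 2 :=
  Real.sq_sqrt (by positivity)

theorem euclLength_nonneg (w : ℝ × W) : 0 ≤ euclLength w := Real.sqrt_nonneg _

theorem sq_add_norm_sq_pos {w : ℝ × W} (hw : w ≠ 0) : 0 < w.1 ^ 2 + ‖w.2‖ ^ 2 := by
  by_cases h : w.1 = 0
  · have : w.2 ≠ 0 := fun h' => hw (Prod.ext h h')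
    positivity
  · positivity

theorem continuous_euclLength : Continuous (euclLength : ℝ × W → ℝ) := by
  unfold euclLength
  fun_prop

theorem isOpen_stereoCap (ε : ℝ) : IsOpen (stereoCap W ε) :=
  isOpen_lt (by fun_prop) (continuous_const.mul (continuous_euclLength.add (by fun_prop)))

theorem stereoCap_subset (ε : ℝ) : stereoCap W ε ⊆ {0}ᶜ := by
  rintro w hw rfl
  simp [stereoCap, euclLength] at hw

/-- If `w` lies in neither cap, adding the two inequalities bounds the length of `w` by `‖w.2‖ / 2`,
although it is at least `‖w.2‖`; so `w = 0`. -/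
theorem stereoCap_union : stereoCap W 1 ∪ stereoCap W (-1) = {0}ᶜ := by
  refine Subset.antisymm (union_subset (stereoCap_subset _) (stereoCap_subset _)) fun w hw => ?_
  by_contra h
  simp only [stereoCap, mem_union, mem_ofPred_eq, not_or, not_lt, one_mul, neg_mul] at h
  have h1 := euclLength_sq w
  have h2 := sq_add_norm_sq_pos hw
  have h3 := euclLength_nonneg w
  nlinarith [sq_nonneg w.1, norm_nonneg w.2]

/-- The two conditions together say `‖w.2‖ / 2 + |w.1| < euclLength w`, and squaring turns this into
a bound on the slope `w.1 / ‖w.2‖`. The overlap is thus an interval times a punctured vector space.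
-/
theorem mem_stereoCap_inter (w : ℝ × W) :
    w ∈ stereoCap W 1 ∩ stereoCap W (-1) ↔ w.2 ≠ 0 ∧ |w.1| < 3 / 4 * ‖w.2‖ := by
  have h1 := euclLength_sq w
  have h3 := euclLength_nonneg w
  have h4 := norm_nonneg w.2
  simp only [stereoCap, mem_inter_iff, mem_ofPred_eq, one_mul, neg_mul]
  have hiff : (‖w.2‖ < 2 * (euclLength w + w.1) ∧ ‖w.2‖ < 2 * (euclLength w + -w.1)) ↔
      ‖w.2‖ / 2 + |w.1| < euclLength w := by
    rw [← lt_sub_iff_add_lt', abs_lt]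
    constructor <;> rintro ⟨h, h'⟩ <;> constructor <;> linarith
  rw [hiff, ← sq_lt_sq₀ (by positivity) h3, h1, ← norm_pos_iff]
  have h5 := sq_abs w.1
  have h6 := abs_nonneg w.1
  constructor
  · intro h
    have : 0 < ‖w.2‖ := by
      rcases h4.eq_or_lt with h0 | h0
      · rw [← h0] at h
        nlinarith
      · exact h0
    refine ⟨this, ?_⟩
    by_contra! hc
    nlinarith
  · rintro ⟨h, h'⟩
    nlinarith

variable [InnerProductSpace ℝ W]

theorem contDiffOn_euclLength : ContDiffOn ℝ ∞ (euclLength : ℝ × W → ℝ) {0}ᶜ :=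
  ((contDiff_fst.pow 2).add (contDiff_snd.norm_sq ℝ)).contDiffOn.sqrt
    fun _ hw => (sq_add_norm_sq_pos hw).ne'

end Length

variable {ι : Type*} [Fintype ι]

/-- Up to positive scaling, inverse stereographic projection is the polynomial map `y ↦ (ε (1 -
‖y‖²), 2y)`, and the cap consists of the rays that meet the image of the ball of radius `2`. A lift
over this ball, composed with `w ↦ w.2 / (euclLength w + ε w.1)`, is a lift over the cap because `q`
is invariant under homotheties. -/
theorem IsPrincipalCircleBundle.exists_hasLift_stereoCap
    (hp : IsPrincipalCircleBundle 𝓘(ℝ, X) 𝓘(ℝ, V') p) {q : T × (ℝ × EuclideanSpace ℝ ι) → B}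
    {D : Set T} (hD : IsOpen D)
    (hq : ContMDiffOn 𝓘(ℝ, T × (ℝ × EuclideanSpace ℝ ι)) 𝓘(ℝ, V') ∞ q (D ×ˢ {0}ᶜ))
    (hhom : ∀ u ∈ D, ∀ w, ∀ r : ℝ, 0 < r → q (u, r • w) = q (u, w))
    {x : T} (hx : x ∈ D) {ε : ℝ} (hε : ε * ε = 1) :
    ∃ δ > 0, HasLift X p q (Metric.ball x δ ×ˢ stereoCap (EuclideanSpace ℝ ι) ε) := by
  have hτ : ContDiff ℝ ∞ fun y : EuclideanSpace ℝ ι =>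
      ((ε * (1 - ‖y‖ ^ 2), (2 : ℝ) • y) : ℝ × EuclideanSpace ℝ ι) :=
    (contDiff_const.mul (contDiff_const.sub (contDiff_id.norm_sq ℝ))).prodMk
      (contDiff_id.const_smul (2 : ℝ))
  have hε0 : ε ≠ 0 := by rintro rfl; simp at hε
  have hτ0 : ∀ y : EuclideanSpace ℝ ι,
      ((ε * (1 - ‖y‖ ^ 2), (2 : ℝ) • y) : ℝ × EuclideanSpace ℝ ι) ∈
        ({0}ᶜ : Set (ℝ × EuclideanSpace ℝ ι)) := by
    intro y h
    simp only [mem_singleton_iff, Prod.mk_eq_zero, smul_eq_zero, OfNat.ofNat_ne_zero,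
      false_or] at h
    rw [h.2] at h
    simp [hε0] at h
  obtain ⟨δ, hδ, s, hs, hsq⟩ := hp.exists_hasLift_ball_prod_ball (X := X)
    (q := fun y : T × EuclideanSpace ℝ ι =>
    q (y.1, (ε * (1 - ‖y.2‖ ^ 2), (2 : ℝ) • y.2))) hD (hq.comp
      (contDiff_fst.prodMk (hτ.comp contDiff_snd)).contMDiff.contMDiffOn
      (fun y hy => ⟨hy.1, hτ0 y.2⟩)) hx 2
  obtain ⟨δ', hδ', hball⟩ := Metric.isOpen_iff.1 hD x hx
  have hpos : ∀ w ∈ stereoCap (EuclideanSpace ℝ ι) ε, 0 < euclLength w + ε * w.1 := fun w hw => by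
    have := (norm_nonneg w.2).trans_lt hw
    linarith
  refine ⟨min δ δ', lt_min hδ hδ', fun y => s (y.1, (euclLength y.2 + ε * y.2.1)⁻¹ • y.2.2),
    hs.comp (ContDiffOn.contMDiffOn ?_) ?_, ?_⟩
  · have hlen : ContDiffOn ℝ ∞ (fun y : T × (ℝ × EuclideanSpace ℝ ι) =>
        euclLength y.2 + ε * y.2.1) (Metric.ball x (min δ δ') ×ˢ stereoCap _ ε) :=
      (contDiffOn_euclLength.comp contDiff_snd.contDiffOn
        fun y hy => stereoCap_subset _ hy.2).add (contDiff_const.mul contDiff_snd.fst).contDiffOn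
    exact contDiff_fst.contDiffOn.prodMk ((hlen.inv fun y hy => (hpos _ hy.2).ne').smul
      contDiff_snd.snd.contDiffOn)
  · rintro ⟨u, w⟩ ⟨hu, hw⟩
    refine ⟨Metric.ball_subset_ball (min_le_left _ _) hu, ?_⟩
    have h := hpos w hw
    rw [mem_ball_zero_iff, norm_smul, norm_inv, Real.norm_of_nonneg h.le, inv_mul_lt_iff₀ h]
    rw [mul_comm]
    exact hw
  · rintro ⟨u, w⟩ ⟨hu, hw⟩
    have h := hpos w hw
    have hmem : (u, (euclLength w + ε * w.1)⁻¹ • w.2) ∈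
        Metric.ball x δ ×ˢ Metric.ball (0 : EuclideanSpace ℝ ι) 2 := by
      refine ⟨Metric.ball_subset_ball (min_le_left _ _) hu, ?_⟩
      rw [mem_ball_zero_iff, norm_smul, norm_inv, Real.norm_of_nonneg h.le, inv_mul_lt_iff₀ h]
      rw [mul_comm]
      exact hw
    simp only [hsq _ hmem]
    -- The factor that takes `w` to the stereographic representative of its ray.
    rw [← hhom u (hball (Metric.ball_subset_ball (min_le_right _ _) hu)) w
      (2 * (euclLength w + ε * w.1)⁻¹) (by positivity)]
    congr 2
    refine Prod.ext ?_ ?_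
    · simp only [norm_smul, norm_inv, Real.norm_of_nonneg h.le, Prod.smul_fst, smul_eq_mul]
      have h1 := euclLength_sq w
      have h2 : ‖w.2‖ ^ 2 = euclLength w ^ 2 - w.1 ^ 2 := by linarith
      rw [mul_pow, h2]
      field_simp
      linear_combination (2 * euclLength w * w.1 + w.1 ^ 2 * ε) * hε
    · simp [smul_smul]

/-- The two caps cover the complement of the origin. With the slope `w.1 / ‖w.2‖` as a coordinate,
their overlap becomes a convex set times a punctured space of dimension at least three, where
logarithms exist and the two lifts can be glued. -/
theorem IsPrincipalCircleBundle.exists_hasLift_euclidean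
    (hp : IsPrincipalCircleBundle 𝓘(ℝ, X) 𝓘(ℝ, V') p) {q : T × (ℝ × EuclideanSpace ℝ ι) → B}
    (hι : 3 ≤ Fintype.card ι) {D : Set T} (hD : IsOpen D)
    (hq : ContMDiffOn 𝓘(ℝ, T × (ℝ × EuclideanSpace ℝ ι)) 𝓘(ℝ, V') ∞ q (D ×ˢ {0}ᶜ))
    (hhom : ∀ u ∈ D, ∀ w, ∀ r : ℝ, 0 < r → q (u, r • w) = q (u, w))
    {x : T} (hx : x ∈ D) :
    ∃ δ > 0, HasLift X p q (Metric.ball x δ ×ˢ {0}ᶜ) := by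
  obtain ⟨δ₁, hδ₁, h₁⟩ := hp.exists_hasLift_stereoCap (X := X) hD hq hhom hx (one_mul (1 : ℝ))
  obtain ⟨δ₂, hδ₂, h₂⟩ := hp.exists_hasLift_stereoCap (X := X) hD hq hhom hx
    (ε := -1) (by norm_num)
  refine ⟨min δ₁ δ₂, lt_min hδ₁ hδ₂, ?_⟩
  have h₁' := h₁.mono (prod_mono_left (Metric.ball_subset_ball (min_le_left δ₁ δ₂)))
  have h₂' := h₂.mono (prod_mono_left (Metric.ball_subset_ball (min_le_right δ₁ δ₂)))
  rw [← stereoCap_union, prod_union]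
  refine h₁'.union hp h₂' (Metric.isOpen_ball.prod (isOpen_stereoCap _))
    (Metric.isOpen_ball.prod (isOpen_stereoCap _)) ?_
  rw [← prod_inter]
  have hconv : Convex ℝ (Metric.ball x (min δ₁ δ₂) ×ˢ Ioo (-(3 / 4) : ℝ) (3 / 4)) :=
    (convex_ball _ _).prod (convex_Ioo _ _)
  refine (hasLog_prod_compl_zero (Z := EuclideanSpace ℝ ι) (by simpa using hι) hconv
    (Metric.isOpen_ball.prod isOpen_Ioo)).congr_homeomorph
    (fun y => ((y.1, y.2.1 / ‖y.2.2‖), y.2.2)) (fun y => (y.1.1, (y.1.2 * ‖y.2‖, y.2)))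
    ?_ (by fun_prop) ?_ ?_ ?_
  · refine ContinuousOn.prodMk (continuousOn_fst.prodMk (ContinuousOn.div (by fun_prop)
      (by fun_prop) fun y hy => ?_)) (by fun_prop)
    exact norm_ne_zero_iff.2 ((mem_stereoCap_inter y.2).1 hy.2).1
  · rintro ⟨u, w⟩ ⟨hu, hw⟩
    obtain ⟨h1, h2⟩ := (mem_stereoCap_inter w).1 hw
    have h3 := norm_pos_iff.2 h1
    refine ⟨⟨hu, ?_⟩, h1⟩
    rw [mem_Ioo, ← abs_lt, abs_div, abs_norm, div_lt_iff₀ h3]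
    exact h2
  · rintro ⟨⟨u, a⟩, v⟩ ⟨⟨hu, ha⟩, hv⟩
    have h3 : 0 < ‖v‖ := norm_pos_iff.2 hv
    refine ⟨hu, (mem_stereoCap_inter _).2 ⟨hv, ?_⟩⟩
    simp only [abs_mul, abs_norm]
    gcongr
    exact abs_lt.2 ha
  · rintro ⟨u, w⟩ ⟨hu, hw⟩
    have h3 := norm_ne_zero_iff.2 ((mem_stereoCap_inter w).1 hw).1
    simp [h3]

/-- A smooth map from `D × (Z ∖ 0)`, invariant under positive homotheties of `Z`, lifts
over a smaller set of the same type. -/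
theorem IsPrincipalCircleBundle.exists_hasLift
    (hp : IsPrincipalCircleBundle 𝓘(ℝ, X) 𝓘(ℝ, V') p) {Z : Type*} [NormedAddCommGroup Z]
    [NormedSpace ℝ Z] [FiniteDimensional ℝ Z] (hZ : 4 ≤ Module.finrank ℝ Z)
    {q : T × Z → B} {D : Set T} (hD : IsOpen D)
    (hq : ContMDiffOn 𝓘(ℝ, T × Z) 𝓘(ℝ, V') ∞ q (D ×ˢ {0}ᶜ))
    (hhom : ∀ u ∈ D, ∀ w, ∀ r : ℝ, 0 < r → q (u, r • w) = q (u, w))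
    {x : T} (hx : x ∈ D) :
    ∃ δ > 0, HasLift X p q (Metric.ball x δ ×ˢ {0}ᶜ) := by
  obtain ⟨d, hd⟩ := Nat.exists_eq_add_of_le hZ
  -- After splitting off one real coordinate, at least three dimensions remain, as required for the
  -- overlap of the caps.
  let A : Z ≃L[ℝ] ℝ × EuclideanSpace ℝ (Fin (d + 3)) :=
    .ofFinrankEq (by simp [hd]; ring)
  obtain ⟨δ, hδ, s, hs, hsq⟩ := hp.exists_hasLift_euclidean (X := X)
    (q := fun y : T × (ℝ × EuclideanSpace ℝ (Fin (d + 3))) => q (y.1, A.symm y.2))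
    (by simp) hD (hq.comp
      (contDiff_fst.prodMk (A.symm.contDiff.comp contDiff_snd)).contMDiff.contMDiffOn
      fun y hy => ⟨hy.1, by simpa using hy.2⟩)
    (fun u hu w r hr => by simp only [map_smul]; exact hhom u hu _ r hr) hx
  refine ⟨δ, hδ, fun y => s (y.1, A y.2), hs.comp
    (contDiff_fst.prodMk (A.contDiff.comp contDiff_snd)).contMDiff.contMDiffOn ?_, ?_⟩
  · exact fun y hy => ⟨hy.1, by simpa using hy.2⟩
  · intro y hy
    simp [hsq (y.1, A y.2) ⟨hy.1, by simpa using hy.2⟩]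

end Caps

/-! ### Making a lift equivariant by averaging over the circle. -/

section Equivariance

/-- The integral is the value at `0` of the convolution of the indicator of `(0, b]` with `t ↦ γ x
(-t)`, so smoothness of convolutions with parameters applies once a bump function has made the
second factor compactly supported. -/
theorem contDiffOn_intervalIntegral {P : Type*} [NormedAddCommGroup P] [NormedSpace ℝ P]
    {S : Set P} (hS : IsOpen S) {γ : P → ℝ → ℝ}
    (h : ContDiffOn ℝ ∞ (fun y : P × ℝ => γ y.1 y.2) (S ×ˢ univ)) {b : ℝ} (hb : 0 < b) :
    ContDiffOn ℝ ∞ (fun x => ∫ t in (0)..b, γ x t) S := by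
  -- This bump is `1` on `[-3b/2, b/2]`, which contains all `-t` with `0 < t ≤ b`.
  let χ : ContDiffBump (-(b / 2)) := ⟨b, b + 1, hb, by linarith⟩
  have hf : MeasureTheory.LocallyIntegrable (indicator (Ioc 0 b) fun _ : ℝ => (1 : ℝ)) := by
    refine (MeasureTheory.IntegrableOn.integrable_indicator ?_ measurableSet_Ioc).locallyIntegrable
    exact MeasureTheory.integrableOn_const (by simp)
  have key := MeasureTheory.contDiffOn_convolution_right_with_param_comp (n := ⊤)
    (ContinuousLinearMap.mul ℝ ℝ) (v := fun _ : P => (0 : ℝ)) contDiffOn_const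
    (g := fun x t => χ t * γ x (-t)) hS (isCompact_closedBall (-(b / 2)) (b + 1))
    (fun x t _ ht => by
      rw [χ.zero_of_le_dist (by simpa using (not_le.1 ht).le), zero_mul]) hf
    (ContDiffOn.mul (χ.contDiff.comp contDiff_snd).contDiffOn
      (h.comp (contDiff_fst.prodMk contDiff_snd.neg).contDiffOn fun y hy => ⟨hy.1, trivial⟩))
  refine key.congr fun x _ => ?_
  rw [MeasureTheory.convolution, intervalIntegral.integral_of_le hb.le,
    ← MeasureTheory.integral_indicator measurableSet_Ioc]
  refine MeasureTheory.integral_congr_ae (.of_forall fun t => ?_)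
  by_cases ht : t ∈ Ioc 0 b
  · have hχ : χ (-t) = 1 := χ.one_of_mem_closedBall (by
      rw [Metric.mem_closedBall, Real.dist_eq, abs_le]
      constructor <;> linarith [ht.1, ht.2])
    simp [ht, hχ]
  · simp [ht]

variable {X V' B M T : Type*} [NormedAddCommGroup X] [NormedSpace ℝ X] [TopologicalSpace M]
  [ChartedSpace X M] [NormedAddCommGroup V'] [NormedSpace ℝ V'] [TopologicalSpace B]
  [ChartedSpace V' B] [MulAction Circle M] {p : M → B}
  [NormedAddCommGroup T] [NormedSpace ℝ T]
  {Z : Type*} [NormedAddCommGroup Z] [NormedSpace ℂ Z]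

theorem one_lt_rank_of_three_le_finrank (hZ : 3 ≤ Module.finrank ℝ Z) :
    1 < Module.rank ℝ Z := by
  have : FiniteDimensional ℝ Z := .of_finrank_pos (by lia)
  rw [← Module.finrank_eq_rank]
  exact_mod_cast (by lia : 1 < Module.finrank ℝ Z)

theorem isPreconnected_prod_compl_zero (hZ : 3 ≤ Module.finrank ℝ Z) {K : Set T}
    (hK : Convex ℝ K) : IsPreconnected (K ×ˢ ({0}ᶜ : Set Z)) :=
  hK.isPreconnected.prod
    (isConnected_compl_singleton_of_one_lt_rank
      (one_lt_rank_of_three_le_finrank hZ) 0).isPreconnected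

theorem contDiff_circle_exp_smul :
    ContDiff ℝ ∞ fun y : ℝ × Z => (Circle.exp y.1 : ℂ) • y.2 := by
  have : ContDiff ℝ ∞ fun t : ℝ => (Circle.exp t : ℂ) := by
    rw [← contMDiff_iff_contDiff]
    exact Circle.contMDiff_coe.comp contMDiff_circleExp
  exact (this.comp contDiff_fst).smul contDiff_snd

/-- The logarithm of the cocycle by which a lift fails to be invariant. -/
theorem IsPrincipalCircleBundle.exists_cocycle
    (hp : IsPrincipalCircleBundle 𝓘(ℝ, X) 𝓘(ℝ, V') p) (hZ : 3 ≤ Module.finrank ℝ Z)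
    {q : T × Z → B} {K : Set T} (hK : Convex ℝ K) (ho : IsOpen K)
    (hinv : ∀ u ∈ K, ∀ w ≠ 0, ∀ a : Circle, q (u, (a : ℂ) • w) = q (u, w)) {s : T × Z → M}
    (hs : ContMDiffOn 𝓘(ℝ, T × Z) 𝓘(ℝ, X) ∞ s (K ×ˢ {0}ᶜ))
    (hsq : ∀ x ∈ K ×ˢ {0}ᶜ, p (s x) = q x) :
    ∃ γ : T × Z → ℝ → ℝ,
      ContDiffOn ℝ ∞ (fun y : (T × Z) × ℝ => γ y.1 y.2) ((K ×ˢ {0}ᶜ) ×ˢ univ) ∧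
      (∀ x ∈ K ×ˢ {0}ᶜ, γ x 0 = 0) ∧
      ∀ x ∈ K ×ˢ {0}ᶜ, ∀ t, s (x.1, (Circle.exp t : ℂ) • x.2) = Circle.exp (γ x t) • s x := by
  have : FiniteDimensional ℝ Z := .of_finrank_pos (by lia)
  have hmem : ∀ x ∈ K ×ˢ ({0}ᶜ : Set Z), ∀ a : Circle, (x.1, (a : ℂ) • x.2) ∈
      K ×ˢ ({0}ᶜ : Set Z) := fun x hx a =>
    ⟨hx.1, by simpa using hx.2⟩
  -- The angle is treated as one more convex parameter, so that a single logarithm works for all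
  -- angles.
  let S : Set ((ℝ × T) × Z) := (univ ×ˢ K) ×ˢ {0}ᶜ
  have hS : IsOpen S := (isOpen_univ.prod ho).prod isOpen_compl_singleton
  have h₁ : ContMDiffOn 𝓘(ℝ, (ℝ × T) × Z) 𝓘(ℝ, X) ∞ (fun y => s (y.1.2, y.2)) S :=
    hs.comp (contDiff_fst.snd.prodMk contDiff_snd).contMDiff.contMDiffOn
      fun y hy => ⟨hy.1.2, hy.2⟩
  have h₂ : ContMDiffOn 𝓘(ℝ, (ℝ × T) × Z) 𝓘(ℝ, X) ∞
      (fun y => s (y.1.2, (Circle.exp y.1.1 : ℂ) • y.2)) S :=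
    hs.comp (contDiff_fst.snd.prodMk (contDiff_circle_exp_smul.comp
      (contDiff_fst.fst.prodMk contDiff_snd))).contMDiff.contMDiffOn
      fun y hy => hmem (y.1.2, y.2) ⟨hy.1.2, hy.2⟩ _
  obtain ⟨g, hg, hgs⟩ := hp.exists_contMDiffOn_smul_eq h₁ h₂ fun y hy => by
    rw [hsq (y.1.2, y.2) ⟨hy.1.2, hy.2⟩, hsq _ (hmem (y.1.2, y.2) ⟨hy.1.2, hy.2⟩ _)]
    exact (hinv _ hy.1.2 _ hy.2 _).symm
  obtain ⟨f, hf, hfg⟩ := (hasLog_prod_compl_zero hZ (convex_univ.prod hK)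
    (isOpen_univ.prod ho)).exists_contDiffOn hS hg
  -- Subtracting the value at angle `0` normalizes the logarithm; nothing changes after
  -- exponentiation, since `g = 1` there.
  refine ⟨fun x t => f ((t, x.1), x.2) - f ((0, x.1), x.2), ?_, fun x _ => sub_self _, ?_⟩
  · refine ContDiffOn.sub (hf.comp ?_ ?_) (hf.comp ?_ ?_)
    · exact ((contDiff_snd.prodMk contDiff_fst.fst).prodMk contDiff_fst.snd).contDiffOn
    · exact fun y hy => ⟨⟨trivial, hy.1.1⟩, hy.1.2⟩
    · exact ((contDiff_const.prodMk contDiff_fst.fst).prodMk contDiff_fst.snd).contDiffOn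
    · exact fun y hy => ⟨⟨trivial, hy.1.1⟩, hy.1.2⟩
  · intro x hx t
    have hg0 : g ((0, x.1), x.2) = 1 := by
      refine hp.smul_left_cancel_of_eq (m := s x) ?_
      have := hgs ((0, x.1), x.2) ⟨⟨trivial, hx.1⟩, hx.2⟩
      simp only [Circle.exp_zero, Circle.coe_one, one_smul] at this ⊢
      exact this.symm
    rw [Circle.exp_sub, hfg _ ⟨⟨trivial, hx.1⟩, hx.2⟩, hfg _ ⟨⟨trivial, hx.1⟩, hx.2⟩, hg0, div_one]
    exact hgs ((t, x.1), x.2) ⟨⟨trivial, hx.1⟩, hx.2⟩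

/-- A lift over `K × (Z ∖ 0)` of a circle-invariant map can be made equivariant. -/
theorem IsPrincipalCircleBundle.exists_equivariant_lift
    (hp : IsPrincipalCircleBundle 𝓘(ℝ, X) 𝓘(ℝ, V') p) (hZ : 3 ≤ Module.finrank ℝ Z)
    {q : T × Z → B} {K : Set T} (hK : Convex ℝ K) (ho : IsOpen K)
    (hinv : ∀ u ∈ K, ∀ w ≠ 0, ∀ a : Circle, q (u, (a : ℂ) • w) = q (u, w))
    (hlift : HasLift X p q (K ×ˢ {0}ᶜ)) :
    ∃ (k : ℤ) (Φ : T × Z → M), ContMDiffOn 𝓘(ℝ, T × Z) 𝓘(ℝ, X) ∞ Φ (K ×ˢ {0}ᶜ) ∧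
      (∀ x ∈ K ×ˢ {0}ᶜ, p (Φ x) = q x) ∧
      ∀ u ∈ K, ∀ w ≠ 0, ∀ a : Circle, Φ (u, (a : ℂ) • w) = a ^ k • Φ (u, w) := by
  obtain ⟨s, hs, hsq⟩ := hlift
  obtain ⟨γ, hγ, hγ0, hγs⟩ := hp.exists_cocycle hZ hK ho hinv hs hsq
  have hmem : ∀ x ∈ K ×ˢ ({0}ᶜ : Set Z), ∀ a : Circle, (x.1, (a : ℂ) • x.2) ∈
      K ×ˢ ({0}ᶜ : Set Z) := fun x hx a =>
    ⟨hx.1, by simpa using hx.2⟩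
  have hc : ∀ x ∈ K ×ˢ ({0}ᶜ : Set Z), Continuous (γ x) := fun x hx =>
    continuousOn_univ.1 (hγ.continuousOn.comp
      (by fun_prop : ContinuousOn (fun t : ℝ => (x, t)) univ)
      fun t _ => ⟨hx, trivial⟩)
  -- The cocycle identity holds modulo `2π` by freeness of the action. It holds exactly because both
  -- sides are continuous in `τ` and agree at `τ = 0`.
  have hcoc : ∀ x ∈ K ×ˢ ({0}ᶜ : Set Z), ∀ t τ,
      γ x (τ + t) = γ (x.1, (Circle.exp t : ℂ) • x.2) τ + γ x t := by
    intro x hx t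
    obtain ⟨n, hn⟩ := isPreconnected_univ.circle_log_unique
      (f₁ := fun τ => γ x (τ + t)) (f₂ := fun τ => γ (x.1, (Circle.exp t : ℂ) • x.2) τ + γ x t)
      ((hc x hx).comp (by fun_prop)).continuousOn
      ((hc _ (hmem x hx _)).add continuous_const).continuousOn fun τ _ => by
        refine hp.smul_left_cancel_of_eq (m := s x) ?_
        rw [← hγs x hx, Circle.exp_add (γ _ τ), mul_smul, ← hγs x hx, ← hγs _ (hmem x hx _),
          Circle.exp_add, Circle.coe_mul, mul_smul]
    have h0 := hn 0 trivial
    simp only [zero_add, hγ0 _ (hmem x hx _)] at h0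
    intro τ
    rw [hn τ trivial]
    linarith
  have hγ2 : ContinuousOn (fun x => γ x (2 * Real.pi)) (K ×ˢ {0}ᶜ) :=
    hγ.continuousOn.comp (f := fun x => (x, 2 * Real.pi)) (s := K ×ˢ {0}ᶜ) (by fun_prop)
      fun x hx => ⟨hx, trivial⟩
  -- A full turn returns to the same point, so `γ x (2π)` is a multiple of `2π`, and the multiple is
  -- constant by connectedness. It is the weight.
  obtain ⟨k, hk⟩ := (isPreconnected_prod_compl_zero hZ hK).circle_log_unique
    (f₁ := fun x => γ x (2 * Real.pi)) (f₂ := fun _ => 0)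
    hγ2 continuousOn_const fun x hx => by
      refine hp.smul_left_cancel_of_eq (m := s x) ?_
      rw [← hγs x hx]
      simp
  simp only [zero_add] at hk
  -- Without its linear part the cocycle is periodic, and its mean `H` satisfies `H (exp(it) x) = H
  -- x - δ x t`. Hence `exp(H) • s` changes by the linear part only.
  let δ : T × Z → ℝ → ℝ := fun x t => γ x t - k * t
  have hδ : ContDiffOn ℝ ∞ (fun y : (T × Z) × ℝ => δ y.1 y.2) ((K ×ˢ {0}ᶜ) ×ˢ univ) :=
    hγ.sub (contDiff_const.mul contDiff_snd).contDiffOn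
  have hδc : ∀ x ∈ K ×ˢ ({0}ᶜ : Set Z), Continuous (δ x) := fun x hx =>
    (hc x hx).sub (by fun_prop)
  have hδcoc : ∀ x ∈ K ×ˢ ({0}ᶜ : Set Z), ∀ t τ,
      δ (x.1, (Circle.exp t : ℂ) • x.2) τ = δ x (τ + t) - δ x t := fun x hx t τ => by
    simp only [δ, hcoc x hx]
    ring
  have hper : ∀ x ∈ K ×ˢ ({0}ᶜ : Set Z), Function.Periodic (δ x) (2 * Real.pi) := by
    intro x hx τ
    simp only [δ, hcoc x hx, hk x hx, Circle.exp_two_pi, Circle.coe_one, one_smul]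
    ring
  let H : T × Z → ℝ := fun x => (2 * Real.pi)⁻¹ * ∫ t in (0)..(2 * Real.pi), δ x t
  have hH : ContDiffOn ℝ ∞ H (K ×ˢ {0}ᶜ) :=
    contDiffOn_const.mul (contDiffOn_intervalIntegral (ho.prod isOpen_compl_singleton) hδ
      (by positivity))
  have hHt : ∀ x ∈ K ×ˢ ({0}ᶜ : Set Z), ∀ t,
      H (x.1, (Circle.exp t : ℂ) • x.2) = H x - δ x t := by
    intro x hx t
    simp only [H, hδcoc x hx]
    have hinteg : Continuous fun τ => δ x (τ + t) := (hδc x hx).comp (by fun_prop)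
    rw [intervalIntegral.integral_sub (hinteg.intervalIntegrable _ _)
      intervalIntegrable_const, intervalIntegral.integral_comp_add_right (δ x), zero_add,
      add_comm (2 * Real.pi) t, (hper x hx).intervalIntegral_add_eq t 0,
      intervalIntegral.integral_const]
    simp only [zero_add, sub_zero, smul_eq_mul]
    have := Real.pi_pos
    field_simp
  refine ⟨k, fun x => Circle.exp (H x) • s x, hp.contMDiffOn_smul
    (contMDiff_circleExp.comp_contMDiffOn hH.contMDiffOn) hs, fun x hx => ?_, ?_⟩
  · rw [hp.invariant, hsq x hx]
  · intro u hu w hw a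
    obtain ⟨t, rfl⟩ := Circle.exp_surjective a
    have hx : (u, w) ∈ K ×ˢ ({0}ᶜ : Set Z) := ⟨hu, hw⟩
    have h1 := hHt (u, w) hx t
    have h2 := hγs (u, w) hx t
    simp only at h1 h2 ⊢
    rw [h1, h2, smul_smul, smul_smul, ← Circle.exp_add, ← Circle.exp_zsmul, ← Circle.exp_add]
    simp only [δ, zsmul_eq_mul]
    ring_nf

end Equivariance

/-! ### From holomorphic to real smooth maps. -/

section RestrictScalars

variable {E₁ M₁ E₂ M₂ : Type*} [NormedAddCommGroup E₁] [NormedSpace ℂ E₁] [NormedSpace ℝ E₁]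
  [IsScalarTower ℝ ℂ E₁] [TopologicalSpace M₁]
  [ChartedSpace E₁ M₁] [NormedAddCommGroup E₂] [NormedSpace ℂ E₂] [NormedSpace ℝ E₂]
  [IsScalarTower ℝ ℂ E₂] [TopologicalSpace M₂] [ChartedSpace E₂ M₂]

theorem ContMDiffWithinAt.real_of_complex {f : M₁ → M₂} {x : M₁} {s : Set M₁}
    {k : WithTop ℕ∞} (h : ContMDiffWithinAt 𝓘(ℂ, E₁) 𝓘(ℂ, E₂) k f s x) :
    ContMDiffWithinAt 𝓘(ℝ, E₁) 𝓘(ℝ, E₂) k f s x := by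
  rw [contMDiffWithinAt_iff] at h ⊢
  refine ⟨h.1, ?_⟩
  simpa [mfld_simps] using h.2.restrict_scalars ℝ

theorem ContMDiffOn.real_of_complex {f : M₁ → M₂} {s : Set M₁}
    {k : WithTop ℕ∞} (h : ContMDiffOn 𝓘(ℂ, E₁) 𝓘(ℂ, E₂) k f s) :
    ContMDiffOn 𝓘(ℝ, E₁) 𝓘(ℝ, E₂) k f s := fun x hx => (h x hx).real_of_complex

theorem HasMFDerivAt.real_of_complex {f : M₁ → M₂} {x : M₁} {D : E₁ →L[ℂ] E₂}
    (h : HasMFDerivAt 𝓘(ℂ, E₁) 𝓘(ℂ, E₂) f x D) :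
    HasMFDerivAt 𝓘(ℝ, E₁) 𝓘(ℝ, E₂) f x (D.restrictScalars ℝ : E₁ →L[ℝ] E₂) := by
  refine ⟨h.1, ?_⟩
  have := HasFDerivWithinAt.restrictScalars ℝ (E := E₁) (F := E₂) h.2
  simp only [mfld_simps, hasFDerivWithinAt_univ] at this ⊢
  exact this.hasFDerivWithinAt

end RestrictScalars

/-! ### Homogeneous coordinates on `ℙ(E)`. -/

namespace ProjBundle

variable {n : ℕ} {V B F : Type*} {E : B → Type*}
  [∀ x, AddCommGroup (E x)] [∀ x, Module ℂ (E x)] [TopologicalSpace (TotalSpace F E)]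
  [NormedAddCommGroup V] [TopologicalSpace B] [NormedAddCommGroup F]
  [NormedSpace ℂ F] [∀ x, TopologicalSpace (E x)] [FiberBundle F E] [VectorBundle ℂ F E]

open Classical in
/-- Local homogeneous coordinates: the point of `ℙ(E)` over `c.symm u` whose line is spanned by
the vector with coordinates `w ≠ 0` in the trivialization `e` (and the vector `w₁` serves as a
default value for `w = 0`). -/
noncomputable def homCoord (c : OpenPartialHomeomorph B V) (e : Trivialization F (π F E))
    [MemTrivializationAtlas e] (w₁ : {w : F // w ≠ 0}) (y : V × F) : ProjBundle F E :=
  ⟨c.symm y.1, .mk ℂ ((fiberEquiv e (c.symm y.1)).symm (if y.2 = 0 then w₁ else y.2)) (by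
    simp only [ne_eq, EmbeddingLike.map_eq_zero_iff]
    split_ifs with h
    · exact w₁.2
    · exact h)⟩

variable (c : OpenPartialHomeomorph B V) (e : Trivialization F (π F E))
  [MemTrivializationAtlas e] (w₁ : {w : F // w ≠ 0})

theorem homCoord_apply (u : V) {w : F} (hw : w ≠ 0) : homCoord c e w₁ (u, w) =
    ⟨c.symm u, .mk ℂ ((fiberEquiv e (c.symm u)).symm w) (by simpa using hw)⟩ := by
  simp [homCoord, hw]

theorem homCoord_chart {x : B} (hx : x ∈ c.source) {w : F} (hw : w ≠ 0) :
    homCoord c e w₁ (c x, w) =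
      ⟨x, .mk ℂ ((fiberEquiv e x).symm w) (by simpa using hw)⟩ := by
  rw [homCoord_apply _ _ _ _ hw]
  have key : ∀ y (_ : y = x) (hy : (fiberEquiv e y).symm w ≠ 0),
      (⟨y, .mk ℂ ((fiberEquiv e y).symm w) hy⟩ : ProjBundle F E) =
        ⟨x, .mk ℂ ((fiberEquiv e x).symm w) (by simpa using hw)⟩ := by
    rintro y rfl hy
    rfl
  exact key _ (c.left_inv hx) _

theorem homCoord_smul (u : V) (w : F) {a : ℂ} (ha : a ≠ 0) :
    homCoord c e w₁ (u, a • w) = homCoord c e w₁ (u, w) := by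
  by_cases hw : w = 0
  · simp [homCoord, hw]
  · rw [homCoord_apply _ _ _ _ hw, homCoord_apply _ _ _ _ (smul_ne_zero ha hw)]
    congr 1
    rw [Projectivization.mk_eq_mk_iff']
    exact ⟨a, by simp⟩

theorem homCoord_eq_iff (u : V) {w w' : F} (hw : w ≠ 0) (hw' : w' ≠ 0) :
    homCoord c e w₁ (u, w) = homCoord c e w₁ (u, w') ↔ ∃ a : ℂ, a • w' = w := by
  rw [homCoord_apply _ _ _ _ hw, homCoord_apply _ _ _ _ hw', ProjBundle.mk.injEq]
  simp only [heq_eq_eq, true_and]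
  rw [Projectivization.mk_eq_mk_iff']
  simp only [← map_smul, EmbeddingLike.apply_eq_iff_eq]

theorem homCoord_eq_chart_symm (A : F ≃L[ℂ] ℂ × EuclideanSpace ℂ (Fin n)) (u : V) {w : F}
    (hw : (A w).1 ≠ 0) :
    homCoord c e w₁ (u, w) = (chart c e A).symm (u, (A w).1⁻¹ • (A w).2) := by
  have hw0 : w ≠ 0 := by
    rintro rfl
    simp at hw
  rw [homCoord_apply _ _ _ _ hw0]
  change _ = chartInv c e A _
  simp only [chartInv]
  congr 1
  rw [Projectivization.mk_eq_mk_iff']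
  refine ⟨(A w).1, ?_⟩
  rw [← map_smul, ← map_smul]
  congr 1
  rw [A.symm_apply_eq]
  ext1
  · simp
  · simp [smul_smul, hw]

variable [NormedSpace ℂ V] [Fact (Module.finrank ℂ F = n + 1)] [ChartedSpace V B]
  [IsManifold 𝓘(ℂ, V) ω B] [ContMDiffVectorBundle ω F E 𝓘(ℂ, V)]

/-- Near a given `w` some affine coordinate is not zero, and there homogeneous coordinates are an
affine quotient followed by the inverse of a chart. -/
theorem contMDiffOn_homCoord (hc : c ∈ atlas V B) :
    ContMDiffOn 𝓘(ℂ, V × F) 𝓘(ℂ, V × EuclideanSpace ℂ (Fin n)) ω (homCoord c e w₁)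
      ((c.target ∩ c.symm ⁻¹' e.baseSet) ×ˢ {0}ᶜ) := by
  rintro ⟨u, w⟩ ⟨hu, hw⟩
  obtain ⟨A, hA⟩ := exists_affine (n := n) (w := w) hw
  have hchart : chart c e A ∈ atlas (V × EuclideanSpace ℂ (Fin n)) (ProjBundle F E) :=
    ⟨c, hc, e, inferInstance, A, rfl⟩
  have hsymm := contMDiffOn_symm_of_mem_maximalAtlas
    (IsManifold.subset_maximalAtlas (I := 𝓘(ℂ, V × EuclideanSpace ℂ (Fin n))) (n := ω) hchart)
  refine ContMDiffAt.contMDiffWithinAt ?_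
  have hsm : ContDiffAt ℂ ω (fun y : V × F => (y.1, (A y.2).1⁻¹ • (A y.2).2)) (u, w) := by
    have hA2 : ContDiff ℂ ω (fun y : V × F => A y.2) := A.contDiff.comp contDiff_snd
    exact contDiffAt_fst.prodMk ((hA2.fst.contDiffAt.inv hA).smul hA2.snd.contDiffAt)
  have htarget : (u, (A w).1⁻¹ • (A w).2) ∈ (chart c e A).target := ⟨hu, trivial⟩
  have := (hsymm.contMDiffAt ((chart c e A).open_target.mem_nhds htarget)).comp (u, w)
    hsm.contMDiffAt
  refine this.congr_of_eventuallyEq ?_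
  have hopen : ∀ᶠ y : V × F in 𝓝 (u, w), (A y.2).1 ≠ 0 :=
    (isOpen_ne.preimage (by fun_prop : Continuous fun y : V × F => (A y.2).1)).mem_nhds hA
  filter_upwards [hopen] with y hy
  exact homCoord_eq_chart_symm c e w₁ A y.1 hy

theorem contMDiff_proj : ContMDiff 𝓘(ℂ, V × EuclideanSpace ℂ (Fin n)) 𝓘(ℂ, V) ω
    (proj : ProjBundle F E → B) := by
  intro x
  obtain ⟨A, hA⟩ := exists_chart (n := n) (V := V) x
  have hchart : chart (chartAt V x.proj) (trivializationAt F E x.proj) A ∈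
      atlas (V × EuclideanSpace ℂ (Fin n)) (ProjBundle F E) :=
    ⟨_, chart_mem_atlas V x.proj, _, inferInstance, A, rfl⟩
  have h1 := contMDiffAt_of_mem_maximalAtlas (IsManifold.subset_maximalAtlas
    (I := 𝓘(ℂ, V × EuclideanSpace ℂ (Fin n))) (n := ω) hchart) hA
  have h2 : ContMDiffAt 𝓘(ℂ, V) 𝓘(ℂ, V) ω (chartAt V x.proj).symm (chartAt V x.proj x.proj) :=
    contMDiffAt_symm_of_mem_maximalAtlas (IsManifold.chart_mem_maximalAtlas _)
      (mem_chart_target V x.proj)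
  have h3 : ContMDiffAt 𝓘(ℂ, V × EuclideanSpace ℂ (Fin n)) 𝓘(ℂ, V) ω
      (Prod.fst : V × EuclideanSpace ℂ (Fin n) → V)
      (chart (chartAt V x.proj) (trivializationAt F E x.proj) A x) :=
    contDiffAt_fst.contMDiffAt
  have h4 := ContMDiffAt.comp (chart (chartAt V x.proj) (trivializationAt F E x.proj) A x)
    (g := (chartAt V x.proj).symm) (f := Prod.fst) h2 h3
  refine (ContMDiffAt.comp x h4 h1).congr_of_eventuallyEq ?_
  filter_upwards [(chart (chartAt V x.proj) (trivializationAt F E x.proj) A).open_source.mem_nhds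
    hA] with y hy
  exact ((chartAt V x.proj).left_inv hy.1.1).symm

/-- Local homogeneous coordinates can be chosen smoothly. -/
theorem exists_homCoord_section (hc : c ∈ atlas V B) (x : ProjBundle F E)
    (hx : x.proj ∈ c.source ∩ e.baseSet) :
    ∃ (O : Set (ProjBundle F E)) (ζ : ProjBundle F E → F), IsOpen O ∧ x ∈ O ∧
      ContMDiffOn 𝓘(ℂ, V × EuclideanSpace ℂ (Fin n)) 𝓘(ℂ, F) ω ζ O ∧
      ∀ y ∈ O, y.proj ∈ c.source ∩ e.baseSet ∧ ζ y ≠ 0 ∧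
        homCoord c e w₁ (c y.proj, ζ y) = y := by
  obtain ⟨A, hA⟩ := exists_affine (n := n) (x.line.map (fiberEquiv e x.proj).toLinearMap
    (fiberEquiv e x.proj).injective).rep_nonzero
  have hxs : x ∈ (chart c e A).source := ⟨hx, hA⟩
  have hchart : chart c e A ∈ atlas (V × EuclideanSpace ℂ (Fin n)) (ProjBundle F E) :=
    ⟨c, hc, e, inferInstance, A, rfl⟩
  refine ⟨(chart c e A).source, fun y => A.symm (1, (chart c e A y).2), (chart c e A).open_source,
    hxs, ?_, fun y hy => ⟨hy.1, symm_one_ne_zero A _, ?_⟩⟩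
  · have h1 := contMDiffOn_of_mem_maximalAtlas (IsManifold.subset_maximalAtlas
      (I := 𝓘(ℂ, V × EuclideanSpace ℂ (Fin n))) (n := ω) hchart)
    have h2 : ContDiff ℂ ω (fun y : V × EuclideanSpace ℂ (Fin n) => A.symm (1, y.2)) :=
      A.symm.contDiff.comp (contDiff_const.prodMk contDiff_snd)
    exact h2.contMDiff.comp_contMDiffOn h1
  · rw [homCoord_eq_chart_symm c e w₁ A _ (by simp)]
    simp only [ContinuousLinearEquiv.apply_symm_apply, inv_one, one_smul]
    exact (chart c e A).left_inv hy

end ProjBundle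

/-! ### Pullback of forms to a vector space. -/

section PullbackForm

variable {X M T : Type*} [NormedAddCommGroup X] [NormedSpace ℝ X] [TopologicalSpace M]
  [ChartedSpace X M] [NormedAddCommGroup T] [NormedSpace ℝ T]

/-- Under the isometry between 1-forms and the dual space, the pullback is composition of linear
maps, which is smooth in both factors. -/
theorem ContDiffAt.oneForm_comp {β : T → X [⋀^Fin 1]→L[ℝ] ℝ} {L : T → T →L[ℝ] X} {y : T}
    {k : WithTop ℕ∞} (hβ : ContDiffAt ℝ k β y) (hL : ContDiffAt ℝ k L y) :
    ContDiffAt ℝ k (fun z => (β z).compContinuousLinearMap (L z)) y := by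
  let e := ContinuousAlternatingMap.ofSubsingletonLIE (𝕜 := ℝ) (E := X) (F := ℝ) (0 : Fin 1)
  let e' := ContinuousAlternatingMap.ofSubsingletonLIE (𝕜 := ℝ) (E := T) (F := ℝ) (0 : Fin 1)
  have : (fun z => (β z).compContinuousLinearMap (L z)) =
      fun z => e' ((e.symm (β z)).comp (L z)) := by
    ext z v
    obtain ⟨β₁, hβ₁⟩ := e.surjective (β z)
    rw [← hβ₁, e.symm_apply_apply]
    rfl
  rw [this]
  exact e'.contDiff.contDiffAt.comp y ((e.symm.contDiff.contDiffAt.comp y hβ).clm_comp hL)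

namespace DiffForm

variable {k : ℕ}

theorem apply_congr_point {α : DiffForm X M k} {x x' : M} (h : x = x') (L : T →L[ℝ] X) :
    ContinuousAlternatingMap.compContinuousLinearMap (α x : X [⋀^Fin k]→L[ℝ] ℝ) L =
      ContinuousAlternatingMap.compContinuousLinearMap (α x' : X [⋀^Fin k]→L[ℝ] ℝ) L := by
  subst h; rfl

/-- The pullback of a form to a normed space. -/
noncomputable def pullbackVec (α : DiffForm X M k) (ψ : T → M) : T → T [⋀^Fin k]→L[ℝ] ℝ :=
  fun y => (α.pullback ψ : DiffForm T T k) y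

theorem pullbackVec_apply (α : DiffForm X M k) (ψ : T → M) (y : T) (v : Fin k → T) :
    α.pullbackVec ψ y v = α (ψ y) fun i => mfderiv 𝓘(ℝ, T) 𝓘(ℝ, X) ψ y (v i) := rfl

variable [IsManifold 𝓘(ℝ, X) ∞ M]

/-- Writing `ψ` as the inverse chart after the chart expression of `ψ` reduces statements about the
pullback to maps between vector spaces. -/
theorem pullbackVec_eventuallyEq_inChart (α : DiffForm X M k) {ψ : T → M}
    (hψ : ContMDiff 𝓘(ℝ, T) 𝓘(ℝ, X) ∞ ψ) (y₀ : T) :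
    α.pullbackVec ψ =ᶠ[𝓝 y₀] fun y =>
      (α.inChart (ψ y₀) (chartAt X (ψ y₀) (ψ y))).compContinuousLinearMap
        (fderiv ℝ (fun z => chartAt X (ψ y₀) (ψ z)) y) := by
  have hU : IsOpen (ψ ⁻¹' (chartAt X (ψ y₀)).source) :=
    (chartAt X (ψ y₀)).open_source.preimage hψ.continuous
  filter_upwards [hU.mem_nhds (mem_chart_source X (ψ y₀))] with y hy
  set φ := chartAt X (ψ y₀)
  have hφ : ContMDiffAt 𝓘(ℝ, X) 𝓘(ℝ, X) ∞ φ (ψ y) :=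
    contMDiffAt_of_mem_maximalAtlas (IsManifold.chart_mem_maximalAtlas _) hy
  have hφs : ContMDiffAt 𝓘(ℝ, X) 𝓘(ℝ, X) ∞ φ.symm (φ (ψ y)) :=
    contMDiffAt_symm_of_mem_maximalAtlas (IsManifold.chart_mem_maximalAtlas _) (φ.map_source hy)
  have hcomp : ContMDiffAt 𝓘(ℝ, T) 𝓘(ℝ, X) ∞ (fun z => φ (ψ z)) y := hφ.comp y (hψ y)
  have hev : ψ =ᶠ[𝓝 y] fun z => φ.symm (φ (ψ z)) := by
    filter_upwards [hU.mem_nhds hy] with z hz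
    exact (φ.left_inv hz).symm
  have hd : mfderiv 𝓘(ℝ, T) 𝓘(ℝ, X) ψ y =
      (mfderiv 𝓘(ℝ, X) 𝓘(ℝ, X) φ.symm (φ (ψ y))).comp
        (mfderiv 𝓘(ℝ, T) 𝓘(ℝ, X) (fun z => φ (ψ z)) y) := by
    rw [hev.mfderiv_eq]
    exact mfderiv_comp y (hφs.mdifferentiableAt (by simp)) (hcomp.mdifferentiableAt (by simp))
  have hfd : fderiv ℝ (fun z => φ (ψ z)) y =
      mfderiv 𝓘(ℝ, T) 𝓘(ℝ, X) (fun z => φ (ψ z)) y := mfderiv_eq_fderiv.symm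
  simp only [pullbackVec, pullback, inChart]
  rw [hd, hfd]
  exact apply_congr_point (T := T) (α := α) (φ.left_inv hy).symm _

theorem IsSmooth.contDiff_pullbackVec {α : DiffForm X M 1} (hα : α.IsSmooth) {ψ : T → M}
    (hψ : ContMDiff 𝓘(ℝ, T) 𝓘(ℝ, X) ∞ ψ) :
    ContDiff ℝ ∞ (α.pullbackVec ψ) := by
  rw [contDiff_iff_contDiffAt]
  intro y₀
  refine ContDiffAt.congr_of_eventuallyEq ?_ (pullbackVec_eventuallyEq_inChart α hψ y₀)
  have hφ : ContMDiffAt 𝓘(ℝ, X) 𝓘(ℝ, X) ∞ (chartAt X (ψ y₀)) (ψ y₀) :=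
    contMDiffAt_of_mem_maximalAtlas (IsManifold.chart_mem_maximalAtlas _) (mem_chart_source _ _)
  have hcomp : ContDiffAt ℝ ∞ (fun z => chartAt X (ψ y₀) (ψ z)) y₀ :=
    contMDiffAt_iff_contDiffAt.1 (hφ.comp y₀ (hψ y₀))
  refine ContDiffAt.oneForm_comp ?_ (hcomp.fderiv_right (by simp))
  exact ContDiffAt.comp (g := α.inChart (ψ y₀)) y₀ ((hα (ψ y₀)).contDiffAt
    ((chartAt X (ψ y₀)).open_target.mem_nhds (mem_chart_target _ _))) hcomp

/-- The exterior derivative commutes with the pullback to a vector space. -/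
theorem IsSmooth.extDeriv_pullbackVec {α : DiffForm X M k} (hα : α.IsSmooth) {ψ : T → M}
    (hψ : ContMDiff 𝓘(ℝ, T) 𝓘(ℝ, X) ∞ ψ) (y₀ : T) :
    extDeriv (α.pullbackVec ψ) y₀ =
      α.d.pullbackVec ψ y₀ := by
  rw [(pullbackVec_eventuallyEq_inChart α hψ y₀).extDeriv_eq]
  have hφ : ContMDiffAt 𝓘(ℝ, X) 𝓘(ℝ, X) ∞ (chartAt X (ψ y₀)) (ψ y₀) :=
    contMDiffAt_of_mem_maximalAtlas (IsManifold.chart_mem_maximalAtlas _) (mem_chart_source _ _)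
  have hcomp : ContDiffAt ℝ ∞ (fun z => chartAt X (ψ y₀) (ψ z)) y₀ :=
    contMDiffAt_iff_contDiffAt.1 (hφ.comp y₀ (hψ y₀))
  have hd : fderiv ℝ (fun z => chartAt X (ψ y₀) (ψ z)) y₀ =
      (mfderiv 𝓘(ℝ, X) 𝓘(ℝ, X) (chartAt X (ψ y₀)) (ψ y₀)).comp
        (mfderiv 𝓘(ℝ, T) 𝓘(ℝ, X) ψ y₀) := by
    rw [← mfderiv_eq_fderiv]
    exact mfderiv_comp y₀ (hφ.mdifferentiableAt (by simp)) ((hψ y₀).mdifferentiableAt (by simp))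
  have hω : DifferentiableAt ℝ (α.inChart (ψ y₀)) (chartAt X (ψ y₀) (ψ y₀)) :=
    ((hα (ψ y₀)).contDiffAt ((chartAt X (ψ y₀)).open_target.mem_nhds
      (mem_chart_target _ _))).differentiableAt (by simp)
  refine (_root_.extDeriv_pullback (r := ∞) (f := fun z => chartAt X (ψ y₀) (ψ z)) hω hcomp
    (by simpa using WithTop.coe_le_coe.2 (le_top : (2 : ℕ∞) ≤ ⊤))).trans ?_
  rw [hd]
  rfl

end DiffForm

end PullbackForm

/-! ### Stokes' theorem on a holomorphic disc. -/

section Stokes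

variable {X M V' B : Type*} [NormedAddCommGroup X] [NormedSpace ℝ X] [TopologicalSpace M]
  [ChartedSpace X M] [NormedAddCommGroup V'] [NormedSpace ℂ V'] [NormedSpace ℝ V']
  [IsScalarTower ℝ ℂ V'] [TopologicalSpace B] [ChartedSpace V' B] [MulAction Circle M]
  {p : M → B} {η : DiffForm X M 1} {κ : DiffForm V' B 2}

theorem ContinuousAlternatingMap.map_single_smul {E : Type*} [NormedAddCommGroup E]
    [NormedSpace ℝ E] (f : E [⋀^Fin 1]→L[ℝ] ℝ) (r : ℝ) (v : E) : f ![r • v] = r * f ![v] := by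
  have h : ∀ v : E, Function.update ![v] 0 = fun w => ![w] := fun v => by
    ext w i
    fin_cases i
    rfl
  have := f.map_update_smul ![v] 0 r v
  simp only [h] at this
  exact this

theorem ContinuousAlternatingMap.map_pair_smul {E : Type*} [NormedAddCommGroup E]
    [NormedSpace ℝ E] (f : E [⋀^Fin 2]→L[ℝ] ℝ) (r : ℝ) (u v : E) :
    f ![u, r • v] = r * f ![u, v] := by
  have h : Function.update ![u, 0] 1 = fun w => ![u, w] := by
    ext w i
    fin_cases i <;> rfl
  have := f.map_update_smul ![u, 0] 1 r v
  simp only [h] at this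
  exact this

/-- Polar coordinates on `ℂ`. -/
noncomputable def polarMap (y : ℝ × ℝ) : ℂ := y.1 * (Circle.exp y.2 : ℂ)

theorem hasDerivAt_circle_exp (t : ℝ) :
    HasDerivAt (fun t : ℝ => (Circle.exp t : ℂ)) (Complex.I * (Circle.exp t : ℂ)) t := by
  simp only [Circle.coe_exp]
  have := ((Complex.ofRealCLM.hasDerivAt (x := t)).mul_const Complex.I).cexp
  simpa [mul_comm] using this

theorem hasFDerivAt_polarMap (y : ℝ × ℝ) : HasFDerivAt polarMap
    ((ContinuousLinearMap.fst ℝ ℝ ℝ).smulRight (Circle.exp y.2 : ℂ) +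
      (ContinuousLinearMap.snd ℝ ℝ ℝ).smulRight (y.1 * (Complex.I * (Circle.exp y.2 : ℂ)))) y := by
  have h2 : HasFDerivAt (fun y : ℝ × ℝ => (Circle.exp y.2 : ℂ)) _ y :=
    (hasDerivAt_circle_exp y.2).hasFDerivAt.comp y hasFDerivAt_snd
  have h3 : HasFDerivAt (fun y : ℝ × ℝ => (y.1 : ℂ)) _ y :=
    Complex.ofRealCLM.hasFDerivAt.comp y hasFDerivAt_fst
  refine (h3.mul h2).congr_fderiv ?_
  ext <;> simp [mul_comm]

theorem contDiff_polarMap : ContDiff ℝ ∞ polarMap := by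
  have : ContDiff ℝ ∞ fun t : ℝ => (Circle.exp t : ℂ) := by
    rw [← contMDiff_iff_contDiff]
    exact Circle.contMDiff_coe.comp contMDiff_circleExp
  exact (Complex.ofRealCLM.contDiff.comp contDiff_fst).mul (this.comp contDiff_snd)

variable [IsManifold 𝓘(ℝ, X) ∞ M]

/-- By Stokes the boundary integral of `η` is the integral over the unit disc of `dη`, the pullback
of `κ` under `p ∘ G`. The latter is positive because `p ∘ G` is a holomorphic immersion, in the
sense of `hol`. Polar coordinates replace the disc by the rectangle `[0, 1] × [0, 2π]`. -/
theorem IsBoothbyWang.integral_circle_pos (hM : IsBoothbyWang p η κ)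
    (hκ : ∀ (x : B) (u : V'), u ≠ 0 → 0 < κ x ![u, Complex.I • u]) {G : ℂ → M}
    (hG : ContMDiff 𝓘(ℝ, ℂ) 𝓘(ℝ, X) ∞ G)
    (hol : ∀ z, ∃ v : V', v ≠ 0 ∧
      ∀ h : ℂ, (mfderiv 𝓘(ℝ, ℂ) 𝓘(ℝ, V') (fun z => p (G z)) z h : V') = h • v) :
    0 < ∫ t in (0)..(2 * Real.pi), η (G (Circle.exp t))
      ![mfderiv 𝓘(ℝ, ℝ) 𝓘(ℝ, X) (fun t : ℝ => G (Circle.exp t)) t (1 : ℝ)] := by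
  set ψ : ℝ × ℝ → M := fun y => G (polarMap y) with hψdef
  have hψ : ContMDiff 𝓘(ℝ, ℝ × ℝ) 𝓘(ℝ, X) ∞ ψ := hG.comp contDiff_polarMap.contMDiff
  set α : ℝ × ℝ → (ℝ × ℝ) [⋀^Fin 1]→L[ℝ] ℝ := η.pullbackVec ψ with hα
  have hαs : ContDiff ℝ ∞ α := hM.smooth.contDiff_pullbackVec hψ
  have hmf : ∀ y h, mfderiv 𝓘(ℝ, ℝ × ℝ) 𝓘(ℝ, X) ψ y h =
      mfderiv 𝓘(ℝ, ℂ) 𝓘(ℝ, X) G (polarMap y) (fderiv ℝ polarMap y h) := by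
    intro y h
    have := mfderiv_comp y (I := 𝓘(ℝ, ℝ × ℝ)) (I' := 𝓘(ℝ, ℂ)) (I'' := 𝓘(ℝ, X)) (g := G)
      (f := polarMap)
      ((hG (polarMap y)).mdifferentiableAt (by simp))
      (contDiff_polarMap.contMDiff.mdifferentiable (by simp) y)
    rw [mfderiv_eq_fderiv (f := polarMap)] at this
    exact congrArg (fun L => L h) this
  have hev : ∀ v : ℝ × ℝ, ContDiff ℝ ∞ fun y => α y ![v] := fun v =>
    (ContinuousAlternatingMap.apply ℝ (ℝ × ℝ) ℝ ![v]).contDiff.comp hαs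
  have hpol : ∀ y : ℝ × ℝ, fderiv ℝ polarMap y (1, 0) = (Circle.exp y.2 : ℂ) ∧
      fderiv ℝ polarMap y (0, 1) = y.1 * (Complex.I * (Circle.exp y.2 : ℂ)) := fun y => by
    rw [(hasFDerivAt_polarMap y).fderiv]
    simp
  -- With `v` the derivative of `p ∘ G`, the radial vector goes to `w = exp(iθ) v` and the angular
  -- one to `r i w`.
  have hcurv : ∀ y : ℝ × ℝ, ∃ w : V', w ≠ 0 ∧ extDeriv α y ![(1, 0), (0, 1)] =
      y.1 * κ (p (ψ y)) ![w, Complex.I • w] := by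
    intro y
    obtain ⟨v, hv, hv'⟩ := hol (polarMap y)
    have hcomp : ∀ h : ℂ, (mfderiv 𝓘(ℝ, X) 𝓘(ℝ, V') p (G (polarMap y))
        (mfderiv 𝓘(ℝ, ℂ) 𝓘(ℝ, X) G (polarMap y) h) : V') = h • v := fun h => by
      rw [← hv' h]
      exact congrArg (fun L => L h) (mfderiv_comp (polarMap y) (I := 𝓘(ℝ, ℂ)) (I' := 𝓘(ℝ, X))
        (I'' := 𝓘(ℝ, V')) (g := p) (f := G)
        ((hM.principal.contMDiff_proj _).mdifferentiableAt (by simp))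
        ((hG _).mdifferentiableAt (by simp))).symm
    refine ⟨(Circle.exp y.2 : ℂ) • v, smul_ne_zero (Circle.coe_ne_zero _) hv, ?_⟩
    rw [hM.smooth.extDeriv_pullbackVec hψ, hM.curvature, DiffForm.pullbackVec_apply]
    have hvec : (fun i => (mfderiv 𝓘(ℝ, X) 𝓘(ℝ, V') p (ψ y) (mfderiv 𝓘(ℝ, ℝ × ℝ) 𝓘(ℝ, X) ψ y
        ((![(1, 0), (0, 1)] : Fin 2 → ℝ × ℝ) i)) : V')) =
        ![(Circle.exp y.2 : ℂ) • v, y.1 • (Complex.I • (Circle.exp y.2 : ℂ) • v)] := by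
      ext i
      fin_cases i
      · simp only [Fin.zero_eta, Matrix.cons_val_zero]
        exact (congrArg (mfderiv 𝓘(ℝ, X) 𝓘(ℝ, V') p (ψ y)) ((hmf y (1, 0)).trans
          (by rw [(hpol y).1]))).trans (hcomp _)
      · simp only [Fin.mk_one, Matrix.cons_val_one, Matrix.cons_val_zero]
        refine (congrArg (mfderiv 𝓘(ℝ, X) 𝓘(ℝ, V') p (ψ y)) ((hmf y (0, 1)).trans
          (by rw [(hpol y).2]))).trans ((hcomp _).trans ?_)
        rw [mul_smul, mul_smul]
        exact algebraMap_smul ℂ y.1 (Complex.I • (Circle.exp y.2 : ℂ) • v : V')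
    refine (congrArg (κ (p (ψ y)) : V' [⋀^Fin 2]→L[ℝ] ℝ) hvec).trans ?_
    exact ContinuousAlternatingMap.map_pair_smul (E := V') _ _ _ _
  have hext : ∀ y : ℝ × ℝ, extDeriv α y ![(1, 0), (0, 1)] =
      fderiv ℝ (fun y => α y ![(0, 1)]) y (1, 0) + fderiv ℝ (fun y => -α y ![(1, 0)]) y (0, 1) := by
    intro y
    rw [extDeriv_apply (hαs.differentiable (by simp) y), Fin.sum_univ_two, fderiv_fun_neg]
    have h0 : Fin.removeNth 0 (![(1, 0), (0, 1)] : Fin 2 → ℝ × ℝ) = ![(0, 1)] := by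
      ext i <;> fin_cases i <;> rfl
    have h1 : Fin.removeNth 1 (![(1, 0), (0, 1)] : Fin 2 → ℝ × ℝ) = ![(1, 0)] := by
      ext i <;> fin_cases i <;> rfl
    rw [h0, h1]
    simp
  have hcont : Continuous fun y : ℝ × ℝ => extDeriv α y ![(1, 0), (0, 1)] := by
    simp_rw [hext]
    exact (((hev (0, 1)).continuous_fderiv (by simp)).clm_apply continuous_const).add
      ((((hev (1, 0)).neg).continuous_fderiv (by simp)).clm_apply continuous_const)
  -- Green's theorem on the rectangle.
  have hdiv := MeasureTheory.integral2_divergence_prod_of_hasFDerivAt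
    (fun y => α y ![(0, 1)]) (fun y => -α y ![(1, 0)]) (fderiv ℝ fun y => α y ![(0, 1)])
    (fderiv ℝ fun y => -α y ![(1, 0)]) 0 0 1 (2 * Real.pi) (hev _).continuous.continuousOn
    (hev _).neg.continuous.continuousOn
    (fun y _ => ((hev _).differentiable (by simp) y).hasFDerivAt)
    (fun y _ => ((hev _).neg.differentiable (by simp) y).hasFDerivAt) (by
      simp_rw [← hext]
      exact hcont.continuousOn.integrableOn_compact (isCompact_uIcc.prod isCompact_uIcc))
  simp_rw [← hext] at hdiv
  have hpos : 0 < ∫ x in (0 : ℝ)..1, ∫ y in (0)..(2 * Real.pi),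
      extDeriv α (x, y) ![(1, 0), (0, 1)] := by
    refine intervalIntegral.intervalIntegral_pos_of_pos_on ?_ (fun x hx => ?_) one_pos
    · exact (intervalIntegral.continuous_parametric_intervalIntegral_of_continuous' hcont _
        _).intervalIntegrable _ _
    · refine intervalIntegral.intervalIntegral_pos_of_pos
        ((hcont.comp (by fun_prop : Continuous fun y : ℝ => (x, y))).intervalIntegrable _ _)
        (fun y => ?_) (by positivity)
      obtain ⟨w, hw, h⟩ := hcurv (x, y)
      simp only [h]
      exact mul_pos hx.1 (hκ _ w hw)
  have happ : ∀ y h, α y ![h] =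
      η (G (polarMap y)) ![mfderiv 𝓘(ℝ, ℂ) 𝓘(ℝ, X) G (polarMap y) (fderiv ℝ polarMap y h)] := by
    intro y h
    rw [hα, DiffForm.pullbackVec_apply]
    congr 1
    ext i
    fin_cases i
    exact hmf y h
  -- The sides at angles `0` and `2π` cancel, and the side at radius `0` is collapsed to a point by
  -- the polar map. Only the unit circle contributes.
  have hper : ∀ x : ℝ, α (x, 2 * Real.pi) ![(1, 0)] = α (x, 0) ![(1, 0)] := by
    intro x
    have hz : polarMap (x, 2 * Real.pi) = polarMap (x, 0) := by simp [polarMap]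
    rw [happ, happ, (hpol _).1, (hpol _).1, hz]
    simp
  have hzero : ∀ y : ℝ, α (0, y) ![(0, 1)] = 0 := by
    intro y
    rw [happ, (hpol _).2]
    exact (η _ : X [⋀^Fin 1]→L[ℝ] ℝ).map_coord_zero 0 (by simp; exact map_zero _)
  have hone : ∀ t : ℝ, α (1, t) ![(0, 1)] = η (G (Circle.exp t))
      ![mfderiv 𝓘(ℝ, ℝ) 𝓘(ℝ, X) (fun t : ℝ => G (Circle.exp t)) t (1 : ℝ)] := by
    intro t
    have hz : polarMap (1, t) = (Circle.exp t : ℂ) := by simp [polarMap]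
    have hd : HasDerivAt (fun t : ℝ => (Circle.exp t : ℂ)) (Complex.I * (Circle.exp t : ℂ)) t :=
      hasDerivAt_circle_exp t
    have hchain : mfderiv 𝓘(ℝ, ℝ) 𝓘(ℝ, X) (fun t : ℝ => G (Circle.exp t)) t (1 : ℝ) =
        mfderiv 𝓘(ℝ, ℂ) 𝓘(ℝ, X) G (Circle.exp t) (Complex.I * (Circle.exp t : ℂ)) := by
      have := mfderiv_comp t (I := 𝓘(ℝ, ℝ)) (I' := 𝓘(ℝ, ℂ)) (I'' := 𝓘(ℝ, X)) (g := G)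
        (f := fun t : ℝ => (Circle.exp t : ℂ)) ((hG _).mdifferentiableAt (by simp))
        hd.differentiableAt.mdifferentiableAt
      rw [mfderiv_eq_fderiv (f := fun t : ℝ => (Circle.exp t : ℂ)), hd.hasFDerivAt.fderiv] at this
      refine (congrArg (fun L => L (1 : ℝ)) this).trans ?_
      exact congrArg (mfderiv 𝓘(ℝ, ℂ) 𝓘(ℝ, X) G (Circle.exp t)) (one_smul ℝ _)
    rw [happ, (hpol _).2, hz, hchain]
    simp
  simp only [hper, hzero, sub_self, zero_add, intervalIntegral.integral_zero, sub_zero,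
    hone] at hdiv
  rwa [hdiv] at hpos

/-- There is no smooth section over a holomorphic sphere, given by two immersed discs that are
glued along their boundary. -/
theorem IsBoothbyWang.not_glued_discs (hM : IsBoothbyWang p η κ)
    (hκ : ∀ (x : B) (u : V'), u ≠ 0 → 0 < κ x ![u, Complex.I • u]) {G₁ G₂ : ℂ → M}
    (hG₁ : ContMDiff 𝓘(ℝ, ℂ) 𝓘(ℝ, X) ∞ G₁) (hG₂ : ContMDiff 𝓘(ℝ, ℂ) 𝓘(ℝ, X) ∞ G₂)
    (hol₁ : ∀ z, ∃ v : V', v ≠ 0 ∧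
      ∀ h : ℂ, (mfderiv 𝓘(ℝ, ℂ) 𝓘(ℝ, V') (fun z => p (G₁ z)) z h : V') = h • v)
    (hol₂ : ∀ z, ∃ v : V', v ≠ 0 ∧
      ∀ h : ℂ, (mfderiv 𝓘(ℝ, ℂ) 𝓘(ℝ, V') (fun z => p (G₂ z)) z h : V') = h • v)
    (hglue : ∀ a : Circle, G₁ a = G₂ (a⁻¹ : Circle)) : False := by
  have h₁ := hM.integral_circle_pos hκ hG₁ hol₁
  have h₂ := hM.integral_circle_pos hκ hG₂ hol₂
  set c₂ : ℝ → M := fun t => G₂ (Circle.exp t) with hc₂def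
  -- The gluing `a ↦ a⁻¹` reverses the boundary orientation, so the two positive integrals are
  -- negatives of each other.
  have hc : (fun t : ℝ => G₁ (Circle.exp t)) = fun t => c₂ (2 * Real.pi - t) := by
    ext t
    rw [hglue, hc₂def]
    simp [Circle.exp_sub]
  have hc₂ : ContMDiff 𝓘(ℝ, ℝ) 𝓘(ℝ, X) ∞ c₂ :=
    hG₂.comp (Circle.contMDiff_coe.comp contMDiff_circleExp)
  have hneg : ∀ t : ℝ, η (G₁ (Circle.exp t))
      ![mfderiv 𝓘(ℝ, ℝ) 𝓘(ℝ, X) (fun t : ℝ => G₁ (Circle.exp t)) t (1 : ℝ)] =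
      -(η (c₂ (2 * Real.pi - t)) ![mfderiv 𝓘(ℝ, ℝ) 𝓘(ℝ, X) c₂ (2 * Real.pi - t) (1 : ℝ)]) := by
    intro t
    have hd : HasDerivAt (fun t : ℝ => 2 * Real.pi - t) (-1) t := (hasDerivAt_id t).const_sub _
    have hchain := mfderiv_comp t (I := 𝓘(ℝ, ℝ)) (I' := 𝓘(ℝ, ℝ)) (I'' := 𝓘(ℝ, X)) (g := c₂)
      (f := fun t : ℝ => 2 * Real.pi - t) ((hc₂ _).mdifferentiableAt (by simp))
      hd.differentiableAt.mdifferentiableAt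
    rw [mfderiv_eq_fderiv (f := fun t : ℝ => 2 * Real.pi - t), hd.hasFDerivAt.fderiv] at hchain
    have hval : (mfderiv 𝓘(ℝ, ℝ) 𝓘(ℝ, X) (fun t => c₂ (2 * Real.pi - t)) t (1 : ℝ) : X) =
        -(mfderiv 𝓘(ℝ, ℝ) 𝓘(ℝ, X) c₂ (2 * Real.pi - t) (1 : ℝ) : X) := by
      refine (congrArg (fun L => L (1 : ℝ)) hchain).trans ?_
      refine Eq.trans ?_ ((mfderiv 𝓘(ℝ, ℝ) 𝓘(ℝ, X) c₂ (2 * Real.pi - t)).map_neg (1 : ℝ))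
      exact congrArg (mfderiv 𝓘(ℝ, ℝ) 𝓘(ℝ, X) c₂ (2 * Real.pi - t)) (one_smul ℝ (-1 : ℝ))
    have hpt : G₁ (Circle.exp t) = c₂ (2 * Real.pi - t) := congrFun hc t
    have key : ∀ (f : X [⋀^Fin 1]→L[ℝ] ℝ) (v : X), f ![-v] = -f ![v] := fun f v => by
      simpa using f.map_single_smul (-1) v
    rw [hc, hpt]
    exact (congrArg (fun v : X => (η (c₂ (2 * Real.pi - t)) : X [⋀^Fin 1]→L[ℝ] ℝ) ![v])
      hval).trans (key _ _)
  simp_rw [hneg] at h₁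
  rw [intervalIntegral.integral_neg, intervalIntegral.integral_comp_sub_left
    (fun t => η (c₂ t) ![mfderiv 𝓘(ℝ, ℝ) 𝓘(ℝ, X) c₂ t (1 : ℝ)])] at h₁
  simp only [sub_self, sub_zero] at h₁
  linarith

end Stokes

/-! ### The weight is not zero. -/

namespace ProjBundle

variable {n : ℕ} {V B F : Type*} {E : B → Type*}
  [∀ x, AddCommGroup (E x)] [∀ x, Module ℂ (E x)] [TopologicalSpace (TotalSpace F E)]
  [NormedAddCommGroup V] [NormedSpace ℂ V] [TopologicalSpace B] [NormedAddCommGroup F]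
  [NormedSpace ℂ F] [∀ x, TopologicalSpace (E x)] [FiberBundle F E] [VectorBundle ℂ F E]
  [Fact (Module.finrank ℂ F = n + 1)] [ChartedSpace V B] [IsManifold 𝓘(ℂ, V) ω B]
  [ContMDiffVectorBundle ω F E 𝓘(ℂ, V)]
  (c : OpenPartialHomeomorph B V) (e : Trivialization F (π F E))
  [MemTrivializationAtlas e] (w₁ : {w : F // w ≠ 0})

/-- An affine parametrization of a projective line in a fibre of `ℙ(E)` is a holomorphic
immersion. -/
theorem exists_mfderiv_homCoord_line (hc : c ∈ atlas V B) {u : V}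
    (hu : u ∈ c.target ∩ c.symm ⁻¹' e.baseSet) {a b : F} {φ ψ : F →L[ℂ] ℂ}
    (hφa : φ a = 1) (hφb : φ b = 0) (hψa : ψ a = 0) (hψb : ψ b = 1) (z : ℂ) :
    ∃ v : V × EuclideanSpace ℂ (Fin n), v ≠ 0 ∧
      ∀ h : ℂ, (mfderiv 𝓘(ℝ, ℂ) 𝓘(ℝ, V × EuclideanSpace ℂ (Fin n))
        (fun z : ℂ => homCoord c e w₁ (u, a + z • b)) z h : V × EuclideanSpace ℂ (Fin n)) =
          h • v := by
  have hne : ∀ z : ℂ, a + z • b ≠ 0 := fun z h => by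
    have := congrArg φ h
    simp [hφa, hφb] at this
  have hline : ContDiff ℂ ω (fun z : ℂ => (u, a + z • b)) :=
    contDiff_const.prodMk (contDiff_const.add (contDiff_id.smul contDiff_const))
  have hf : ContMDiff 𝓘(ℂ, ℂ) 𝓘(ℂ, V × EuclideanSpace ℂ (Fin n)) ω
      (fun z : ℂ => homCoord c e w₁ (u, a + z • b)) :=
    (contMDiffOn_homCoord c e w₁ hc).comp_contMDiff hline.contMDiff
      fun z => ⟨hu, hne z⟩
  obtain ⟨D, hD⟩ : ∃ D : ℂ →L[ℂ] V × EuclideanSpace ℂ (Fin n), HasMFDerivAt 𝓘(ℂ, ℂ)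
      𝓘(ℂ, V × EuclideanSpace ℂ (Fin n)) (fun z : ℂ => homCoord c e w₁ (u, a + z • b)) z D :=
    ⟨_, ((hf z).mdifferentiableAt (by simp)).hasMFDerivAt⟩
  refine ⟨D 1, fun h0 => ?_, fun h => ?_⟩
  -- If the derivative vanished, so would that of a local choice `ζ` of homogeneous coordinates
  -- along the line. Since `ζ` is a multiple of `a + z • b`, one has `ψ ζ = z · φ ζ`, and
  -- differentiating gives `φ ζ = 0`. Then the multiple is `0` and `ζ = 0`, which is impossible.
  · have hD0 : D = 0 := by
      ext1
      simpa using h0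
    set x := homCoord c e w₁ (u, a + z • b) with hxdef
    have hxp : ∀ z : ℂ, (homCoord c e w₁ (u, a + z • b)).proj = c.symm u := fun z => rfl
    obtain ⟨O, ζ, hO, hxO, hζ, hζ'⟩ := exists_homCoord_section (n := n) c e w₁ hc x
      ⟨by rw [hxp]; exact c.map_target hu.1, hu.2⟩
    obtain ⟨T, hT⟩ : ∃ T : V × EuclideanSpace ℂ (Fin n) →L[ℂ] F,
        HasMFDerivAt 𝓘(ℂ, V × EuclideanSpace ℂ (Fin n)) 𝓘(ℂ, F) ζ x T :=
      ⟨_, ((hζ.contMDiffAt (hO.mem_nhds hxO)).mdifferentiableAt (by simp)).hasMFDerivAt⟩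
    have hg' : HasFDerivAt (fun z : ℂ => ζ (homCoord c e w₁ (u, a + z • b))) (T.comp D) z :=
      (HasMFDerivAt.comp z hT hD).hasFDerivAt
    have hg : HasDerivAt (fun z : ℂ => ζ (homCoord c e w₁ (u, a + z • b))) 0 z := by
      simpa [hD0] using hg'.hasDerivAt
    have hmem : ∀ᶠ z' : ℂ in 𝓝 z, homCoord c e w₁ (u, a + z' • b) ∈ O :=
      hf.continuous.continuousAt (hO.mem_nhds hxO)
    have hprop : ∀ z' : ℂ, homCoord c e w₁ (u, a + z' • b) ∈ O →
        ∃ s : ℂ, s • (a + z' • b) = ζ (homCoord c e w₁ (u, a + z' • b)) := fun z' hz' => by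
      obtain ⟨-, h2, h3⟩ := hζ' _ hz'
      rw [hxp, c.right_inv hu.1] at h3
      exact (homCoord_eq_iff c e w₁ u h2 (hne z')).1 h3
    have hφg := φ.hasFDerivAt.comp_hasDerivAt z hg
    have hψg := ψ.hasFDerivAt.comp_hasDerivAt z hg
    have hprod := (hasDerivAt_id z).mul hφg
    have heq : (ψ ∘ fun z : ℂ => ζ (homCoord c e w₁ (u, a + z • b))) =ᶠ[𝓝 z]
        id * (φ ∘ fun z : ℂ => ζ (homCoord c e w₁ (u, a + z • b))) := by
      filter_upwards [hmem] with z' hz'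
      obtain ⟨s, hs⟩ := hprop z' hz'
      simp only [Function.comp_apply, Pi.mul_apply, id_eq, ← hs]
      simp [hφa, hφb, hψa, hψb, mul_comm]
    have hz := (hψg.congr_of_eventuallyEq heq.symm).unique hprod
    obtain ⟨s, hs⟩ := hprop z hxO
    simp only [map_zero, Function.comp_apply, mul_zero, add_zero, one_mul, id_eq] at hz
    rw [← hs] at hz
    have hs0 : s = 0 := by simpa [hφa, hφb] using hz.symm
    rw [hs0, zero_smul] at hs
    exact (hζ' _ hxO).2.1 hs.symm
  · refine (congrArg (fun L : ℂ →L[ℝ] V × EuclideanSpace ℂ (Fin n) => L h)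
      hD.real_of_complex.mfderiv).trans ?_
    change D h = h • D 1
    rw [← map_smul, smul_eq_mul, mul_one]

variable {X M : Type*} [NormedAddCommGroup X] [NormedSpace ℝ X]
  [TopologicalSpace M] [ChartedSpace X M] [IsManifold 𝓘(ℝ, X) ∞ M] [MulAction Circle M]

/-- The weight of an equivariant lift of the tautological projection to a Boothby–Wang bundle
with positive curvature does not vanish. -/
theorem weight_ne_zero {p : M → ProjBundle F E} {η : DiffForm X M 1}
    {κ : DiffForm (V × EuclideanSpace ℂ (Fin n)) (ProjBundle F E) 2} (hM : IsBoothbyWang p η κ)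
    (hκ : ∀ (x : ProjBundle F E) (u : V × EuclideanSpace ℂ (Fin n)), u ≠ 0 →
      0 < κ x ![u, Complex.I • u]) (hn : 1 ≤ n) (hc : c ∈ atlas V B) {u : V}
    (hu : u ∈ c.target ∩ c.symm ⁻¹' e.baseSet) {φ : F → M}
    (hφ : ContMDiffOn 𝓘(ℝ, F) 𝓘(ℝ, X) ∞ φ {0}ᶜ)
    (hφp : ∀ w ≠ 0, p (φ w) = homCoord c e w₁ (u, w)) {k : ℤ}
    (hφk : ∀ w ≠ 0, ∀ a : Circle, φ ((a : ℂ) • w) = a ^ k • φ w) : k ≠ 0 := by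
  rintro rfl
  have : FiniteDimensional ℂ F := .of_fact_finrank_eq_succ n
  have hfin : Module.finrank ℂ F = n + 1 := Fact.out
  let b := Module.finBasisOfFinrankEq ℂ F hfin
  let i : Fin (n + 1) := 0
  let j : Fin (n + 1) := Fin.last n
  have hij : i ≠ j := by
    rw [Ne, Fin.ext_iff]
    simp [i, j]
    lia
  let f := LinearMap.toContinuousLinearMap (b.coord i)
  let g := LinearMap.toContinuousLinearMap (b.coord j)
  have hfi : f (b i) = 1 := by simp [f]
  have hfj : f (b j) = 0 := by simp [f, hij.symm]
  have hgi : g (b i) = 0 := by simp [g, hij]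
  have hgj : g (b j) = 1 := by simp [g]
  have hne₁ : ∀ z : ℂ, b i + z • b j ≠ 0 := fun z h => by
    have := congrArg f h
    simp [hfi, hfj] at this
  have hne₂ : ∀ z : ℂ, b j + z • b i ≠ 0 := fun z h => by
    have := congrArg g h
    simp [hgi, hgj] at this
  have hline : ∀ a b : F, ContDiff ℝ ∞ (fun z : ℂ => a + z • b) := fun a b =>
    contDiff_const.add (contDiff_id.smul contDiff_const)
  have hcongr : ∀ {f₁ f₂ : ℂ → ProjBundle F E}, f₁ = f₂ → ∀ z h : ℂ,
      (mfderiv 𝓘(ℝ, ℂ) 𝓘(ℝ, V × EuclideanSpace ℂ (Fin n)) f₁ z h :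
        V × EuclideanSpace ℂ (Fin n)) =
      mfderiv 𝓘(ℝ, ℂ) 𝓘(ℝ, V × EuclideanSpace ℂ (Fin n)) f₂ z h := by
    rintro f₁ _ rfl z h
    rfl
  -- The two affine charts of the projective line through `b i` and `b j`. On the unit circle `b i +
  -- a • b j = a • (b j + a⁻¹ • b i)`, so a lift of weight zero takes equal values on the two
  -- boundaries.
  refine hM.not_glued_discs hκ (G₁ := fun z => φ (b i + z • b j))
    (G₂ := fun z => φ (b j + z • b i))
    (hφ.comp_contMDiff (hline _ _).contMDiff hne₁)
    (hφ.comp_contMDiff (hline _ _).contMDiff hne₂) (fun z => ?_) (fun z => ?_) (fun a => ?_)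
  · obtain ⟨v, hv, h⟩ := exists_mfderiv_homCoord_line (n := n) c e w₁ hc hu hfi hfj hgi hgj z
    exact ⟨v, hv, fun t => (hcongr (funext fun z => hφp _ (hne₁ z)) z t).trans (h t)⟩
  · obtain ⟨v, hv, h⟩ := exists_mfderiv_homCoord_line (n := n) c e w₁ hc hu hgj hgi hfj hfi z
    exact ⟨v, hv, fun t => (hcongr (funext fun z => hφp _ (hne₂ z)) z t).trans (h t)⟩
  · have := hφk _ (hne₂ (a⁻¹ : Circle)) a
    rw [zpow_zero, one_smul] at this
    rw [← this, smul_add, smul_smul]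
    simp [add_comm]

end ProjBundle

/-! ### Smooth maps to the sphere and to lens spaces. -/

section Sphere

variable {E : Type*} [NormedAddCommGroup E] [InnerProductSpace ℝ E] {n : ℕ}
  [Fact (Module.finrank ℝ E = n + 1)]

open Classical in
/-- The radial retraction of `E ∖ 0` onto the unit sphere. -/
noncomputable def sphereRetract (z₀ : Metric.sphere (0 : E) 1) (w : E) : Metric.sphere (0 : E) 1 :=
  if h : w = 0 then z₀ else ⟨‖w‖⁻¹ • w, by simp [norm_smul, h]⟩

theorem coe_sphereRetract (z₀ : Metric.sphere (0 : E) 1) {w : E} (hw : w ≠ 0) :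
    (sphereRetract z₀ w : E) = ‖w‖⁻¹ • w := by
  simp [sphereRetract, hw]

theorem contMDiffOn_sphereRetract (z₀ : Metric.sphere (0 : E) 1) :
    ContMDiffOn 𝓘(ℝ, E) (𝓡 n) ∞ (sphereRetract z₀) {0}ᶜ := by
  intro w hw
  -- On the open submanifold `E ∖ 0` the radial map is defined everywhere, so that it can be
  -- corestricted to the sphere.
  let U : TopologicalSpace.Opens E := ⟨{0}ᶜ, isOpen_compl_singleton⟩
  have hf : ContMDiff 𝓘(ℝ, E) 𝓘(ℝ, E) ∞ (fun x : U => ‖(x : E)‖⁻¹ • (x : E)) := by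
    intro x
    have hx : (x : E) ≠ 0 := x.2
    have : ContDiffAt ℝ ∞ (fun x : E => ‖x‖⁻¹ • x) x :=
      ((contDiffAt_norm ℝ hx).inv (norm_ne_zero_iff.2 hx)).smul contDiffAt_id
    exact contMDiffAt_subtype_iff.2 this.contMDiffAt
  have hs : ∀ x : U, ‖(x : E)‖⁻¹ • (x : E) ∈ Metric.sphere (0 : E) 1 := fun x => by
    have hx : (x : E) ≠ 0 := x.2
    simp [norm_smul, hx]
  have h := hf.codRestrict_sphere (n := n) hs
  have heq : (fun x : U => sphereRetract z₀ (x : E)) = Set.codRestrict _ _ hs := by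
    ext1 x
    exact Subtype.ext (coe_sphereRetract z₀ x.2)
  have h' := h ⟨w, hw⟩
  rw [← heq, contMDiffAt_subtype_iff] at h'
  exact h'.contMDiffWithinAt

end Sphere

namespace LensSpace

variable {n l : ℕ} [NeZero l]

/-- The quotient map from the sphere to the lens space. -/
def mk (z : OddSphere n) : LensSpace n l :=
  Quotient.mk (MulAction.orbitRel (rootsOfUnity l ℂ) (OddSphere n)) z

theorem mk_surjective : Function.Surjective (mk : OddSphere n → LensSpace n l) :=
  Quotient.mk_surjective

theorem mk_eq_mk_iff {z z' : OddSphere n} : (mk z : LensSpace n l) = mk z' ↔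
    ∃ a : rootsOfUnity l ℂ, a • z' = z :=
  Quotient.eq.trans MulAction.orbitRel_apply

theorem exists_chartAt_eq (y : LensSpace n l) :
    ∃ (z : OddSphere n) (s : OpenPartialHomeomorph (LensSpace n l) (OddSphere n)),
      mk z = y ∧ z ∈ s.target ∧ (∀ z, s.symm z = mk z) ∧
      chartAt (EuclideanSpace ℝ (Fin (2 * n + 1))) y =
        s.trans (chartAt (EuclideanSpace ℝ (Fin (2 * n + 1))) z) := by
  have hloc : IsLocalHomeomorph (mk : OddSphere n → LensSpace n l) :=
    isQuotientCoveringMap_quotientMk_of_properlyDiscontinuousSMul.isCoveringMap.isLocalHomeomorph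
  let g := (mk_surjective (n := n) (l := l)).hasRightInverse.choose
  exact ⟨g y, hloc.localInverseAt (g y), mk_surjective.hasRightInverse.choose_spec y,
    hloc.self_mem_localInverseAt_target, fun z => congrFun (hloc.localInverseAt_symm _) z, rfl⟩

/-- The chart at `mk z` is built from a chosen representative `z₀` of the orbit, possibly different
from `z`. Near `z` the quotient map is therefore the rotation that takes `z` to `z₀`, followed by a
chart of the sphere and the inverse of that chart. -/
theorem contMDiff_mk : ContMDiff (𝓡 (2 * n + 1)) (𝓡 (2 * n + 1)) ∞
    (mk : OddSphere n → LensSpace n l) := by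
  intro z
  obtain ⟨z₀, s, hz₀, hs, hsymm, hch⟩ := exists_chartAt_eq (mk z : LensSpace n l)
  obtain ⟨a, ha⟩ := mk_eq_mk_iff.1 hz₀
  set φ := chartAt (EuclideanSpace ℝ (Fin (2 * n + 1))) z₀ with hφ
  have hza : z₀ ∈ φ.source := mem_chart_source _ _
  have h1 : ContMDiffAt (𝓡 (2 * n + 1)) (𝓡 (2 * n + 1)) ∞ φ z₀ :=
    contMDiffAt_of_mem_maximalAtlas (IsManifold.chart_mem_maximalAtlas z₀) hza
  have hs' : s (mk z) = z₀ := by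
    rw [← hz₀, ← hsymm, s.right_inv hs]
  have htarget : φ z₀ ∈
      (chartAt (EuclideanSpace ℝ (Fin (2 * n + 1))) (mk z : LensSpace n l)).target := by
    convert mem_chart_target (EuclideanSpace ℝ (Fin (2 * n + 1))) (mk z : LensSpace n l)
    rw [hch]
    simp [hs', hφ]
  have h2 : ContMDiffAt (𝓡 (2 * n + 1)) (𝓡 (2 * n + 1)) ∞
      (chartAt (EuclideanSpace ℝ (Fin (2 * n + 1))) (mk z : LensSpace n l)).symm (φ z₀) :=
    contMDiffAt_symm_of_mem_maximalAtlas (IsManifold.chart_mem_maximalAtlas _) htarget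
  have h3 := (contMDiff_roots_smul n l a).of_le (m := ∞) le_top z
  have h4 := (h2.comp z₀ h1)
  rw [← ha] at h4
  refine (h4.comp z h3).congr_of_eventuallyEq ?_
  have hev : ∀ᶠ z' in 𝓝 z, a • z' ∈ φ.source :=
    (continuous_const_smul a).continuousAt.eventually
      (φ.open_source.mem_nhds (by simpa only [ha] using hza))
  filter_upwards [hev] with z' hz'
  simp only [Function.comp_apply, hch, OpenPartialHomeomorph.coe_trans_symm]
  rw [φ.left_inv hz', hsymm]
  exact mk_eq_mk_iff.2 ⟨a⁻¹, inv_smul_smul a z'⟩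

theorem exists_section (y : LensSpace n l) :
    ∃ (O : Set (LensSpace n l)) (s : LensSpace n l → OddSphere n), IsOpen O ∧ y ∈ O ∧
      ContMDiffOn (𝓡 (2 * n + 1)) (𝓡 (2 * n + 1)) ∞ s O ∧ ∀ y' ∈ O, mk (s y') = y' := by
  obtain ⟨z₀, s, hz₀, hs, hsymm, hch⟩ := exists_chartAt_eq y
  set φ := chartAt (EuclideanSpace ℝ (Fin (2 * n + 1))) z₀ with hφ
  refine ⟨_, fun y' => φ.symm (chartAt (EuclideanSpace ℝ (Fin (2 * n + 1))) y y'),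
    (chartAt (EuclideanSpace ℝ (Fin (2 * n + 1))) y).open_source, mem_chart_source _ y, ?_, ?_⟩
  · refine (contMDiffOn_chart_symm (x := z₀)).comp contMDiffOn_chart fun y' hy' => ?_
    have := (chartAt (EuclideanSpace ℝ (Fin (2 * n + 1))) y).map_source hy'
    rw [hch] at this
    rw [hch]
    exact this.1
  · intro y' hy'
    rw [hch] at hy' ⊢
    simp only [OpenPartialHomeomorph.coe_trans, Function.comp_apply]
    have h2 : φ.symm (φ (s y')) = s y' := φ.left_inv hy'.2
    rw [h2, ← hsymm, s.left_inv hy'.1]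

end LensSpace

/-! ### Trivializations from parametrizations, and local roots. -/

section Trivialization

variable {V₁ H₁ M V₂ H₂ N V₃ H₃ S V₄ H₄ L : Type*}
  [NormedAddCommGroup V₁] [NormedSpace ℝ V₁] [TopologicalSpace H₁] [TopologicalSpace M]
  [ChartedSpace H₁ M] [NormedAddCommGroup V₂] [NormedSpace ℝ V₂] [TopologicalSpace H₂]
  [TopologicalSpace N] [ChartedSpace H₂ N] [NormedAddCommGroup V₃] [NormedSpace ℝ V₃]
  [TopologicalSpace H₃] [TopologicalSpace S] [Nonempty S] [ChartedSpace H₃ S]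
  [NormedAddCommGroup V₄]
  [NormedSpace ℝ V₄] [TopologicalSpace H₄] [TopologicalSpace L] [ChartedSpace H₄ L]
  {I₁ : ModelWithCorners ℝ V₁ H₁} {I₂ : ModelWithCorners ℝ V₂ H₂} {I₃ : ModelWithCorners ℝ V₃ H₃}
  {I₄ : ModelWithCorners ℝ V₄ H₄}

/-- A parametrization `θ` of `pr ⁻¹ U` by `U × S` whose fibres are those of a submersion
`q : S → L` induces a trivialization with fibre `L`. -/
theorem exists_isSmoothTrivialization_of_quotient {pr : M → N} (hpr : ContMDiff I₁ I₂ ∞ pr)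
    {U : Set N} (hU : IsOpen U) {θ : N × S → M}
    (hθ : ContMDiffOn (I₂.prod I₃) I₁ ∞ θ (U ×ˢ univ)) {q : S → L} (hq : ContMDiff I₃ I₄ ∞ q)
    (hs : ∀ y, ∃ (O : Set L) (s : L → S), IsOpen O ∧ y ∈ O ∧ ContMDiffOn I₄ I₃ ∞ s O ∧
      ∀ y' ∈ O, q (s y') = y')
    (hprθ : ∀ x ∈ U, ∀ z, pr (θ (x, z)) = x)
    (hθq : ∀ x ∈ U, ∀ z z', θ (x, z) = θ (x, z') ↔ q z = q z')
    (hsec : ∀ m, pr m ∈ U → ∃ (O : Set M) (s : M → S), IsOpen O ∧ m ∈ O ∧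
      ContMDiffOn I₁ I₃ ∞ s O ∧ ∀ m' ∈ O, θ (pr m', s m') = m') :
    ∃ e : Trivialization L pr, e.baseSet = U ∧ IsSmoothTrivialization I₁ I₂ I₄ e := by
  classical
  have hr : ∀ y, ∃ z, q z = y := fun y => by
    obtain ⟨O, s, -, hy, -, h⟩ := hs y
    exact ⟨_, h y hy⟩
  -- The preimages `r` and `χ` are chosen point by point, without continuity. Only `q ∘ χ` and `θ
  -- (x, r y)` matter; they do not depend on the choice and so agree locally with the smooth
  -- expressions given by sections.
  choose r hr using hr
  have hχ : ∀ m, ∃ z, pr m ∈ U → θ (pr m, z) = m := fun m => by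
    by_cases hm : pr m ∈ U
    · obtain ⟨O, s, -, hmO, -, h⟩ := hsec m hm
      exact ⟨_, fun _ => h m hmO⟩
    · exact ⟨Classical.arbitrary S, fun h => (hm h).elim⟩
  choose χ hχ using hχ
  have hfwd : ContMDiffOn I₁ (I₂.prod I₄) ∞ (fun m => (pr m, q (χ m))) (pr ⁻¹' U) := by
    intro m hm
    obtain ⟨O, s, hO, hmO, hsO, h⟩ := hsec m hm
    have h1 : ContMDiffAt I₁ I₄ ∞ (fun m => q (s m)) m :=
      (hq _).comp m (hsO.contMDiffAt (hO.mem_nhds hmO))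
    refine ContMDiffWithinAt.prodMk (hpr m).contMDiffWithinAt ?_
    refine (h1.congr_of_eventuallyEq ?_).contMDiffWithinAt
    filter_upwards [hO.mem_nhds hmO, (hU.preimage hpr.continuous).mem_nhds hm] with m' hm' hm''
    exact (hθq _ hm'' _ _).1 ((hχ m' hm'').trans (h m' hm').symm)
  have hbwd : ContMDiffOn (I₂.prod I₄) I₁ ∞ (fun y : N × L => θ (y.1, r y.2)) (U ×ˢ univ) := by
    rintro ⟨x, y⟩ ⟨hx, -⟩
    obtain ⟨O, s, hO, hyO, hsO, h⟩ := hs y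
    have h1 : ContMDiffAt (I₂.prod I₄) (I₂.prod I₃) ∞ (fun y : N × L => (y.1, s y.2)) (x, y) :=
      contMDiffAt_fst.prodMk
        (ContMDiffAt.comp (x, y) (hsO.contMDiffAt (hO.mem_nhds hyO)) contMDiffAt_snd)
    have h2 : ContMDiffAt (I₂.prod I₃) I₁ ∞ θ (x, s y) :=
      hθ.contMDiffAt ((hU.prod isOpen_univ).mem_nhds ⟨hx, trivial⟩)
    refine ((ContMDiffAt.comp (x, y) h2 h1).congr_of_eventuallyEq ?_).contMDiffWithinAt
    filter_upwards [(hU.prod hO).mem_nhds (show (x, y) ∈ U ×ˢ O from ⟨hx, hyO⟩)] with y' hy'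
    exact (hθq _ hy'.1 _ _).2 ((hr _).trans (h _ hy'.2).symm)
  let e : Trivialization L pr :=
    { toFun := fun m => (pr m, q (χ m))
      invFun := fun y => θ (y.1, r y.2)
      source := pr ⁻¹' U
      target := U ×ˢ univ
      map_source' := fun m hm => ⟨hm, trivial⟩
      map_target' := fun y hy => by
        rw [mem_preimage, hprθ _ hy.1]
        exact hy.1
      left_inv' := fun m hm => by
        refine Eq.trans ?_ (hχ m hm)
        exact (hθq _ hm _ _).2 (hr _)
      right_inv' := fun y hy => by
        have h1 := hprθ _ hy.1 (r y.2)
        refine Prod.ext h1 ?_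
        have h2 := hχ (θ (y.1, r y.2)) (by rw [h1]; exact hy.1)
        rw [h1, hθq _ hy.1] at h2
        exact h2.trans (hr _)
      open_source := hU.preimage hpr.continuous
      open_target := hU.prod isOpen_univ
      continuousOn_toFun := hfwd.continuousOn
      continuousOn_invFun := hbwd.continuousOn
      baseSet := U
      open_baseSet := hU
      source_eq := rfl
      target_eq := rfl
      proj_toFun := fun m _ => rfl }
  exact ⟨e, rfl, hfwd, hbwd⟩

end Trivialization

section CircleRoot

variable {H E Y : Type*} [NormedAddCommGroup E] [NormedSpace ℝ E] [TopologicalSpace H]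
  [TopologicalSpace Y] [ChartedSpace H Y] {J : ModelWithCorners ℝ E H}

/-- Smooth circle-valued functions have local smooth roots. -/
theorem ContMDiffOn.exists_circle_root {g : Y → Circle} {O : Set Y}
    (hg : ContMDiffOn J (𝓡 1) ∞ g O) (hO : IsOpen O) {x : Y} (hx : x ∈ O) {k : ℤ} (hk : k ≠ 0) :
    ∃ (O' : Set Y) (a : Y → Circle), O' ⊆ O ∧ IsOpen O' ∧ x ∈ O' ∧
      ContMDiffOn J (𝓡 1) ∞ a O' ∧ ∀ y ∈ O', a y ^ k = g y := by
  have hh : ContMDiffOn J 𝓘(ℝ, ℂ) ∞ (fun y => (((g x)⁻¹ * g y : Circle) : ℂ)) O :=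
    Circle.contMDiff_coe.comp_contMDiffOn (contMDiffOn_const.mul hg)
  -- Dividing by `g x` makes the function equal to `1` at `x`, so the principal branch is smooth
  -- near it; the argument of `g x` is added back before division by `k`.
  let f : Y → ℝ := fun y => (Complex.log (((g x)⁻¹ * g y : Circle) : ℂ)).im
  let O' := O ∩ (fun y => (((g x)⁻¹ * g y : Circle) : ℂ)) ⁻¹' Complex.slitPlane
  have hf : ContMDiffOn J 𝓘(ℝ, ℝ) ∞ f O' := by
    intro y hy
    have h1 : ContDiffAt ℝ ∞ (fun z : ℂ => (Complex.log z).im) (((g x)⁻¹ * g y : Circle) : ℂ) :=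
      Complex.imCLM.contDiff.contDiffAt.comp _ ((Complex.contDiffAt_log hy.2).restrict_scalars ℝ)
    exact ContMDiffAt.comp_contMDiffWithinAt (g := fun z : ℂ => (Complex.log z).im) y
      h1.contMDiffAt ((hh y hy.1).mono inter_subset_left)
  refine ⟨O', fun y => Circle.exp ((Complex.arg (g x) + f y) / k), inter_subset_left,
    hh.continuousOn.isOpen_inter_preimage hO Complex.isOpen_slitPlane, ⟨hx, by simp⟩, ?_, ?_⟩
  · have h2 : ContDiff ℝ ∞ (fun t : ℝ => (Complex.arg (g x) + t) / k) :=
      (contDiff_const.add contDiff_id).div_const _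
    exact contMDiff_circleExp.comp_contMDiffOn (h2.contMDiff.comp_contMDiffOn hf)
  · intro y _
    have hk' : (k : ℝ) ≠ 0 := Int.cast_ne_zero.2 hk
    rw [← Circle.exp_zsmul, zsmul_eq_mul, mul_div_cancel₀ _ hk', Circle.exp_add, Circle.exp_arg]
    simp only [f, Complex.log_im]
    rw [Circle.exp_arg, mul_inv_cancel_left]

end CircleRoot

/-! ### Local trivializations with lens space fibre. -/

namespace ProjBundle

variable {n : ℕ} {V B F : Type*} {E : B → Type*}
  [∀ x, AddCommGroup (E x)] [∀ x, Module ℂ (E x)] [TopologicalSpace (TotalSpace F E)]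
  [NormedAddCommGroup V] [NormedSpace ℂ V] [TopologicalSpace B] [NormedAddCommGroup F]
  [NormedSpace ℂ F] [∀ x, TopologicalSpace (E x)] [FiberBundle F E] [VectorBundle ℂ F E]
  [Fact (Module.finrank ℂ F = n + 1)] [ChartedSpace V B] [IsManifold 𝓘(ℂ, V) ω B]
  [ContMDiffVectorBundle ω F E 𝓘(ℂ, V)]
  {c : OpenPartialHomeomorph B V} {e : Trivialization F (π F E)}
  [MemTrivializationAtlas e] {w₁ : {w : F // w ≠ 0}}
  {X M : Type*} [NormedAddCommGroup X] [NormedSpace ℝ X]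
  [TopologicalSpace M] [ChartedSpace X M] [MulAction Circle M]
  {p : M → ProjBundle F E}

/-- The composition of a principal circle bundle over `ℙ(E)` with `ℙ(E) → B` is trivial, with a
lens space as fibre, where the tautological projection has an equivariant lift. -/
theorem exists_isSmoothTrivialization_lensSpace
    (hp : IsPrincipalCircleBundle 𝓘(ℝ, X) 𝓘(ℝ, V × EuclideanSpace ℂ (Fin n)) p)
    (hc : c ∈ atlas V B) {K : Set V} (hK : IsOpen K)
    (hKc : K ⊆ c.target ∩ c.symm ⁻¹' e.baseSet) {Φ : V × F → M}
    (hΦ : ContMDiffOn 𝓘(ℝ, V × F) 𝓘(ℝ, X) ∞ Φ (K ×ˢ {0}ᶜ))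
    (hΦp : ∀ x ∈ K ×ˢ ({0}ᶜ : Set F), p (Φ x) = homCoord c e w₁ x) {k : ℤ} (hk : k ≠ 0)
    (hΦk : ∀ u ∈ K, ∀ w ≠ 0, ∀ a : Circle, Φ (u, (a : ℂ) • w) = a ^ k • Φ (u, w))
    (l : ℕ) [NeZero l] (hl : l = k.natAbs) :
    ∃ e' : Trivialization (LensSpace n l) (fun m => (p m).proj),
      e'.baseSet = c.source ∩ c ⁻¹' K ∧
        IsSmoothTrivialization 𝓘(ℝ, X) 𝓘(ℝ, V) (𝓡 (2 * n + 1)) e' := by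
  have : FiniteDimensional ℂ F := .of_fact_finrank_eq_succ n
  have hfin : Module.finrank ℂ F = n + 1 := Fact.out
  let L : EuclideanSpace ℂ (Fin (n + 1)) ≃L[ℂ] F := .ofFinrankEq (by simp [hfin])
  let U := c.source ∩ c ⁻¹' K
  have hU : IsOpen U := c.isOpen_inter_preimage hK
  have hz0 : ∀ z : OddSphere n, L (z : EuclideanSpace ℂ (Fin (n + 1))) ≠ 0 := fun z => by
    simpa using ne_zero_of_mem_unit_sphere z
  have : Nonempty (OddSphere n) := (NormedSpace.sphere_nonempty.2 zero_le_one).to_subtype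
  have hnorm : ∀ z : OddSphere n, ‖(z : EuclideanSpace ℂ (Fin (n + 1)))‖ = 1 := fun z =>
    norm_eq_of_mem_sphere z
  have hcs : ContMDiffOn 𝓘(ℝ, V) 𝓘(ℝ, V) ∞ c c.source :=
    ((contMDiffOn_of_mem_maximalAtlas (IsManifold.subset_maximalAtlas
      (I := 𝓘(ℂ, V)) (n := ω) hc)).real_of_complex).of_le (by exact le_top)
  have hLs : ContDiff ℝ ∞ L := (L.contDiff (n := ∞)).restrict_scalars ℝ
  have hLsymm : ContDiff ℝ ∞ L.symm := (L.symm.contDiff (n := ∞)).restrict_scalars ℝ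
  have hprs : ContMDiff 𝓘(ℝ, V × EuclideanSpace ℂ (Fin n)) 𝓘(ℝ, V) ∞
      (proj : ProjBundle F E → B) := fun x =>
    (((contMDiff_proj (n := n) (V := V) (F := F) (E := E)).contMDiffAt
      (x := x)).contMDiffWithinAt (s := univ)).real_of_complex.of_le (by exact le_top)
  have hpr : ContMDiff 𝓘(ℝ, X) 𝓘(ℝ, V) ∞ (fun m => (p m).proj) := hprs.comp hp.contMDiff_proj
  have hpΦ : ∀ x ∈ U, ∀ z : OddSphere n, p (Φ (c x, L z)) = homCoord c e w₁ (c x, L z) :=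
    fun x hx z => hΦp _ ⟨hx.2, hz0 z⟩
  refine exists_isSmoothTrivialization_of_quotient (S := OddSphere n) (I₃ := 𝓡 (2 * n + 1))
    (q := LensSpace.mk) (θ := fun y => Φ (c y.1, L y.2)) hpr hU ?_ LensSpace.contMDiff_mk
    LensSpace.exists_section ?_ ?_ ?_
  · refine hΦ.comp (ContMDiffOn.prodMk_space ?_ ?_) ?_
    · exact hcs.comp contMDiffOn_fst fun y hy => hy.1.1
    · exact ((hLs.contMDiff.comp contMDiff_coe_sphere).comp contMDiff_snd).contMDiffOn
    · exact fun y hy => ⟨hy.1.2, hz0 _⟩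
  · intro x hx z
    rw [hpΦ x hx]
    exact c.left_inv hx.1
  · intro x hx z z'
    rw [LensSpace.mk_eq_mk_iff]
    constructor
    -- Equal images lie on the same line of the fibre of `ℙ(E)`, so the unit vectors differ by some
    -- `a` in the circle; equivariance and freeness give `a ^ k = 1`.
    · intro h
      have h1 := congrArg p h
      rw [hpΦ x hx, hpΦ x hx, homCoord_eq_iff _ _ _ _ (hz0 _) (hz0 _)] at h1
      obtain ⟨s, hs⟩ := h1
      rw [← map_smul, EmbeddingLike.apply_eq_iff_eq] at hs
      have hs1 : ‖s‖ = 1 := by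
        have := congrArg norm hs
        rwa [norm_smul, hnorm, hnorm, mul_one] at this
      let a : Circle := ⟨s, mem_sphere_zero_iff_norm.2 hs1⟩
      have h2 := hΦk _ hx.2 _ (hz0 z') a
      rw [← map_smul] at h2
      have h3 : (a : ℂ) • (z' : EuclideanSpace ℂ (Fin (n + 1))) = z := hs
      rw [h3] at h2
      have h4 : a ^ k = 1 := hp.smul_left_cancel_of_eq
        (h2.symm.trans (h.trans (one_smul _ _).symm))
      have h5 : a ^ l = 1 := by
        rw [hl]
        exact pow_natAbs_eq_one.2 h4
      have h6 : s ^ l = 1 := by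
        have := congrArg (fun a : Circle => (a : ℂ)) h5
        simpa using this
      refine ⟨rootsOfUnity.mkOfPowEq s h6, Subtype.ext ?_⟩
      exact hs
    · rintro ⟨r, hr⟩
      let a : Circle := ⟨((r : ℂˣ) : ℂ), mem_sphere_zero_iff_norm.2
        (Complex.norm_eq_one_of_mem_rootsOfUnity r.2)⟩
      have h5 : a ^ l = 1 := by
        ext
        have := congrArg (fun r : ℂˣ => (r : ℂ)) ((mem_rootsOfUnity l (r : ℂˣ)).1 r.2)
        rw [Circle.coe_pow, Circle.coe_one]
        simpa using this
      have h4 : a ^ k = 1 := by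
        rw [hl] at h5
        exact pow_natAbs_eq_one.1 h5
      have h3 : (a : ℂ) • (z' : EuclideanSpace ℂ (Fin (n + 1))) = z := congrArg Subtype.val hr
      have h2 := hΦk _ hx.2 _ (hz0 z') a
      rw [← map_smul, h3, h4, one_smul] at h2
      exact h2
  -- A local inverse: normalized homogeneous coordinates of `p m` give a point of `M` in the same
  -- circle as `m`, off by some `g m`. Rotating the unit vector by a local `k`-th root of `g`
  -- corrects this.
  · intro m hm
    obtain ⟨O, ζ, hO, hmO, hζ, hζ'⟩ := exists_homCoord_section (n := n) c e w₁ hc (p m)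
      ⟨hm.1, by simpa [c.left_inv hm.1] using (hKc hm.2).2⟩
    let z₀ : OddSphere n := Classical.arbitrary _
    let O₁ := p ⁻¹' O ∩ (fun m => (p m).proj) ⁻¹' U
    have hO₁ : IsOpen O₁ := (hO.preimage hp.contMDiff_proj.continuous).inter
      (hU.preimage hpr.continuous)
    let w : M → EuclideanSpace ℂ (Fin (n + 1)) := fun m => L.symm (ζ (p m))
    have hw0 : ∀ m ∈ O₁, w m ≠ 0 := fun m hm => by simpa [w] using (hζ' _ hm.1).2.1
    have hws : ContMDiffOn 𝓘(ℝ, X) 𝓘(ℝ, EuclideanSpace ℂ (Fin (n + 1))) ∞ w O₁ :=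
      hLsymm.contMDiff.comp_contMDiffOn ((hζ.real_of_complex.of_le (by exact le_top)).comp
        hp.contMDiff_proj.contMDiffOn fun m hm => hm.1)
    have hrs : ContMDiffOn 𝓘(ℝ, X) (𝓡 (2 * n + 1)) ∞ (fun m => sphereRetract z₀ (w m)) O₁ :=
      (contMDiffOn_sphereRetract z₀).comp hws hw0
    have hr : ∀ m ∈ O₁, L (sphereRetract z₀ (w m)) = ((‖w m‖⁻¹ : ℝ) : ℂ) • ζ (p m) :=
      fun m hm => by
        rw [coe_sphereRetract z₀ (hw0 m hm), ← Complex.coe_smul, map_smul]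
        simp [w]
    have hf₁ : ContMDiffOn 𝓘(ℝ, X) 𝓘(ℝ, X) ∞
        (fun m => Φ (c (p m).proj, L (sphereRetract z₀ (w m)))) O₁ :=
      hΦ.comp (ContMDiffOn.prodMk_space (hcs.comp hpr.contMDiffOn fun m hm => hm.2.1)
        ((hLs.contMDiff.comp contMDiff_coe_sphere).comp_contMDiffOn hrs))
        fun m hm => ⟨hm.2.2, hz0 _⟩
    have hpf : ∀ m ∈ O₁, p (Φ (c (p m).proj, L (sphereRetract z₀ (w m)))) = p m :=
      fun m hm => by
        rw [hpΦ _ hm.2, hr m hm, homCoord_smul]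
        · exact (hζ' _ hm.1).2.2
        · simpa using hw0 m hm
    obtain ⟨g, hg, hgf⟩ := hp.exists_contMDiffOn_smul_eq hf₁ contMDiffOn_id hpf
    obtain ⟨O₂, a, hO₂, hO₂o, hmO₂, ha, hag⟩ := hg.exists_circle_root hO₁ ⟨hmO, hm⟩ hk
    have haw0 : ∀ m ∈ O₂, (a m : ℂ) • w m ≠ 0 := fun m hm =>
      smul_ne_zero (Circle.coe_ne_zero _) (hw0 m (hO₂ hm))
    refine ⟨O₂, fun m => sphereRetract z₀ ((a m : ℂ) • w m), hO₂o, hmO₂, ?_, ?_⟩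
    · refine (contMDiffOn_sphereRetract z₀).comp ?_ haw0
      have hsmul : ContDiff ℝ ∞ (fun y : ℂ × EuclideanSpace ℂ (Fin (n + 1)) => y.1 • y.2) :=
        contDiff_fst.smul contDiff_snd
      exact hsmul.contMDiff.comp_contMDiffOn
        ((Circle.contMDiff_coe.comp_contMDiffOn ha).prodMk_space (hws.mono hO₂))
    · intro m hm
      have h1 : (sphereRetract z₀ ((a m : ℂ) • w m) : EuclideanSpace ℂ (Fin (n + 1))) =
          (a m : ℂ) • (sphereRetract z₀ (w m) : EuclideanSpace ℂ (Fin (n + 1))) := by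
        rw [coe_sphereRetract z₀ (haw0 m hm), coe_sphereRetract z₀ (hw0 m (hO₂ hm)), norm_smul,
          Circle.norm_coe, one_mul, smul_comm]
      simp only [h1, map_smul]
      rw [hΦk _ (hO₂ hm).2.2 _ (hz0 _), hag m hm]
      exact (hgf m (hO₂ hm)).symm

end ProjBundle

/-! ### Uniqueness of the weight and the global statement. -/

namespace ProjBundle

variable {n : ℕ} {V B F : Type*} {E : B → Type*}
  [∀ x, AddCommGroup (E x)] [∀ x, Module ℂ (E x)] [TopologicalSpace (TotalSpace F E)]
  [NormedAddCommGroup V] [NormedSpace ℂ V] [TopologicalSpace B] [NormedAddCommGroup F]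
  [NormedSpace ℂ F] [∀ x, TopologicalSpace (E x)] [FiberBundle F E] [VectorBundle ℂ F E]
  {X M : Type*} [NormedAddCommGroup X] [NormedSpace ℝ X]
  [TopologicalSpace M] [ChartedSpace X M] [MulAction Circle M]

variable (X) in
/-- The tautological projection `E x ∖ 0 → ℙ(E x)` lifts to a map to the circle bundle
`p : M → ℙ(E)` that is equivariant of weight `k`. -/
def IsWeight (p : M → ProjBundle F E) (x : B) (k : ℤ) : Prop :=
  ∃ (T : F ≃ₗ[ℂ] E x) (φ : F → M), ContMDiffOn 𝓘(ℝ, F) 𝓘(ℝ, X) ∞ φ {0}ᶜ ∧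
    (∀ (w : F) (hw : w ≠ 0), p (φ w) = ⟨x, .mk ℂ (T w) (by simpa using hw)⟩) ∧
    ∀ w ≠ 0, ∀ a : Circle, φ ((a : ℂ) • w) = a ^ k • φ w

/-- After a linear change of coordinates, two equivariant lifts differ by a circle-valued `g` on `F
∖ 0` with `g (a • w) = a ^ (k' - k) * g w`. Since `F ∖ 0` has no first cohomology, `g` has a
logarithm, so its winding number `k' - k` along a circle orbit is zero. -/
theorem IsWeight.unique [Fact (Module.finrank ℂ F = n + 1)] [ChartedSpace V B] (hn : 1 ≤ n)
    {p : M → ProjBundle F E}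
    (hp : IsPrincipalCircleBundle 𝓘(ℝ, X) 𝓘(ℝ, V × EuclideanSpace ℂ (Fin n)) p) {x : B} {k k' : ℤ}
    (h : IsWeight X p x k) (h' : IsWeight X p x k') : k = k' := by
  have : FiniteDimensional ℂ F := .of_fact_finrank_eq_succ n
  have hfin : Module.finrank ℂ F = n + 1 := Fact.out
  have : Nontrivial F := Module.nontrivial_of_finrank_pos (R := ℂ) (by lia)
  obtain ⟨T, φ, hφ, hφp, hφk⟩ := h
  obtain ⟨T', φ', hφ', hφp', hφk'⟩ := h'
  let S : F ≃L[ℂ] F := (T.trans T'.symm).toContinuousLinearEquiv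
  have hS : ∀ w, T' (S w) = T w := fun w => by
    change T' (T'.symm (T w)) = T w
    simp
  have hS0 : ∀ w : F, w ≠ 0 → S w ≠ 0 := fun w hw => by simpa using hw
  have hφS : ContMDiffOn 𝓘(ℝ, F) 𝓘(ℝ, X) ∞ (fun w => φ' (S w)) {0}ᶜ :=
    hφ'.comp ((S.contDiff (n := ∞)).restrict_scalars ℝ).contMDiff.contMDiffOn hS0
  obtain ⟨g, hg, hgφ⟩ := hp.exists_contMDiffOn_smul_eq hφ hφS fun w hw => by
    rw [hφp w hw, hφp' _ (hS0 w hw)]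
    simp only [hS]
  have hga : ∀ w ≠ 0, ∀ a : Circle, g ((a : ℂ) • w) = a ^ (k' - k) * g w := fun w hw a => by
    have hw' : (a : ℂ) • w ≠ 0 := smul_ne_zero (Circle.coe_ne_zero a) hw
    have h1 := hgφ _ hw'
    simp only [map_smul, hφk w hw, hφk' _ (hS0 w hw), hgφ w hw, smul_smul] at h1
    have h2 := hp.smul_left_cancel_of_eq h1
    rw [zpow_sub, mul_right_comm, ← div_eq_mul_inv, h2, mul_div_assoc]
    simp
  -- The factor `ℝ` is a dummy convex set.
  have hlog : HasLog ((univ : Set ℝ) ×ˢ ({0}ᶜ : Set F)) :=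
    hasLog_prod_compl_zero (by rw [finrank_real_of_complex, hfin]; lia) convex_univ isOpen_univ
  obtain ⟨f, hf, hfg⟩ := hlog (fun y => g y.2)
    (hg.continuousOn.comp continuousOn_snd fun y hy => hy.2)
  obtain ⟨w, hw⟩ := exists_ne (0 : F)
  have hc : Continuous fun t : ℝ => ((0 : ℝ), (Circle.exp t : ℂ) • w) := by fun_prop
  obtain ⟨j, hj⟩ := (isPreconnected_univ (α := ℝ)).circle_log_unique
    (f₁ := fun t : ℝ => f (0, (Circle.exp t : ℂ) • w)) (f₂ := fun t => f (0, w) + (k' - k : ℤ) * t)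
    (hf.comp hc.continuousOn fun t _ => ⟨trivial, smul_ne_zero (Circle.coe_ne_zero _) hw⟩)
    (by fun_prop) fun t _ => by
      rw [hfg (0, (Circle.exp t : ℂ) • w) ⟨trivial, smul_ne_zero (Circle.coe_ne_zero _) hw⟩,
        Circle.exp_add, Circle.exp_intCast_mul, hfg (0, w) ⟨trivial, hw⟩, hga w hw, mul_comm]
  have h0 := hj 0 trivial
  have h1 := hj (2 * Real.pi) trivial
  simp only [Circle.exp_zero, Circle.coe_one, one_smul, mul_zero, add_zero,
    Circle.exp_two_pi] at h0 h1
  have h2 : ((k' - k : ℤ) : ℝ) * (2 * Real.pi) = 0 := by linarith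
  have h3 : ((k' - k : ℤ) : ℝ) = 0 := (mul_eq_zero.1 h2).resolve_right (by positivity)
  have h4 : k' - k = 0 := by exact_mod_cast h3
  lia

variable [Fact (Module.finrank ℂ F = n + 1)] [ChartedSpace V B] [IsManifold 𝓘(ℂ, V) ω B]
  [ContMDiffVectorBundle ω F E 𝓘(ℂ, V)] [FiniteDimensional ℂ V]

/-- Here `n ≥ 1` enters: the real dimension `2n + 2` of `F` is at least four, so homogeneous
coordinates lift over a small ball of base points, and the lift can be made equivariant. -/
theorem exists_equivariant_lift_homCoord (hn : 1 ≤ n) {p : M → ProjBundle F E}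
    (hp : IsPrincipalCircleBundle 𝓘(ℝ, X) 𝓘(ℝ, V × EuclideanSpace ℂ (Fin n)) p)
    (w₁ : {w : F // w ≠ 0}) (b : B) :
    ∃ (K : Set V) (k : ℤ) (Φ : V × F → M), IsOpen K ∧ chartAt V b b ∈ K ∧
      K ⊆ (chartAt V b).target ∩ (chartAt V b).symm ⁻¹' (trivializationAt F E b).baseSet ∧
      ContMDiffOn 𝓘(ℝ, V × F) 𝓘(ℝ, X) ∞ Φ (K ×ˢ {0}ᶜ) ∧
      (∀ x ∈ K ×ˢ ({0}ᶜ : Set F),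
        p (Φ x) = homCoord (chartAt V b) (trivializationAt F E b) w₁ x) ∧
      ∀ u ∈ K, ∀ w ≠ 0, ∀ a : Circle, Φ (u, (a : ℂ) • w) = a ^ k • Φ (u, w) := by
  have : FiniteDimensional ℂ F := .of_fact_finrank_eq_succ n
  have hfin : Module.finrank ℂ F = n + 1 := Fact.out
  set c := chartAt V b
  set e := trivializationAt F E b
  let D := c.target ∩ c.symm ⁻¹' e.baseSet
  have hD : IsOpen D := c.symm.continuousOn.isOpen_inter_preimage c.open_target e.open_baseSet
  have hb : c b ∈ D := ⟨mem_chart_target V b, by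
    simpa [c, e] using mem_baseSet_trivializationAt F E b⟩
  have hq : ContMDiffOn 𝓘(ℝ, V × F) 𝓘(ℝ, V × EuclideanSpace ℂ (Fin n)) ∞ (homCoord c e w₁)
      (D ×ˢ {0}ᶜ) :=
    (contMDiffOn_homCoord c e w₁ (chart_mem_atlas V b)).real_of_complex.of_le (by exact le_top)
  obtain ⟨δ, hδ, hlift⟩ := hp.exists_hasLift
    (by rw [finrank_real_of_complex, hfin]; lia : 4 ≤ Module.finrank ℝ F) hD hq
    (fun u _ w r hr => homCoord_smul c e w₁ u w (a := (r : ℂ)) (by simpa using hr.ne')) hb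
  obtain ⟨ε, hε, hεD⟩ := Metric.isOpen_iff.1 hD _ hb
  have hlift' := hlift.mono (prod_mono_left (Metric.ball_subset_ball (min_le_left δ ε)))
  obtain ⟨k, Φ, h1, h2, h3⟩ := hp.exists_equivariant_lift
    (by rw [finrank_real_of_complex, hfin]; lia : 3 ≤ Module.finrank ℝ F) (convex_ball _ _)
    Metric.isOpen_ball
    (fun u _ w _ a => homCoord_smul c e w₁ u w (Circle.coe_ne_zero a)) hlift'
  exact ⟨Metric.ball (c b) (min δ ε), k, Φ, Metric.isOpen_ball,
    Metric.mem_ball_self (by positivity),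
    (Metric.ball_subset_ball (min_le_right δ ε)).trans hεD, h1, h2, h3⟩

/-- A Boothby–Wang bundle over the projectivization of a holomorphic vector bundle of rank at
least two, with positive curvature, is a bundle of lens spaces over a connected base. -/
theorem exists_isSmoothFiberBundle_lensSpace [IsManifold 𝓘(ℝ, X) ∞ M] [ConnectedSpace B]
    (hn : 1 ≤ n) {p : M → ProjBundle F E} {η : DiffForm X M 1}
    {κ : DiffForm (V × EuclideanSpace ℂ (Fin n)) (ProjBundle F E) 2} (hM : IsBoothbyWang p η κ)
    (hκ : ∀ (x : ProjBundle F E) (u : V × EuclideanSpace ℂ (Fin n)), u ≠ 0 →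
      0 < κ x ![u, Complex.I • u]) :
    ∃ l : ℕ+, IsSmoothFiberBundle 𝓘(ℝ, X) 𝓘(ℝ, V) (𝓡 (2 * n + 1)) (LensSpace n l)
      (fun m : M => (p m).proj) := by
  have : FiniteDimensional ℂ F := .of_fact_finrank_eq_succ n
  have hfin : Module.finrank ℂ F = n + 1 := Fact.out
  have : Nontrivial F := Module.nontrivial_of_finrank_pos (R := ℂ) (by lia)
  let w₁ : {w : F // w ≠ 0} := ⟨_, (exists_ne (0 : F)).choose_spec⟩
  have hp := hM.principal
  choose K k Φ hK hbK hKc hΦ hΦp hΦk using exists_equivariant_lift_homCoord hn hp w₁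
  have hweight : ∀ b x, x ∈ (chartAt V b).source → chartAt V b x ∈ K b → IsWeight X p x (k b) := by
    intro b x hx hxK
    refine ⟨(fiberEquiv (trivializationAt F E b) x).symm, fun w => Φ b (chartAt V b x, w), ?_,
      fun w hw => ?_, fun w hw a => hΦk b _ hxK w hw a⟩
    · exact (hΦ b).comp (contMDiffOn_const.prodMk_space contMDiffOn_id) fun w hw => ⟨hxK, hw⟩
    · rw [hΦp b (chartAt V b x, w) ⟨hxK, hw⟩, homCoord_chart _ _ _ hx hw]
  -- The lift constructed around `b` also computes the weight at all nearby points `x`, where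
  -- uniqueness identifies it with `k x`.
  have hlc : IsLocallyConstant k := by
    rw [IsLocallyConstant.iff_exists_open]
    intro b
    refine ⟨(chartAt V b).source ∩ chartAt V b ⁻¹' K b,
      (chartAt V b).isOpen_inter_preimage (hK b), ⟨mem_chart_source V b, hbK b⟩, fun x hx => ?_⟩
    exact (hweight x x (mem_chart_source V x) (hbK x)).unique hn hp (hweight b x hx.1 hx.2)
  obtain ⟨b₀⟩ : Nonempty B := inferInstance
  have hk0 : ∀ b, k b ≠ 0 := fun b =>
    weight_ne_zero (chartAt V b) (trivializationAt F E b) w₁ hM hκ hn (chart_mem_atlas V b)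
      (hKc b (hbK b)) (φ := fun w => Φ b (chartAt V b b, w))
      ((hΦ b).comp (contMDiffOn_const.prodMk_space contMDiffOn_id) fun w hw => ⟨hbK b, hw⟩)
      (fun w hw => hΦp b _ ⟨hbK b, hw⟩) (hΦk b _ (hbK b))
  obtain ⟨l, hl⟩ : ∃ l : ℕ+, (l : ℕ) = (k b₀).natAbs :=
    ⟨⟨(k b₀).natAbs, Int.natAbs_pos.2 (hk0 b₀)⟩, rfl⟩
  refine ⟨l, fun b => ?_⟩
  obtain ⟨e, he, hs⟩ := exists_isSmoothTrivialization_lensSpace hp (chart_mem_atlas V b) (hK b)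
    (hKc b) (hΦ b) (hΦp b) (hk0 b) (hΦk b) (l : ℕ)
    (by rw [hl, hlc.apply_eq_of_preconnectedSpace b b₀])
  exact ⟨e, he ▸ ⟨mem_chart_source V b, hbK b⟩, hs⟩

end ProjBundle

theorem proposition4p1 {d_0 d_inf : ℕ}
    -- `N` is a compact connected complex manifold
    {V N : Type*} [NormedAddCommGroup V] [NormedSpace ℂ V] [FiniteDimensional ℂ V]
    [TopologicalSpace N] [ChartedSpace V N] [IsManifold 𝓘(ℂ, V) ω N]
    [T2Space N] [CompactSpace N] [ConnectedSpace N]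
    -- `E_0`, `E_inf` are holomorphic vector bundles on `N` of ranks `d_0 + 1` and `d_inf + 1`
    {E_0 E_inf : N → Type*}
    [∀ x, AddCommGroup (E_0 x)] [∀ x, Module ℂ (E_0 x)] [∀ x, TopologicalSpace (E_0 x)]
    [TopologicalSpace (TotalSpace (EuclideanSpace ℂ (Fin (d_0 + 1))) E_0)]
    [FiberBundle (EuclideanSpace ℂ (Fin (d_0 + 1))) E_0]
    [VectorBundle ℂ (EuclideanSpace ℂ (Fin (d_0 + 1))) E_0]
    [ContMDiffVectorBundle ω (EuclideanSpace ℂ (Fin (d_0 + 1))) E_0 𝓘(ℂ, V)]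
    [∀ x, AddCommGroup (E_inf x)] [∀ x, Module ℂ (E_inf x)] [∀ x, TopologicalSpace (E_inf x)]
    [TopologicalSpace (TotalSpace (EuclideanSpace ℂ (Fin (d_inf + 1))) E_inf)]
    [FiberBundle (EuclideanSpace ℂ (Fin (d_inf + 1))) E_inf]
    [VectorBundle ℂ (EuclideanSpace ℂ (Fin (d_inf + 1))) E_inf]
    [ContMDiffVectorBundle ω (EuclideanSpace ℂ (Fin (d_inf + 1))) E_inf 𝓘(ℂ, V)]
    -- `κ` is a Kähler form on `ℙ(E_0 ⊕ E_inf)`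
    (κ : DiffForm (V × EuclideanSpace ℂ (Fin (d_0 + d_inf + 1)))
      (ProjBundle (EuclideanSpace ℂ (Fin (d_0 + 1)) × EuclideanSpace ℂ (Fin (d_inf + 1)))
        (E_0 ×ᵇ E_inf)) 2)
    (hκ : IsKahlerForm κ)
    -- `p : M → ℙ(E_0 ⊕ E_inf)` with the contact form `η` is the Boothby-Wang bundle
    {X M : Type*} [NormedAddCommGroup X] [NormedSpace ℝ X] [FiniteDimensional ℝ X]
    [TopologicalSpace M] [ChartedSpace X M] [IsManifold 𝓘(ℝ, X) ∞ M] [MulAction Circle M]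
    (p : M → ProjBundle (EuclideanSpace ℂ (Fin (d_0 + 1)) × EuclideanSpace ℂ (Fin (d_inf + 1)))
      (E_0 ×ᵇ E_inf))
    (η : DiffForm X M 1) (hM : IsBoothbyWang p η κ) :
    ∃ l : ℕ+, IsSmoothFiberBundle 𝓘(ℝ, X) 𝓘(ℝ, V) (𝓡 (2 * (d_0 + d_inf + 1) + 1))
      (LensSpace (d_0 + d_inf + 1) l) (fun m : M => (p m).proj) := by
  -- The direct sum is treated as a single bundle, with `n = d_0 + d_inf + 1 ≥ 1`.
  exact ProjBundle.exists_isSmoothFiberBundle_lensSpace (by lia) hM hκ.pos
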